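/- Let $N\ge 3$ and let $P_1,\dots,P_N$ be complex (for instance real) $3\times 4$ matrices ("cameras"); let $f_i,g_i,h_i$ be the linear forms on $\mathbb{C}^4$ given by the rows of $P_i$. Assume that the cameras are in general position, i.e. no four of the $3N$ planes $\{f_i=0\},\{g_i=0\},\{h_i=0\}\subset\mathbb{P}^3$ have a common point, and that the camera centers $q_i=\{f_i=g_i=h_i=0\}$ do not all lie on one line. Put $H_i=\{h_i=0\}$ (the camera planes), $L_{ij}=H_i\cap H_j$ and $p_{ijk}=H_i\cap H_j\cap H_k$. Let $$\phi:\mathbb{P}^3\dashrightarrow\mathbb{P}^{2N},\qquad \phi=\Big(f_1\prod_{j\ne1}h_j: g_1\prod_{j\neq 1}h_j:\dots: f_N\prod_{j\ne N}h_j: g_N\prod_{j\ne N}h_j:\prod_{j}h_j\Big),$$ and let $MV_N\subset\mathbb{P}^{2N}$ be the Zariski closure of its image (the multiview variety). Let $\pi:\tilde{\mathbb{P}}^3\to\mathbb{P}^3$ be the blow-up of $\mathbb{P}^3$ at all points $q_i$ ($1\le i\le N$) and $p_{ijk}$ ($i<j<k$), followed by the blow-up of the proper transforms of all lines $L_{ij}$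 ($i<j$). For a morphism $f:Y\to X$ of smooth varieties, let $\Delta^i(f)$ be the set of $x\in X$ such that for every $(i-1)$-dimensional subspace $V\subset T_xX$ there is a point $y\in f^{-1}(x)$ with $V+f_*T_yY\ne T_xX$. Then $\phi\circ\pi$ extends to a morphism $\tilde\phi:\tilde{\mathbb{P}}^3\to\mathbb{P}^{2N}$. Let $X_i\subset\mathbb{P}^{2N}$ be the image under $\tilde\phi$ of the proper transform of $H_i$. The sets $X_1,\dots,X_N$ are pairwise disjoint lines in $\mathbb{P}^{2N}$ (in particular $X_i\cong\mathbb{P}^1$), and $$\Delta^{2N-3}(\tilde\phi)=MV_N,\qquad \Delta^{2N-2}(\tilde\phi)=\Delta^{2N-1}(\tilde\phi)=\coprod_{i=1}^N X_i,\qquad \Delta^{2N}(\tilde\phi)=\emptyset .$$ -/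

import Mathlib

open scoped LinearAlgebra.Projectivization

noncomputable section

namespace Multiview

/-! ### Varieties in products of projective spaces -/

section General

variable {ι κ : Type} {d : ι → ℕ} {e : κ → ℕ} {τ : Type}

/-- The product of the complex projective spaces `ℙ(ℂ ^ d a)`, for `a : ι`. -/
abbrev MultiProj {ι : Type} (d : ι → ℕ) : Type := ∀ a, ℙ ℂ (Fin (d a) → ℂ)

/-- The multihomogeneous coordinates on `MultiProj d`. -/
abbrev Coord {ι : Type} (d : ι → ℕ) : Type := Σ a, Fin (d a)

/-- `v` is a system of multihomogeneous coordinates of the point `y`. -/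
def IsLift (v : Coord d → ℂ) (y : MultiProj d) : Prop :=
  ∀ a, ∃ h : (fun k => v ⟨a, k⟩) ≠ 0, Projectivization.mk ℂ (fun k => v ⟨a, k⟩) h = y a

/-- The ideal of a subset `Y`: the polynomials that vanish at all multihomogeneous coordinates
of all points of `Y` (it is generated by its multihomogeneous elements, since the set of all
lifts of points of `Y` is stable under scaling each block of coordinates). -/
def vanishingIdeal (Y : Set (MultiProj d)) : Ideal (MvPolynomial (Coord d) ℂ) where
  carrier := {F | ∀ y ∈ Y, ∀ v, IsLift v y → MvPolynomial.eval v F = 0}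
  zero_mem' := fun _ _ _ _ => map_zero _
  add_mem' := fun {F G} hF hG y hy v hv => by
    rw [map_add, hF y hy v hv, hG y hy v hv, add_zero]
  smul_mem' := fun c F hF y hy v hv => by
    rw [smul_eq_mul, map_mul, hF y hy v hv, mul_zero]

/-- Zariski closure in a product of projective spaces. -/
def zariskiClosure (Y : Set (MultiProj d)) : Set (MultiProj d) :=
  {y | ∀ F ∈ vanishingIdeal Y, ∀ v, IsLift v y → MvPolynomial.eval v F = 0}

/-- Simultaneous blow-up of `Y` along the ideals generated by the families of multihomogeneous
forms `F k`, for `k : κ`: the Zariski closure, in `Y × ∏ k, ℙ(ℂ ^ e k)`, of the graph of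
`y ↦ ([F k (y)])_k`, the graph being taken over the points of `Y` at which no family `F k`
vanishes identically. The projection to `Y` forgets the factors indexed by `κ`. -/
def blowUp (Y : Set (MultiProj d)) (F : ∀ k, Fin (e k) → MvPolynomial (Coord d) ℂ) :
    Set (MultiProj (Sum.elim d e)) :=
  zariskiClosure {z | ∃ y ∈ Y, ∃ v, IsLift v y ∧ (∀ i, z (Sum.inl i) = y i) ∧
    ∀ k, ∃ h : (fun r => MvPolynomial.eval v (F k r)) ≠ 0,
      z (Sum.inr k) = Projectivization.mk ℂ (fun r => MvPolynomial.eval v (F k r)) h}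

/-- The polynomials `F t` are homogeneous coordinates of `f y` at every point `y` of `Y` at which
they do not all vanish. -/
def Represents (Y : Set (MultiProj d)) (f : Y → ℙ ℂ (τ → ℂ))
    (F : τ → MvPolynomial (Coord d) ℂ) : Prop :=
  ∀ y : Y, ∀ v, IsLift v y.1 → ∀ h : (fun t => MvPolynomial.eval v (F t)) ≠ 0,
    Projectivization.mk ℂ (fun t => MvPolynomial.eval v (F t)) h = f y

/-- Morphisms from an irreducible variety `Y` to a projective space: around every point the map
is given by polynomials in the multihomogeneous coordinates that have no common zero there. -/
def IsMorphism (Y : Set (MultiProj d)) (f : Y → ℙ ℂ (τ → ℂ)) : Prop :=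
  ∀ y : Y, ∃ F : τ → MvPolynomial (Coord d) ℂ, Represents Y f F ∧
    ∃ v, IsLift v y.1 ∧ (fun t => MvPolynomial.eval v (F t)) ≠ 0

/-- The differential of the polynomial `F` at `v`. -/
def polyDifferential [Fintype ι] (F : MvPolynomial (Coord d) ℂ) (v : Coord d → ℂ) :
    (Coord d → ℂ) →ₗ[ℂ] ℂ :=
  ∑ c, MvPolynomial.eval v (MvPolynomial.pderiv c F) • LinearMap.proj c

/-- The Zariski tangent space at `v` of the multicone over `Y`. If `v` lifts `y ∈ Y`, then the
tangent space `T_y Y` is the quotient of this space by the directions that scale the blocks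
of `v`. -/
def coneTangent [Fintype ι] (Y : Set (MultiProj d)) (v : Coord d → ℂ) :
    Submodule ℂ (Coord d → ℂ) :=
  ⨅ F ∈ vanishingIdeal Y, LinearMap.ker (polyDifferential F v)

/-- The tangent space of a projective space `ℙ(E)` at the line `x ⊆ E`, as `E ⧸ x`. (It is
canonically `Hom(x, E ⧸ x)`; choosing a nonzero vector of `x` identifies the two, and a
different choice only multiplies the identification by a scalar.) -/
abbrev ProjTangent {E : Type} [AddCommGroup E] [Module ℂ E] (x : ℙ ℂ E) : Type :=
  E ⧸ x.submodule

/-- The image `f_* T_y Y ⊆ T_x ℙ` of the differential of a morphism `f : Y → ℙ` at a point `y`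
with `f y = x`. A tangent vector of `Y` at `y` is represented by a tangent vector `w` to the
multicone at a lift `v` of `y`, and it is sent to the class of the derivative at `v` along `w` of
polynomials that represent `f` near `y`. (The resulting subspace does not depend on the choice of
`v` and of the polynomials; scaling directions `w` are sent to `0`.) -/
def differentialRange [Fintype ι] (Y : Set (MultiProj d)) (f : Y → ℙ ℂ (τ → ℂ)) (y : Y)
    (x : ℙ ℂ (τ → ℂ)) : Submodule ℂ (ProjTangent x) :=
  Submodule.span ℂ {z | ∃ (v : Coord d → ℂ) (F : τ → MvPolynomial (Coord d) ℂ)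
    (w : Coord d → ℂ), IsLift v y.1 ∧ Represents Y f F ∧
      (fun t => MvPolynomial.eval v (F t)) ≠ 0 ∧ w ∈ coneTangent Y v ∧
      z = x.submodule.mkQ (fun t => polyDifferential (F t) v w)}

/-- The `i`-th higher discriminant of `f : Y → ℙ`: the points `x` such that for every
`(i - 1)`-dimensional subspace `V` of `T_x ℙ` there is a point `y` in the fibre over `x` such
that `V` and `f_* T_y Y` do not span `T_x ℙ`. -/
def higherDiscriminant [Fintype ι] (Y : Set (MultiProj d)) (f : Y → ℙ ℂ (τ → ℂ)) (i : ℕ) :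
    Set (ℙ ℂ (τ → ℂ)) :=
  {x | ∀ V : Submodule ℂ (ProjTangent x), Module.finrank ℂ V + 1 = i →
    ∃ y : Y, f y = x ∧ V ⊔ differentialRange Y f y x ≠ ⊤}

/-- Zariski closure in a single projective space. -/
def projZariskiClosure (S : Set (ℙ ℂ (τ → ℂ))) : Set (ℙ ℂ (τ → ℂ)) :=
  {x | ∀ F : MvPolynomial τ ℂ,
    (∀ (u : τ → ℂ) (hu : u ≠ 0), Projectivization.mk ℂ u hu ∈ S → MvPolynomial.eval u F = 0) →
    ∀ (u : τ → ℂ) (hu : u ≠ 0), Projectivization.mk ℂ u hu = x → MvPolynomial.eval u F = 0}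

/-- `S` is a line in the projective space, that is, the image of a linear embedding of `ℙ¹`. -/
def IsProjectiveLine (S : Set (ℙ ℂ (τ → ℂ))) : Prop :=
  ∃ (L : (Fin 2 → ℂ) →ₗ[ℂ] (τ → ℂ)) (hL : Function.Injective L),
    S = Set.range (Projectivization.map L hL)

end General

/-! ### Cameras -/

section Cameras

variable {N : ℕ}

/-- The `3N` planes given by the rows of the camera matrices are in general position:
no four of them have a common point in `ℙ³`. -/
def GeneralPosition (P : Fin N → Matrix (Fin 3) (Fin 4) ℂ) : Prop :=
  ∀ r : Fin 4 ↪ Fin N × Fin 3, LinearIndependent ℂ (fun k => P (r k).1 (r k).2)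

/-- All camera centers lie on one line of `ℙ³`. (The center `q_i` of the `i`-th camera is the
point of `ℙ³` given by the kernel of the matrix `P i`.) -/
def CollinearCenters (P : Fin N → Matrix (Fin 3) (Fin 4) ℂ) : Prop :=
  ∃ L : Submodule ℂ (Fin 4 → ℂ), Module.finrank ℂ L = 2 ∧
    ∀ i, LinearMap.ker (P i).mulVecLin ≤ L

/-- The linear form given by row `r` of the `i`-th camera matrix (rows `0`, `1`, `2` are `f_i`,
`g_i`, `h_i`), as a polynomial in the four variables `X (c 0), …, X (c 3)`. -/
def rowForm {σ : Type} (P : Fin N → Matrix (Fin 3) (Fin 4) ℂ) (c : Fin 4 → σ)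
    (i : Fin N) (r : Fin 3) : MvPolynomial σ ℂ :=
  ∑ j, MvPolynomial.C (P i r j) * MvPolynomial.X (c j)

/-- Indices of the `2N + 1` homogeneous coordinates of `ℙ^{2N}`: two for every camera, and a
last one. -/
abbrev ImgIndex (N : ℕ) : Type := Option (Fin N × Fin 2)

/-- The forms that define the camera map: `f_i ∏_{j ≠ i} h_j`, `g_i ∏_{j ≠ i} h_j`
(for the indices `(i, 0)`, `(i, 1)`) and `∏_j h_j` (for the last index). -/
def cameraForm (P : Fin N → Matrix (Fin 3) (Fin 4) ℂ) : ImgIndex N → MvPolynomial (Fin 4) ℂ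
  | some (i, b) => rowForm P id i b.castSucc * ∏ j ∈ Finset.univ.erase i, rowForm P id j 2
  | none => ∏ j, rowForm P id j 2

/-- The values of the forms `cameraForm` at a vector `p`. Where it is nonzero,
`φ [p] = [cameraVec P p]`. -/
def cameraVec (P : Fin N → Matrix (Fin 3) (Fin 4) ℂ) (p : Fin 4 → ℂ) : ImgIndex N → ℂ :=
  fun t => MvPolynomial.eval p (cameraForm P t)

/-- The multiview variety `MV_N ⊆ ℙ^{2N}`: the closure of the image of the rational map `φ`. -/
def multiviewVariety (P : Fin N → Matrix (Fin 3) (Fin 4) ℂ) : Set (ℙ ℂ (ImgIndex N → ℂ)) :=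
  projZariskiClosure {x | ∃ (p : Fin 4 → ℂ) (h : cameraVec P p ≠ 0),
    Projectivization.mk ℂ (cameraVec P p) h = x}

/-! ### The resolution -/

/-- Triples `i < j < k` of cameras. -/
abbrev Triple (N : ℕ) : Type := {t : Fin N × Fin N × Fin N // t.1 < t.2.1 ∧ t.2.1 < t.2.2}

/-- Pairs `i < j` of cameras. -/
abbrev Pair (N : ℕ) : Type := {t : Fin N × Fin N // t.1 < t.2}

/-- `MultiProj dims₀` is `ℙ³`. -/
abbrev dims₀ : Unit → ℕ := fun _ => 4

/-- `MultiProj (dims₁ N)` is `ℙ³` times a `ℙ²` for every `i` and for every `i < j < k`. -/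
abbrev dims₁ (N : ℕ) : Unit ⊕ (Fin N ⊕ Triple N) → ℕ := Sum.elim dims₀ (fun _ => 3)

/-- `MultiProj (dims₂ N)` is `MultiProj (dims₁ N)` times a `ℙ¹` for every `i < j`. -/
abbrev dims₂ (N : ℕ) : (Unit ⊕ (Fin N ⊕ Triple N)) ⊕ Pair N → ℕ := Sum.elim (dims₁ N) (fun _ => 2)

/-- Generators of the ideals of the points blown up in the first step: `f_i, g_i, h_i` for the
camera center `q_i`, and `h_i, h_j, h_k` for the point `p_{ijk} = H_i ∩ H_j ∩ H_k`. -/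
def pointForms (P : Fin N → Matrix (Fin 3) (Fin 4) ℂ) :
    (k : Fin N ⊕ Triple N) → Fin 3 → MvPolynomial (Coord dims₀) ℂ
  | Sum.inl i => fun r => rowForm P (fun c => ⟨(), c⟩) i r
  | Sum.inr t => ![rowForm P (fun c => ⟨(), c⟩) t.1.1 2, rowForm P (fun c => ⟨(), c⟩) t.1.2.1 2,
      rowForm P (fun c => ⟨(), c⟩) t.1.2.2 2]

/-- `Y₁`: the blow-up of `ℙ³` at the points `q_i` and `p_{ijk}`. -/
def firstBlowUp (P : Fin N → Matrix (Fin 3) (Fin 4) ℂ) : Set (MultiProj (dims₁ N)) :=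
  blowUp Set.univ (pointForms P)

/-- The pullbacks to `Y₁` of the equations `h_i, h_j` of the line `L_{ij} = H_i ∩ H_j`. -/
def lineForms (P : Fin N → Matrix (Fin 3) (Fin 4) ℂ) (t : Pair N) :
    Fin 2 → MvPolynomial (Coord (dims₁ N)) ℂ :=
  ![rowForm P (fun c => ⟨Sum.inl (), c⟩) t.1.1 2, rowForm P (fun c => ⟨Sum.inl (), c⟩) t.1.2 2]

/-- The resolution `Y₂`: the blow-up of `Y₁` along the proper transforms of the lines
`L_{ij}`. (On `Y₁` the pullbacks of `h_i` and `h_j` generate the product of the ideal of the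
proper transform of `L_{ij}` with the invertible ideal of the exceptional divisors over the
points `p_{ijk}` of `L_{ij}`; an invertible factor does not affect the blow-up.) -/
def resolution (P : Fin N → Matrix (Fin 3) (Fin 4) ℂ) : Set (MultiProj (dims₂ N)) :=
  blowUp (firstBlowUp P) (lineForms P)

/-- The composite blow-down map `π` to `ℙ³`. -/
def blowDown (y : MultiProj (dims₂ N)) : ℙ ℂ (Fin 4 → ℂ) := y (Sum.inl (Sum.inl ()))

/-- `φ'` is the resolved camera map: the morphism from the resolution to `ℙ^{2N}` that extends
the rational map `φ ∘ π`. -/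
def IsResolvedMap (P : Fin N → Matrix (Fin 3) (Fin 4) ℂ)
    (φ' : resolution P → ℙ ℂ (ImgIndex N → ℂ)) : Prop :=
  IsMorphism (resolution P) φ' ∧
    ∀ (y : resolution P) (p : Fin 4 → ℂ) (hp : p ≠ 0), blowDown y.1 = Projectivization.mk ℂ p hp →
      ∀ h : cameraVec P p ≠ 0, φ' y = Projectivization.mk ℂ (cameraVec P p) h

/-- The proper transform in the resolution of the camera plane `H_i = {h_i = 0}`: the closure of
the preimage of the part of `H_i` that contains no center `q_j` and meets no line `L_{jk}` (the
points `p_{jkl}` lie on these lines). -/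
def cameraPlaneTransform (P : Fin N → Matrix (Fin 3) (Fin 4) ℂ) (i : Fin N) :
    Set (MultiProj (dims₂ N)) :=
  zariskiClosure {y | y ∈ resolution P ∧ ∃ (p : Fin 4 → ℂ) (hp : p ≠ 0),
    blowDown y = Projectivization.mk ℂ p hp ∧ (P i).mulVec p 2 = 0 ∧
    (∀ j, (P j).mulVec p ≠ 0) ∧
    ∀ j k, j ≠ k → ¬ ((P j).mulVec p 2 = 0 ∧ (P k).mulVec p 2 = 0)}

/-- `X_i`: the image under the resolved map of the proper transform of the `i`-th camera plane. -/
def cameraPlaneImage (P : Fin N → Matrix (Fin 3) (Fin 4) ℂ)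
    (φ' : resolution P → ℙ ℂ (ImgIndex N → ℂ)) (i : Fin N) : Set (ℙ ℂ (ImgIndex N → ℂ)) :=
  {x | ∃ y : resolution P, y.1 ∈ cameraPlaneTransform P i ∧ φ' y = x}

end Cameras

end Multiview

end

/-! The multicone over the resolution is the closure of the vectors whose blocks are arbitrary
multiples `l a` of the defining forms evaluated at `p`. Its ideal is therefore the kernel of a ring
map `pullback` into a polynomial ring (`mem_vanishingIdeal_resolution`). A solution of these
equations in a ℂ-algebra is an `IPoint`: over ℂ it gives a point, over the dual numbers a tangent
vector, over power series an arc. A relation has to be checked only at the generic point, in a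
domain, and then holds for points, tangent vectors and arcs alike.

The resolved map is given locally by families of polynomials proportional to the camera forms at the
generic point (`Compatible`). Over a center, the block of the exceptional plane replaces the
vanishing row values. Elsewhere the ratios `h_i : h_j`, which are coordinates on the resolution,
allow the common factor of the camera forms to be divided out. The map is onto `MV_N` by a valuative
argument (`exists_resolvedMap_eq`).

On `H_i` every camera form except the two of camera `i` vanishes, so the proper transform of `H_i`
is projected from `q_i` onto a coordinate line `X_i` (`cameraPlaneImage_eq`). Two different points
of ℙ³ with equal images in all cameras span a line through all the centers, which is excluded. Off
the lines `X_i` the resolved map is therefore injective (`IPoint.ext_of_image`), and the linearized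
argument shows that it is an immersion there. Tangent vectors are computed in two kinds of charts:
near points over no center, the coordinates are `h_i/h_j`, `h_j/h_k`, `h_k` and `f_i` for suitable
`i, j, k` (`IsFlag`); over a center they are those of the blow-up of a point (`IsOverCenter`). The
rank of the differential is at most 3 everywhere and equal to 3 off the lines. Counting dimensions
gives the discriminant of index `2N-3` and places that of index `2N-2` inside the lines.

Let `x` lie on `X_i`. Its fibre contains the transform of a line `r + t q` in `H_i` through the
center `q`. Let `L` be a linear form vanishing on the line `X_i`, with constant `L₀` on the last
coordinate vector and parts `λ_m` belonging to the cameras. The image of the tangent space at the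
point `t` lies in `ker L` as soon as the rational function `L₀ + ∑ λ_m/h_m` of `t` vanishes there;
at a pole the condition is that the total residue is zero, and `t = ∞` is the point over `q`. Such a
`t` always exists (`exists_zero_or_residue`, `exists_isCritical`). Hence a hyperplane through the
tangent direction of `X_i` always contains the image of some tangent space of the fibre, which
settles the index `2N-1`.

For the index `2N`, a hyperplane is chosen that avoids the tangent direction of `X_i` and finitely
many directions attached to the points `p_{ijk}`. The image of the tangent space at each point of
the fibre contains, modulo the image point and up to a nonzero scalar, one of these directions
(`PointData.exists_tangent_ne_zero`), so this hyperplane is transversal to all of them. -/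

noncomputable section

namespace Multiview

open MvPolynomial

/-! ### Lifts, closures and tangent vectors in products of projective spaces. -/

section ProductsOfProjectiveSpaces

open TrivSqZeroExt

variable {ι κ : Type} {d : ι → ℕ} {e : κ → ℕ} {τ : Type}

/-- Scaling of the blocks of a vector of multihomogeneous coordinates. -/
def scaleVec {R : Type*} [CommRing R] [Algebra ℂ R] (μ : ι → ℂ) (V : Coord d → R) : Coord d → R :=
  fun c => μ c.1 • V c

/-- The substitution `X_c ↦ μ_c X_c` with one scalar for each block. -/
def scaleHom (d : ι → ℕ) (μ : ι → ℂ) : MvPolynomial (Coord d) ℂ →ₐ[ℂ] MvPolynomial (Coord d) ℂ :=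
  aeval (fun c => C (μ c.1) * X c)

lemma aeval_scaleHom {R : Type*} [CommRing R] [Algebra ℂ R] (μ : ι → ℂ) (V : Coord d → R)
    (F : MvPolynomial (Coord d) ℂ) :
    aeval V (scaleHom d μ F) = aeval (scaleVec μ V) F := by
  have : (aeval V).comp (scaleHom d μ) = aeval (R := ℂ) (scaleVec μ V) := by
    ext c
    simp [scaleHom, scaleVec, Algebra.smul_def]
  exact congrArg (fun φ => φ F) this

lemma eval_scaleHom (μ : ι → ℂ) (v : Coord d → ℂ) (F : MvPolynomial (Coord d) ℂ) :
    eval v (scaleHom d μ F) = eval (scaleVec μ v) F := aeval_scaleHom μ v F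

lemma exists_isLift (y : MultiProj d) : ∃ v, IsLift v y :=
  ⟨fun c => (y c.1).rep c.2, fun a => ⟨(y a).rep_nonzero, (y a).mk_rep⟩⟩

lemma isLift_iff_exists_scaleVec {v v' : Coord d → ℂ} {y : MultiProj d} (hv : IsLift v y) :
    IsLift v' y ↔ ∃ μ : ι → ℂ, (∀ a, μ a ≠ 0) ∧ v' = scaleVec μ v := by
  constructor
  · intro hv'
    have key : ∀ a, ∃ m : ℂ, m ≠ 0 ∧ ∀ k, v' ⟨a, k⟩ = m * v ⟨a, k⟩ := by
      intro a
      obtain ⟨h, e⟩ := hv a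
      obtain ⟨h', e'⟩ := hv' a
      obtain ⟨m, hm⟩ := (Projectivization.mk_eq_mk_iff' ℂ _ _ h' h).1 (e'.trans e.symm)
      refine ⟨m, ?_, fun k => (congrFun hm k).symm⟩
      rintro rfl
      exact h' (by rw [← hm, zero_smul])
    choose μ h1 h2 using key
    exact ⟨μ, h1, funext fun c => h2 c.1 c.2⟩
  · rintro ⟨μ, hμ, rfl⟩ a
    obtain ⟨h, e⟩ := hv a
    have e2 : (fun k => scaleVec μ v ⟨a, k⟩) = μ a • fun k => v ⟨a, k⟩ := rfl
    have h' : (fun k => scaleVec μ v ⟨a, k⟩) ≠ 0 := by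
      rw [e2]; exact smul_ne_zero (hμ a) h
    refine ⟨h', ?_⟩
    rw [← e]
    exact (Projectivization.mk_eq_mk_iff' ℂ _ _ h' h).2 ⟨μ a, rfl⟩

lemma IsLift.ne_zero {v : Coord d → ℂ} {y : MultiProj d} (hv : IsLift v y) (a : ι) :
    (fun k => v ⟨a, k⟩) ≠ 0 := (hv a).1

/-- The point with given multihomogeneous coordinates. -/
def ofLift (v : Coord d → ℂ) (hv : ∀ a, (fun k => v ⟨a, k⟩) ≠ 0) : MultiProj d :=
  fun a => Projectivization.mk ℂ _ (hv a)

lemma isLift_ofLift (v : Coord d → ℂ) (hv : ∀ a, (fun k => v ⟨a, k⟩) ≠ 0) :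
    IsLift v (ofLift v hv) := fun a => ⟨hv a, rfl⟩

lemma IsLift.ext {v : Coord d → ℂ} {y y' : MultiProj d} (h : IsLift v y) (h' : IsLift v y') :
    y = y' := funext fun a => (h a).2.symm.trans (h' a).2

/-- The lifts of a point are stable under scaling of the blocks. This invariance is what allows
every later test to be made at one chosen lift. -/
lemma scaleHom_mem_vanishingIdeal {Y : Set (MultiProj d)} {F : MvPolynomial (Coord d) ℂ}
    (hF : F ∈ vanishingIdeal Y) {μ : ι → ℂ} (hμ : ∀ a, μ a ≠ 0) :
    scaleHom d μ F ∈ vanishingIdeal Y := by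
  intro y hy v hv
  rw [eval_scaleHom]
  exact hF y hy _ ((isLift_iff_exists_scaleVec hv).2 ⟨μ, hμ, rfl⟩)

lemma mem_zariskiClosure_iff {Y : Set (MultiProj d)} {y : MultiProj d} {v : Coord d → ℂ}
    (hv : IsLift v y) :
    y ∈ zariskiClosure Y ↔ ∀ F ∈ vanishingIdeal Y, eval v F = 0 := by
  refine ⟨fun h F hF => h F hF v hv, fun h F hF v' hv' => ?_⟩
  obtain ⟨μ, hμ, rfl⟩ := (isLift_iff_exists_scaleVec hv).1 hv'
  rw [← eval_scaleHom]
  exact h _ (scaleHom_mem_vanishingIdeal hF hμ)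

lemma subset_zariskiClosure (Y : Set (MultiProj d)) : Y ⊆ zariskiClosure Y :=
  fun y hy _ hF v hv => hF y hy v hv

lemma vanishingIdeal_zariskiClosure (Y : Set (MultiProj d)) :
    vanishingIdeal (zariskiClosure Y) = vanishingIdeal Y := by
  ext F
  exact ⟨fun h y hy => h y (subset_zariskiClosure Y hy), fun h y hy v hv => hy F h v hv⟩

/-- First order Taylor expansion. It turns rules for `polyDifferential` into identities of ring
homomorphisms to the dual numbers. -/
lemma aeval_dual [Fintype ι] (v w : Coord d → ℂ) (F : MvPolynomial (Coord d) ℂ) :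
    aeval (fun c => (inl (v c) + inr (w c) : DualNumber ℂ)) F
      = inl (eval v F) + inr (polyDifferential F v w) := by
  induction F using MvPolynomial.induction_on with
  | C a =>
    have : polyDifferential (C a : MvPolynomial (Coord d) ℂ) v w = 0 := by
      simp [polyDifferential]
    rw [this]
    simp [TrivSqZeroExt.algebraMap_eq_inl]
  | add p q hp hq =>
    have : polyDifferential (p + q) v w = polyDifferential p v w + polyDifferential q v w := by
      simp [polyDifferential, add_mul, Finset.sum_add_distrib]
    rw [map_add, hp, hq, this, map_add, inl_add, inr_add]
    abel
  | mul_X p c hp =>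
    have : polyDifferential (p * X c) v w = eval v p * w c + polyDifferential p v w * v c := by
      classical
      simp only [polyDifferential, Derivation.leibniz, pderiv_X, map_add, smul_eq_mul, map_mul,
        LinearMap.sum_apply, LinearMap.smul_apply, LinearMap.proj_apply, add_mul,
        Finset.sum_add_distrib, eval_X, Finset.sum_mul]
      congr 1
      · rw [Finset.sum_eq_single c]
        · simp
        · intro b _ hb
          simp [hb.symm]
        · simp
      · exact Finset.sum_congr rfl fun _ _ => by ring
    rw [map_mul, hp, this, aeval_X, map_mul, eval_X]
    ext <;> simp

lemma snd_aeval_dual [Fintype ι] (v w : Coord d → ℂ) (F : MvPolynomial (Coord d) ℂ) :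
    (aeval (fun c => (inl (v c) + inr (w c) : DualNumber ℂ)) F).snd = polyDifferential F v w := by
  rw [aeval_dual]; simp

lemma mem_coneTangent [Fintype ι] {Y : Set (MultiProj d)} {v w : Coord d → ℂ} :
    w ∈ coneTangent Y v ↔ ∀ F ∈ vanishingIdeal Y, polyDifferential F v w = 0 := by
  simp [coneTangent, Submodule.mem_iInf]

/-- Tangent vectors are the points over the dual numbers: the constant part of each equation already
vanishes because `y` lies in `Y`. -/
lemma mem_coneTangent_iff_dual [Fintype ι] {Y : Set (MultiProj d)} {y : MultiProj d} (hy : y ∈ Y)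
    {v w : Coord d → ℂ} (hv : IsLift v y) :
    w ∈ coneTangent Y v ↔ ∀ F ∈ vanishingIdeal Y,
      aeval (fun c => (inl (v c) + inr (w c) : DualNumber ℂ)) F = 0 := by
  rw [mem_coneTangent]
  refine forall₂_congr fun F hF => ?_
  rw [aeval_dual, hF y hy v hv]
  constructor
  · intro h; rw [h]; simp
  · intro h
    simpa using congrArg TrivSqZeroExt.snd h

lemma polyDifferential_scaleHom [Fintype ι] (μ : ι → ℂ) (v w : Coord d → ℂ)
    (F : MvPolynomial (Coord d) ℂ) :
    polyDifferential (scaleHom d μ F) v w = polyDifferential F (scaleVec μ v) (scaleVec μ w) := by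
  rw [← snd_aeval_dual, aeval_scaleHom, ← snd_aeval_dual]
  congr 3
  funext c
  ext <;> simp [scaleVec]

lemma polyDifferential_mul [Fintype ι] (v w : Coord d → ℂ) (F G : MvPolynomial (Coord d) ℂ) :
    polyDifferential (F * G) v w
      = eval v F * polyDifferential G v w + polyDifferential F v w * eval v G := by
  rw [← snd_aeval_dual, map_mul, aeval_dual, aeval_dual]
  simp

lemma polyDifferential_sub [Fintype ι] (v w : Coord d → ℂ) (F G : MvPolynomial (Coord d) ℂ) :
    polyDifferential (F - G) v w = polyDifferential F v w - polyDifferential G v w := by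
  rw [← snd_aeval_dual, map_sub, aeval_dual, aeval_dual]
  simp

/-- Two families of polynomials that represent the same map are proportional modulo the
vanishing ideal. -/
lemma Represents.cross_mem {Y : Set (MultiProj d)} {f : Y → ℙ ℂ (τ → ℂ)}
    {F G : τ → MvPolynomial (Coord d) ℂ} (hF : Represents Y f F) (hG : Represents Y f G) (s t : τ) :
    F t * G s - F s * G t ∈ vanishingIdeal Y := by
  intro y hy v hv
  simp only [map_sub, map_mul]
  by_cases h1 : (fun t => eval v (F t)) = 0
  · have := fun t => congrFun h1 t
    simp only [Pi.zero_apply] at this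
    simp [this]
  by_cases h2 : (fun t => eval v (G t)) = 0
  · have := fun t => congrFun h2 t
    simp only [Pi.zero_apply] at this
    simp [this]
  obtain ⟨m, hm⟩ := (Projectivization.mk_eq_mk_iff' ℂ _ _ h1 h2).1
    ((hF ⟨y, hy⟩ v hv h1).trans (hG ⟨y, hy⟩ v hv h2).symm)
  have := fun t => congrFun hm t
  simp only [Pi.smul_apply, smul_eq_mul] at this
  rw [← this, ← this]
  ring

lemma Represents.scaleHom {Y : Set (MultiProj d)} {f : Y → ℙ ℂ (τ → ℂ)}
    {F : τ → MvPolynomial (Coord d) ℂ} (hF : Represents Y f F) {μ : ι → ℂ} (hμ : ∀ a, μ a ≠ 0) :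
    Represents Y f (fun t => scaleHom d μ (F t)) := by
  intro y v hv h
  simp only [eval_scaleHom] at h ⊢
  exact hF y _ ((isLift_iff_exists_scaleVec hv).2 ⟨μ, hμ, rfl⟩) h

/-- The derivative of a family of polynomials at `v`. -/
def familyDifferential [Fintype ι] (F : τ → MvPolynomial (Coord d) ℂ) (v : Coord d → ℂ) :
    (Coord d → ℂ) →ₗ[ℂ] (τ → ℂ) :=
  LinearMap.pi fun t => polyDifferential (F t) v

lemma scaleVec_mem_coneTangent [Fintype ι] {Y : Set (MultiProj d)} {v w : Coord d → ℂ}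
    {μ : ι → ℂ} (hμ : ∀ a, μ a ≠ 0) (h : w ∈ coneTangent Y v) :
    scaleVec μ w ∈ coneTangent Y (scaleVec μ v) := by
  rw [mem_coneTangent] at h ⊢
  intro F hF
  rw [← polyDifferential_scaleHom]
  exact h _ (scaleHom_mem_vanishingIdeal hF hμ)

lemma scaleVec_inv {R : Type*} [CommRing R] [Algebra ℂ R] {μ : ι → ℂ} (hμ : ∀ a, μ a ≠ 0)
    (v : Coord d → R) : scaleVec (fun a => (μ a)⁻¹) (scaleVec μ v) = v := by
  funext c
  simp [scaleVec, hμ c.1]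

/-- The image of the differential can be computed with a single lift of the point and a single
family of polynomials. -/
lemma differentialRange_eq [Fintype ι] {Y : Set (MultiProj d)} {f : Y → ℙ ℂ (τ → ℂ)} {y : Y}
    {x : ℙ ℂ (τ → ℂ)} (hx : f y = x) {F : τ → MvPolynomial (Coord d) ℂ} (hF : Represents Y f F)
    {v : Coord d → ℂ} (hv : IsLift v y.1) (hFv : (fun t => eval v (F t)) ≠ 0) :
    differentialRange Y f y x
      = (coneTangent Y v).map (x.submodule.mkQ ∘ₗ familyDifferential F v) := by
  apply le_antisymm
  · refine Submodule.span_le.2 ?_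
    rintro _ ⟨v', G, w', hv', hG, hGv, hw', rfl⟩
    obtain ⟨μ, hμ, rfl⟩ := (isLift_iff_exists_scaleVec hv).1 hv'
    set w := scaleVec (fun a => (μ a)⁻¹) w' with hw
    have hw1 : scaleVec μ w = w' := by
      have := scaleVec_inv (fun a => inv_ne_zero (hμ a)) w'
      simpa using this
    have hwc : w ∈ coneTangent Y v := by
      have := scaleVec_mem_coneTangent (fun a => inv_ne_zero (hμ a)) hw'
      rwa [scaleVec_inv hμ] at this
    -- Differentiating the proportionality of the two families along `w` shows that their
    -- derivatives agree, up to the factor `m`, modulo the image vector.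
    have hcross := fun s t => mem_coneTangent.1 hwc _ ((hG.scaleHom hμ).cross_mem hF s t)
    simp only [polyDifferential_sub, polyDifferential_mul, polyDifferential_scaleHom,
      eval_scaleHom, hw1] at hcross
    have hGF : ∃ m : ℂ, ∀ t, eval (scaleVec μ v) (G t) = m * eval v (F t) := by
      obtain ⟨m, hm⟩ := (Projectivization.mk_eq_mk_iff' ℂ _ _ hGv hFv).1
        ((hG y _ hv' hGv).trans (hF y v hv hFv).symm)
      exact ⟨m, fun t => (congrFun hm t).symm⟩
    obtain ⟨m, hm⟩ := hGF
    obtain ⟨s, hs⟩ := Function.ne_iff.1 hFv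
    simp only [Pi.zero_apply] at hs
    refine ⟨m • w, Submodule.smul_mem _ _ hwc, ?_⟩
    rw [LinearMap.comp_apply, map_smul]
    simp only [Submodule.mkQ_apply]
    rw [Submodule.Quotient.eq]
    have hxs : x.submodule = Submodule.span ℂ {fun t => eval v (F t)} := by
      rw [← hx, ← hF y v hv hFv, Projectivization.submodule_mk]
    rw [hxs, Submodule.mem_span_singleton]
    refine ⟨(m * polyDifferential (F s) v w - polyDifferential (G s) (scaleVec μ v) w') /
      eval v (F s), funext fun t => ?_⟩
    have := hcross s t
    rw [hm s, hm t] at this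
    simp only [Pi.smul_apply, smul_eq_mul, Pi.sub_apply, familyDifferential, LinearMap.pi_apply]
    field_simp
    linear_combination this
  · rintro _ ⟨w, hw, rfl⟩
    exact Submodule.subset_span ⟨v, F, w, hv, hF, hFv, hw, rfl⟩

/-- A representing family that does not vanish at a prescribed lift. -/
lemma IsMorphism.exists_represents {Y : Set (MultiProj d)} {f : Y → ℙ ℂ (τ → ℂ)}
    (hf : IsMorphism Y f) (y : Y) {v : Coord d → ℂ} (hv : IsLift v y.1) :
    ∃ F : τ → MvPolynomial (Coord d) ℂ, Represents Y f F ∧ (fun t => eval v (F t)) ≠ 0 := by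
  obtain ⟨F, hF, v', hv', h⟩ := hf y
  obtain ⟨μ, hμ, rfl⟩ := (isLift_iff_exists_scaleVec hv).1 hv'
  refine ⟨_, hF.scaleHom hμ, ?_⟩
  simpa only [eval_scaleHom] using h

end ProductsOfProjectiveSpaces

/-! ### The parametrization of the multicone, and its points over ℂ-algebras. -/

section Coordinates

variable {N : ℕ} {R S : Type*} [CommRing R] [Algebra ℂ R] [CommRing S] [Algebra ℂ S]

/-- Indices of the blocks of coordinates of the resolution. -/
abbrev Blk (N : ℕ) : Type := (Unit ⊕ (Fin N ⊕ Triple N)) ⊕ Pair N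

/-- The value of a row of a camera matrix at a vector with entries in a `ℂ`-algebra. -/
def rowVal (P : Fin N → Matrix (Fin 3) (Fin 4) ℂ) (i : Fin N) (r : Fin 3) (p : Fin 4 → R) : R :=
  ∑ j, algebraMap ℂ R (P i r j) * p j

/-- The three cameras of a triple. -/
def Triple.cam (t : Triple N) : Fin 3 → Fin N := ![t.1.1, t.1.2.1, t.1.2.2]

/-- The two cameras of a pair. -/
def Pair.cam (t : Pair N) : Fin 2 → Fin N := ![t.1.1, t.1.2]

/-- The forms on `ℂ⁴` that define the blocks of the resolution. -/
def blockForm (P : Fin N → Matrix (Fin 3) (Fin 4) ℂ) (p : Fin 4 → R) :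
    (a : Blk N) → Fin (dims₂ N a) → R
  | Sum.inl (Sum.inl ()) => p
  | Sum.inl (Sum.inr (Sum.inl i)) => fun r => rowVal P i r p
  | Sum.inl (Sum.inr (Sum.inr t)) => fun r => rowVal P (t.cam r) 2 p
  | Sum.inr t => fun r => rowVal P (t.cam r) 2 p

/-- Multihomogeneous coordinates of the graph point over `p`. -/
def graphVec (P : Fin N → Matrix (Fin 3) (Fin 4) ℂ) (p : Fin 4 → R) (l : Blk N → R) :
    Coord (dims₂ N) → R := fun c => l c.1 * blockForm P p c.1 c.2

lemma map_rowVal (φ : R →ₐ[ℂ] S) (P : Fin N → Matrix (Fin 3) (Fin 4) ℂ) (i : Fin N) (r : Fin 3)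
    (p : Fin 4 → R) : φ (rowVal P i r p) = rowVal P i r (fun j => φ (p j)) := by
  simp [rowVal]

lemma map_blockForm (φ : R →ₐ[ℂ] S) (P : Fin N → Matrix (Fin 3) (Fin 4) ℂ) (p : Fin 4 → R)
    (a : Blk N) (k : Fin (dims₂ N a)) :
    φ (blockForm P p a k) = blockForm P (fun j => φ (p j)) a k := by
  rcases a with (⟨⟩ | i | t) | t
  · rfl
  all_goals exact map_rowVal _ _ _ _ _

lemma rowVal_smul (P : Fin N → Matrix (Fin 3) (Fin 4) ℂ) (i : Fin N) (r : Fin 3) (a : R)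
    (p : Fin 4 → R) : rowVal P i r (fun j => a * p j) = a * rowVal P i r p := by
  simp only [rowVal, Finset.mul_sum]
  exact Finset.sum_congr rfl fun _ _ => by ring

lemma rowVal_add (P : Fin N → Matrix (Fin 3) (Fin 4) ℂ) (i : Fin N) (r : Fin 3)
    (p q : Fin 4 → R) : rowVal P i r (fun j => p j + q j) = rowVal P i r p + rowVal P i r q := by
  simp [rowVal, mul_add, Finset.sum_add_distrib]

lemma aeval_rowForm {σ : Type} (P : Fin N → Matrix (Fin 3) (Fin 4) ℂ) (c : Fin 4 → σ)
    (i : Fin N) (r : Fin 3) (v : σ → R) :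
    aeval v (rowForm P c i r) = rowVal P i r (fun j => v (c j)) := by
  simp [rowForm, rowVal]

lemma eval_rowForm {σ : Type} (P : Fin N → Matrix (Fin 3) (Fin 4) ℂ) (c : Fin 4 → σ)
    (i : Fin N) (r : Fin 3) (v : σ → ℂ) :
    eval v (rowForm P c i r) = rowVal P i r (fun j => v (c j)) := aeval_rowForm P c i r v

/-- The coordinate ring of the space that parametrizes the multicone over the resolution. -/
abbrev ParamRing (N : ℕ) : Type := MvPolynomial (Fin 4 ⊕ Blk N) ℂ

/-- Pull-back of polynomials along the parametrization of the multicone over the resolution. -/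
def pullback (P : Fin N → Matrix (Fin 3) (Fin 4) ℂ) :
    MvPolynomial (Coord (dims₂ N)) ℂ →ₐ[ℂ] ParamRing N :=
  aeval (graphVec P (fun j => X (Sum.inl j)) (fun a => X (Sum.inr a)))

/-- Every graph vector is a specialization of the generic one, so evaluation there factors through
`pullback`. -/
lemma aeval_graphVec (P : Fin N → Matrix (Fin 3) (Fin 4) ℂ) (p : Fin 4 → R) (l : Blk N → R)
    (F : MvPolynomial (Coord (dims₂ N)) ℂ) :
    aeval (graphVec P p l) F = aeval (Sum.elim p l) (pullback P F) := by
  have : aeval (R := ℂ) (graphVec P p l) = (aeval (Sum.elim p l)).comp (pullback P) := by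
    ext c
    simp [pullback, graphVec, map_blockForm]
  exact congrArg (fun φ => φ F) this

/-- `V` satisfies all equations of the multicone over the resolution. -/
def IPoint (P : Fin N → Matrix (Fin 3) (Fin 4) ℂ) (V : Coord (dims₂ N) → R) : Prop :=
  ∀ F, pullback P F = 0 → aeval V F = 0

lemma IPoint.map {P : Fin N → Matrix (Fin 3) (Fin 4) ℂ} {V : Coord (dims₂ N) → R}
    (hV : IPoint P V) (φ : R →ₐ[ℂ] S) : IPoint P (fun c => φ (V c)) := by
  intro F hF
  have := congrArg φ (hV F hF)
  rw [map_zero, ← AlgHom.comp_apply, MvPolynomial.comp_aeval] at this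
  exact this

/-- A scaling of the blocks is absorbed by the parameters `l`. -/
lemma pullback_scaleHom_eq_zero {P : Fin N → Matrix (Fin 3) (Fin 4) ℂ}
    {F : MvPolynomial (Coord (dims₂ N)) ℂ} (hF : pullback P F = 0) (μ : Blk N → ℂ) :
    pullback P (scaleHom _ μ F) = 0 := by
  have : scaleVec μ (graphVec P (fun j => X (Sum.inl j)) (fun a => X (Sum.inr a)))
      = graphVec (R := ParamRing N) P (fun j => X (Sum.inl j)) (fun a => μ a • X (Sum.inr a)) := by
    funext c
    simp [scaleVec, graphVec]
  rw [pullback, aeval_scaleHom, this, aeval_graphVec, hF, map_zero]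

lemma IPoint.scaleVec {P : Fin N → Matrix (Fin 3) (Fin 4) ℂ} {V : Coord (dims₂ N) → R}
    (hV : IPoint P V) (μ : Blk N → ℂ) : IPoint P (scaleVec μ V) := by
  intro F hF
  rw [← aeval_scaleHom]
  exact hV _ (pullback_scaleHom_eq_zero hF μ)

/-- Points of the multicone with coordinates in an integral domain. -/
lemma IPoint.of_domain [IsDomain R] {P : Fin N → Matrix (Fin 3) (Fin 4) ℂ}
    {V : Coord (dims₂ N) → R} {p : Fin 4 → R} {m : Blk N → R} (hm : ∀ a, m a ≠ 0)
    (h : ∀ a k, m a * V ⟨a, k⟩ = blockForm P p a k) : IPoint P V := by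
  intro F hF
  let K := FractionRing R
  let φ : R →ₐ[ℂ] K := IsScalarTower.toAlgHom ℂ R K
  have hφ : Function.Injective φ := IsFractionRing.injective R K
  apply hφ
  -- Over the fraction field the factors `m a` are invertible and `V` becomes an honest graph
  -- vector.
  have hV : (fun c => φ (V c)) = graphVec P (fun j => φ (p j)) (fun a => (φ (m a))⁻¹) := by
    funext ⟨a, k⟩
    have h1 : φ (m a) ≠ 0 := by
      rw [Ne, map_eq_zero_iff φ hφ]; exact hm a
    simp only [graphVec]
    rw [← map_blockForm, ← h, map_mul]
    exact (inv_mul_cancel_left₀ h1 _).symm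
  rw [map_zero, ← AlgHom.comp_apply, MvPolynomial.comp_aeval, hV, aeval_graphVec, hF, map_zero]

end Coordinates

/-! ### Consequences of general position. -/

section GeneralPosition

variable {N : ℕ} {P : Fin N → Matrix (Fin 3) (Fin 4) ℂ}

lemma GeneralPosition.linearIndependent (hP : GeneralPosition P) {ρ : Fin 4 → Fin N × Fin 3}
    (hρ : Function.Injective ρ) : LinearIndependent ℂ (fun k => P (ρ k).1 (ρ k).2) :=
  hP ⟨ρ, hρ⟩

/-- A frame of `ℂ⁴` dual to four different rows of the camera matrices. -/
lemma GeneralPosition.exists_dual_frame (hP : GeneralPosition P) {ρ : Fin 4 → Fin N × Fin 3}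
    (hρ : Function.Injective ρ) :
    ∃ e : Fin 4 → Fin 4 → ℂ,
      (∀ a b, rowVal P (ρ a).1 (ρ a).2 (e b) = if a = b then 1 else 0) ∧
      ∀ {R : Type} [CommRing R] [Algebra ℂ R] (p : Fin 4 → R) (j : Fin 4),
        p j = ∑ b, rowVal P (ρ b).1 (ρ b).2 p * algebraMap ℂ R (e b j) := by
  let M : Matrix (Fin 4) (Fin 4) ℂ := fun k => P (ρ k).1 (ρ k).2
  have hM : IsUnit M := Matrix.linearIndependent_rows_iff_isUnit.1 (hP.linearIndependent hρ)
  have hdet : IsUnit M.det := (Matrix.isUnit_iff_isUnit_det _).1 hM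
  refine ⟨fun b j => M⁻¹ j b, fun a b => ?_, ?_⟩
  · have := congrFun (congrFun (Matrix.mul_nonsing_inv M hdet) a) b
    rw [Matrix.one_apply] at this
    rw [← this]
    rfl
  · intro R _ _ p j
    have h1 : ∀ k, ∑ b, M⁻¹ j b * M b k = if j = k then 1 else 0 := fun k => by
      have := congrFun (congrFun (Matrix.nonsing_inv_mul M hdet) j) k
      rwa [Matrix.one_apply, Matrix.mul_apply] at this
    calc p j = ∑ k, algebraMap ℂ R (if j = k then 1 else 0) * p k := by
          simp [Finset.sum_ite_eq]
      _ = ∑ k, ∑ b, algebraMap ℂ R (M⁻¹ j b * M b k) * p k := by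
          refine Finset.sum_congr rfl fun k _ => ?_
          rw [← h1 k, map_sum, Finset.sum_mul]
      _ = ∑ b, rowVal P (ρ b).1 (ρ b).2 p * algebraMap ℂ R (M⁻¹ j b) := by
          rw [Finset.sum_comm]
          refine Finset.sum_congr rfl fun b _ => ?_
          rw [rowVal, Finset.sum_mul]
          refine Finset.sum_congr rfl fun k _ => ?_
          rw [map_mul]
          ring

/-- Four different planes have no common point. -/
lemma GeneralPosition.eq_zero (hP : GeneralPosition P) {R : Type} [CommRing R] [Algebra ℂ R]
    {ρ : Fin 4 → Fin N × Fin 3} (hρ : Function.Injective ρ) {p : Fin 4 → R}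
    (h : ∀ b, rowVal P (ρ b).1 (ρ b).2 p = 0) : p = 0 := by
  obtain ⟨e, -, he⟩ := hP.exists_dual_frame hρ
  funext j
  rw [he p j]
  simp [h]

lemma exists_ne_of_three_le (hN : 3 ≤ N) (i : Fin N) : ∃ j, j ≠ i := by
  have : Nontrivial (Fin N) := Fin.nontrivial_iff_two_le.2 (by omega)
  exact exists_ne i

lemma injective_camera_rows {i j : Fin N} (hij : i ≠ j) (r : Fin 3) :
    Function.Injective (![(i, 0), (i, 1), (i, 2), (j, r)] : Fin 4 → Fin N × Fin 3) := by
  intro a b h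
  fin_cases a <;> fin_cases b <;> simp_all [hij.symm]

/-- The center of a camera lies on no plane of another camera. -/
lemma GeneralPosition.eq_zero_of_center (hP : GeneralPosition P) {R : Type} [CommRing R]
    [Algebra ℂ R] {i j : Fin N} (hij : i ≠ j) (r : Fin 3) {p : Fin 4 → R}
    (h : ∀ r, rowVal P i r p = 0) (h' : rowVal P j r p = 0) : p = 0 := by
  refine hP.eq_zero (injective_camera_rows hij r) fun b => ?_
  fin_cases b
  exacts [h 0, h 1, h 2, h']

lemma GeneralPosition.exists_rowVal_ne_zero (hP : GeneralPosition P) (hN : 3 ≤ N) (i : Fin N)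
    (r : Fin 3) : ∃ p : Fin 4 → ℂ, rowVal P i r p ≠ 0 := by
  obtain ⟨j, hj⟩ := exists_ne_of_three_le hN i
  obtain ⟨e, he, -⟩ := hP.exists_dual_frame (injective_camera_rows hj.symm 0)
  fin_cases r
  · have h1 := he 0 0
    rw [if_pos rfl] at h1
    exact ⟨e 0, fun h => one_ne_zero (h1.symm.trans h)⟩
  · have h1 := he 1 1
    rw [if_pos rfl] at h1
    exact ⟨e 1, fun h => one_ne_zero (h1.symm.trans h)⟩
  · have h1 := he 2 2
    rw [if_pos rfl] at h1
    exact ⟨e 2, fun h => one_ne_zero (h1.symm.trans h)⟩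

/-- The rows of the cameras at the generic point are non-zero. -/
lemma GeneralPosition.rowVal_X_ne_zero (hP : GeneralPosition P) (hN : 3 ≤ N) {σ : Type}
    {c : Fin 4 → σ} (hc : Function.Injective c) (i : Fin N) (r : Fin 3) :
    rowVal P i r (fun j => (X (c j) : MvPolynomial σ ℂ)) ≠ 0 := by
  obtain ⟨p, hp⟩ := hP.exists_rowVal_ne_zero hN i r
  intro h
  apply hp
  have := congrArg (aeval (Function.extend c p 0)) h
  rw [map_rowVal, map_zero] at this
  simpa [hc.extend_apply] using this

end GeneralPosition

/-! ### The ideal of the resolution as the kernel of the pull-back. -/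

section ResolutionIdeal

variable {N : ℕ} {P : Fin N → Matrix (Fin 3) (Fin 4) ℂ}

lemma eval_pointForms (P : Fin N → Matrix (Fin 3) (Fin 4) ℂ) (v : Coord dims₀ → ℂ)
    (k : Fin N ⊕ Triple N) (r : Fin 3) :
    eval v (pointForms P k r) = blockForm P (fun j => v ⟨(), j⟩) (Sum.inl (Sum.inr k)) r := by
  rcases k with i | t
  · exact eval_rowForm ..
  · fin_cases r <;> exact eval_rowForm ..

lemma eval_lineForms (P : Fin N → Matrix (Fin 3) (Fin 4) ℂ) (v : Coord (dims₁ N) → ℂ)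
    (t : Pair N) (r : Fin 2) :
    eval v (lineForms P t r) = blockForm P (fun j => v ⟨Sum.inl (), j⟩) (Sum.inr t) r := by
  fin_cases r <;> exact eval_rowForm ..

/-- The graph point over a point on none of the camera planes. -/
lemma graphVec_mem {p : Fin 4 → ℂ} (hp0 : p ≠ 0)
    (hp1 : ∀ i, ∃ r, rowVal P i r p ≠ 0)
    (hp2 : ∀ i j, i ≠ j → rowVal P i 2 p ≠ 0 ∨ rowVal P j 2 p ≠ 0)
    {l : Blk N → ℂ} (hl : ∀ a, l a ≠ 0) :
    ∃ hv, ofLift (graphVec P p l) hv ∈ resolution P := by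
  have hb : ∀ a, blockForm P p a ≠ 0 := by
    rintro ((⟨⟩ | i | t) | t) h
    · exact hp0 h
    · obtain ⟨r, hr⟩ := hp1 i
      exact hr (congrFun h r)
    · rcases hp2 t.1.1 t.1.2.1 t.2.1.ne with h' | h'
      · exact h' (congrFun h (0 : Fin 3))
      · exact h' (congrFun h (1 : Fin 3))
    · rcases hp2 t.1.1 t.1.2 t.2.ne with h' | h'
      · exact h' (congrFun h (0 : Fin 2))
      · exact h' (congrFun h (1 : Fin 2))
  have hv : ∀ a, (fun k => graphVec P p l ⟨a, k⟩) ≠ 0 := fun a => by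
    have : (fun k => graphVec P p l ⟨a, k⟩) = l a • blockForm P p a := rfl
    rw [this]
    exact smul_ne_zero (hl a) (hb a)
  refine ⟨hv, subset_zariskiClosure _ ?_⟩
  refine ⟨fun a => ofLift _ hv (Sum.inl a), subset_zariskiClosure _ ?_,
    fun c => graphVec P p l ⟨Sum.inl c.1, c.2⟩, fun a => ⟨hv (Sum.inl a), rfl⟩, fun _ => rfl, ?_⟩
  · refine ⟨fun a => ofLift _ hv (Sum.inl (Sum.inl a)),
      trivial, fun c => graphVec P p l ⟨Sum.inl (Sum.inl c.1), c.2⟩,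
      fun a => ⟨hv (Sum.inl (Sum.inl a)), rfl⟩, fun _ => rfl, fun k => ?_⟩
    have e : (fun r => eval (fun c : Coord dims₀ => graphVec P p l ⟨Sum.inl (Sum.inl c.1), c.2⟩)
        (pointForms P k r)) =
        l (Sum.inl (Sum.inl ())) • blockForm P p (Sum.inl (Sum.inr k)) := by
      funext r
      rw [eval_pointForms]
      rcases k with i | t <;> exact rowVal_smul ..
    have h' := smul_ne_zero (hl (Sum.inl (Sum.inl ()))) (hb (Sum.inl (Sum.inr k)))
    refine ⟨by rw [e]; exact h', ?_⟩
    refine (Projectivization.mk_eq_mk_iff' ℂ _ _ _ _).2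
      ⟨l (Sum.inl (Sum.inr k)) / l (Sum.inl (Sum.inl ())), ?_⟩
    rw [e, smul_smul, div_mul_cancel₀ _ (hl _)]
    rfl
  · intro t
    have e : (fun r => eval (fun c : Coord (dims₁ N) => graphVec P p l ⟨Sum.inl c.1, c.2⟩)
        (lineForms P t r)) = l (Sum.inl (Sum.inl ())) • blockForm P p (Sum.inr t) := by
      funext r
      rw [eval_lineForms]
      exact rowVal_smul ..
    have h' := smul_ne_zero (hl (Sum.inl (Sum.inl ()))) (hb (Sum.inr t))
    refine ⟨by rw [e]; exact h', ?_⟩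
    refine (Projectivization.mk_eq_mk_iff' ℂ _ _ _ _).2
      ⟨l (Sum.inr t) / l (Sum.inl (Sum.inl ())), ?_⟩
    rw [e, smul_smul, div_mul_cancel₀ _ (hl _)]
    rfl

/-- A polynomial that vanishes at the graph points over the complement of the camera planes
vanishes on the multicone. -/
lemma pullback_eq_zero_of_generic (hN : 3 ≤ N) (hP : GeneralPosition P)
    {F : MvPolynomial (Coord (dims₂ N)) ℂ}
    (h : ∀ (p : Fin 4 → ℂ) (l : Blk N → ℂ), (∀ i, rowVal P i 2 p ≠ 0) → (∀ a, l a ≠ 0) →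
      eval (graphVec P p l) F = 0) : pullback P F = 0 := by
  -- The excluded parameters are the zeros of `G`; a nonzero factor can be cancelled in the
  -- polynomial ring.
  let G : ParamRing N := (∏ i, rowVal P i 2 (fun j => X (Sum.inl j))) * ∏ a, X (Sum.inr a)
  have hG : G ≠ 0 := by
    refine mul_ne_zero (Finset.prod_ne_zero_iff.2 fun i _ => ?_)
      (Finset.prod_ne_zero_iff.2 fun a _ => X_ne_zero _)
    exact hP.rowVal_X_ne_zero hN Sum.inl_injective i 2
  have : G * pullback P F = 0 := by
    refine MvPolynomial.funext fun x => ?_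
    have hx : x = Sum.elim (fun j => x (Sum.inl j)) (fun a => x (Sum.inr a)) := by
      funext c
      cases c <;> rfl
    have h1 : eval x G = (∏ i, rowVal P i 2 (fun j => x (Sum.inl j))) * ∏ a, x (Sum.inr a) := by
      change aeval x G = _
      simp only [G, map_mul, map_prod, map_rowVal, aeval_X]
    rw [map_mul, map_zero, h1]
    by_contra hne
    have h2 := left_ne_zero_of_mul (left_ne_zero_of_mul hne)
    have h3 := right_ne_zero_of_mul (left_ne_zero_of_mul hne)
    apply right_ne_zero_of_mul hne
    rw [← h (fun j => x (Sum.inl j)) (fun a => x (Sum.inr a))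
      (fun i => Finset.prod_ne_zero_iff.1 h2 i (Finset.mem_univ _))
      (fun a => Finset.prod_ne_zero_iff.1 h3 a (Finset.mem_univ _))]
    exact (congrArg (fun z => eval z (pullback P F)) hx).trans
      (aeval_graphVec P _ _ F).symm
  exact (mul_eq_zero.1 this).resolve_left hG

lemma rowVal_zero {R : Type*} [CommRing R] [Algebra ℂ R] (i : Fin N) (r : Fin 3) :
    rowVal P i r (0 : Fin 4 → R) = 0 := by simp [rowVal]

/-- Substitution of the line forms for the last blocks of coordinates. -/
def substLine (P : Fin N → Matrix (Fin 3) (Fin 4) ℂ) :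
    MvPolynomial (Coord (dims₂ N)) ℂ →ₐ[ℂ] MvPolynomial (Coord (dims₁ N)) ℂ :=
  aeval fun
    | ⟨Sum.inl a, k⟩ => X ⟨a, k⟩
    | ⟨Sum.inr t, k⟩ => lineForms P t k

/-- Extension of coordinates on the first blow-up by the values of the line forms. -/
def extendVec (P : Fin N → Matrix (Fin 3) (Fin 4) ℂ) (v : Coord (dims₁ N) → ℂ) :
    Coord (dims₂ N) → ℂ
  | ⟨Sum.inl a, k⟩ => v ⟨a, k⟩
  | ⟨Sum.inr t, k⟩ => eval v (lineForms P t k)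

lemma eval_substLine (v : Coord (dims₁ N) → ℂ) (F : MvPolynomial (Coord (dims₂ N)) ℂ) :
    eval v (substLine P F) = eval (extendVec P v) F := by
  have : (aeval (R := ℂ) v).comp (substLine P) = aeval (extendVec P v) := by
    ext ⟨a | t, k⟩
    · simp [substLine, extendVec]
    · simp only [substLine, AlgHom.comp_apply, aeval_X, extendVec]
      rfl
  exact congrArg (fun φ => φ F) this

/-- The resolution is a closure of a graph over a closure of a graph. Substituting the line forms
turns an equation of the second blow-up into one of the first, which only has to be tested on the
first graph. -/
lemma substLine_mem {F : MvPolynomial (Coord (dims₂ N)) ℂ} (hF : pullback P F = 0)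
    {z : MultiProj (dims₁ N)} (hz : z ∈ firstBlowUp P) {v : Coord (dims₁ N) → ℂ}
    (hv : IsLift v z) : eval v (substLine P F) = 0 := by
  refine hz (substLine P F) ?_ v hv
  rintro z ⟨y, -, u, hu, hzy, hk⟩ v hv
  have h0 : IsLift (fun c : Coord dims₀ => v ⟨Sum.inl c.1, c.2⟩) y := fun a => by
    obtain ⟨h, e⟩ := hv (Sum.inl a)
    exact ⟨h, e.trans (hzy a)⟩
  obtain ⟨ν, hν, e0⟩ := (isLift_iff_exists_scaleVec hu).1 h0
  have h1 : ∀ k : Fin N ⊕ Triple N, ∃ m : ℂ, ∀ r : Fin 3, v ⟨Sum.inr k, r⟩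
      = m * eval u (pointForms P k r) := by
    intro k
    obtain ⟨h, e⟩ := hv (Sum.inr k)
    obtain ⟨h', e'⟩ := hk k
    obtain ⟨m, hm⟩ := (Projectivization.mk_eq_mk_iff' ℂ _ _ h h').1 (e.trans e')
    exact ⟨m, fun r => (congrFun hm r).symm⟩
  choose m hm using h1
  -- The line forms are evaluated at the rescaled vector `ν () • u`, so each of the last blocks
  -- acquires the scalar `ν ()`.
  have key : extendVec P v = graphVec P (fun j => u ⟨(), j⟩)
      (Sum.elim (Sum.elim ν m) fun _ => ν ()) := by
    funext ⟨a, k⟩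
    have e0' : ∀ j, v ⟨Sum.inl (), j⟩ = ν () * u ⟨(), j⟩ := fun j => congrFun e0 ⟨(), j⟩
    rcases a with (⟨⟩ | i | t) | t
    · exact e0' k
    · exact (hm (Sum.inl i) k).trans (congrArg (m (Sum.inl i) * ·) (eval_pointForms P u (Sum.inl i) k))
    · exact (hm (Sum.inr t) k).trans (congrArg (m (Sum.inr t) * ·) (eval_pointForms P u (Sum.inr t) k))
    · refine (eval_lineForms P v t k).trans ?_
      have : (fun j : Fin 4 => v ⟨Sum.inl (), j⟩) = fun j => ν () * u ⟨(), j⟩ := funext e0'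
      exact (congrArg (fun q : Fin 4 → ℂ => blockForm P q (Sum.inr t) k) this).trans
        (rowVal_smul ..)
  rw [eval_substLine, key]
  exact (aeval_graphVec P _ _ F).trans (by rw [hF, map_zero])

/-- The ideal of the resolution is the kernel of the pull-back along its parametrization. -/
theorem mem_vanishingIdeal_resolution (hN : 3 ≤ N) (hP : GeneralPosition P)
    {F : MvPolynomial (Coord (dims₂ N)) ℂ} :
    F ∈ vanishingIdeal (resolution P) ↔ pullback P F = 0 := by
  constructor
  · intro hF
    refine pullback_eq_zero_of_generic hN hP fun p l hp hl => ?_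
    have i0 : Fin N := ⟨0, by omega⟩
    obtain ⟨hv, h⟩ := graphVec_mem (P := P) (p := p)
      (by rintro rfl; exact hp i0 (rowVal_zero _ _)) (fun i => ⟨2, hp i⟩)
      (fun i _ _ => Or.inl (hp i)) hl
    exact hF _ h _ (isLift_ofLift _ hv)
  · intro hF
    rw [resolution, blowUp, vanishingIdeal_zariskiClosure]
    rintro z ⟨y, hy, u, hu, hzy, hk⟩ v hv
    have h2 : IsLift (extendVec P u) z := by
      rintro (a | t)
      · obtain ⟨h, e⟩ := hu a
        exact ⟨h, e.trans (hzy a).symm⟩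
      · obtain ⟨h, e⟩ := hk t
        exact ⟨h, e.symm⟩
    obtain ⟨μ, hμ, rfl⟩ := (isLift_iff_exists_scaleVec h2).1 hv
    rw [← eval_scaleHom, ← eval_substLine]
    exact substLine_mem (pullback_scaleHom_eq_zero hF μ) hy hu

/-- The resolution is a Zariski closure, hence closed, and its ideal is the kernel of `pullback`. -/
theorem mem_resolution_iff (hN : 3 ≤ N) (hP : GeneralPosition P) {y : MultiProj (dims₂ N)}
    {v : Coord (dims₂ N) → ℂ} (hv : IsLift v y) : y ∈ resolution P ↔ IPoint P v := by
  have : zariskiClosure (resolution P) = resolution P := by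
    have h : resolution P = zariskiClosure _ := rfl
    rw [h, zariskiClosure, vanishingIdeal_zariskiClosure]
    rfl
  rw [← this, mem_zariskiClosure_iff hv]
  exact forall_congr' fun F => by rw [mem_vanishingIdeal_resolution hN hP]; rfl

theorem mem_coneTangent_resolution_iff (hN : 3 ≤ N) (hP : GeneralPosition P)
    {y : MultiProj (dims₂ N)} (hy : y ∈ resolution P) {v w : Coord (dims₂ N) → ℂ}
    (hv : IsLift v y) :
    w ∈ coneTangent (resolution P) v ↔
      IPoint P (fun c => (TrivSqZeroExt.inl (v c) + TrivSqZeroExt.inr (w c) : DualNumber ℂ)) := by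
  rw [mem_coneTangent_iff_dual hy hv]
  exact forall_congr' fun F => by rw [mem_vanishingIdeal_resolution hN hP]

end ResolutionIdeal

/-- Proportional non-zero vectors define the same point. -/
lemma mk_eq_mk_of_cross {τ : Type*} {u u' : τ → ℂ} (hu : u ≠ 0) (hu' : u' ≠ 0)
    (h : ∀ s t, u t * u' s = u s * u' t) :
    Projectivization.mk ℂ u hu = Projectivization.mk ℂ u' hu' := by
  obtain ⟨s, hs⟩ := Function.ne_iff.1 hu'
  simp only [Pi.zero_apply] at hs
  refine (Projectivization.mk_eq_mk_iff' ℂ _ _ _ _).2 ⟨u s / u' s, funext fun t => ?_⟩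
  simp only [Pi.smul_apply, smul_eq_mul]
  field_simp
  linear_combination -(h s t)

lemma cross_of_mk_eq_mk {τ : Type*} {u u' : τ → ℂ} {hu : u ≠ 0} {hu' : u' ≠ 0}
    (h : Projectivization.mk ℂ u hu = Projectivization.mk ℂ u' hu') (s t : τ) :
    u t * u' s = u s * u' t := by
  obtain ⟨m, hm⟩ := (Projectivization.mk_eq_mk_iff' ℂ _ _ _ _).1 h
  rw [← hm]
  simp only [Pi.smul_apply, smul_eq_mul]
  ring

/-! ### Names for the blocks of coordinates. -/

section Accessors

variable {N : ℕ} {R : Type*}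

/-- The coordinates on `ℙ³`. -/
def pB (V : Coord (dims₂ N) → R) : Fin 4 → R := fun k => V ⟨Sum.inl (Sum.inl ()), k⟩

/-- The coordinates on the exceptional plane over the center of camera `i`. -/
def aB (V : Coord (dims₂ N) → R) (i : Fin N) : Fin 3 → R :=
  fun k => V ⟨Sum.inl (Sum.inr (Sum.inl i)), k⟩

/-- The coordinates on the exceptional plane over the common point of three camera planes. -/
def bB (V : Coord (dims₂ N) → R) (t : Triple N) : Fin 3 → R :=
  fun k => V ⟨Sum.inl (Sum.inr (Sum.inr t)), k⟩

/-- The coordinate belonging to `i` on the projective line that resolves `(h_i : h_j)`. -/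
def cc [One R] (V : Coord (dims₂ N) → R) (i j : Fin N) : R :=
  if h : i < j then V ⟨Sum.inr ⟨(i, j), h⟩, (0 : Fin 2)⟩
  -- The value 1 for `i = j` represents the ratio `h_i : h_i`, so the relations below hold without
  -- the assumption `i ≠ j`.
  else if h : j < i then V ⟨Sum.inr ⟨(j, i), h⟩, (1 : Fin 2)⟩ else 1

/-- The coordinates in `ℙ^{2N}` that belong to camera `m`, together with the last one. -/
def xx (X : ImgIndex N → R) (m : Fin N) : Fin 3 → R :=
  ![X (some (m, 0)), X (some (m, 1)), X none]

lemma cc_self [One R] (V : Coord (dims₂ N) → R) (i : Fin N) : cc V i i = 1 := by simp [cc]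

lemma xx_castSucc (X : ImgIndex N → R) (m : Fin N) (b : Fin 2) :
    xx X m b.castSucc = X (some (m, b)) := by
  fin_cases b <;> rfl

lemma xx_two (X : ImgIndex N → R) (m : Fin N) : xx X m 2 = X none := rfl

/-- The block of a pair in terms of `cc`. -/
lemma cc_pair [One R] (V : Coord (dims₂ N) → R) (t : Pair N) :
    cc V t.1.1 t.1.2 = V ⟨Sum.inr t, (0 : Fin 2)⟩ ∧
      cc V t.1.2 t.1.1 = V ⟨Sum.inr t, (1 : Fin 2)⟩ := by
  obtain ⟨⟨i, j⟩, h⟩ := t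
  have h' : i < j := h
  simp [cc, h', h'.not_gt]

lemma exists_pair_of_ne [One R] (V : Coord (dims₂ N) → R) {i j : Fin N} (hij : i ≠ j) :
    ∃ (t : Pair N) (r r' : Fin 2), cc V i j = V ⟨Sum.inr t, r⟩ ∧ cc V j i = V ⟨Sum.inr t, r'⟩ ∧
      t.cam r = i ∧ t.cam r' = j ∧ ∀ r'', r'' = r ∨ r'' = r' := by
  rcases lt_or_gt_of_ne hij with h | h
  · refine ⟨⟨(i, j), h⟩, 0, 1, (cc_pair V ⟨(i, j), h⟩).1, (cc_pair V ⟨(i, j), h⟩).2, rfl, rfl, ?_⟩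
    decide
  · refine ⟨⟨(j, i), h⟩, 1, 0, (cc_pair V ⟨(j, i), h⟩).2, (cc_pair V ⟨(j, i), h⟩).1, rfl, rfl, ?_⟩
    decide

lemma Triple.cam_injective (t : Triple N) : Function.Injective t.cam := by
  obtain ⟨⟨i, j, k⟩, h1, h2⟩ := t
  have h1' : i < j := h1
  have h2' : j < k := h2
  intro a b h
  fin_cases a <;> fin_cases b <;>
    simp_all [Triple.cam, h1'.ne, h1'.ne', h2'.ne, h2'.ne', (h1'.trans h2').ne,
      (h1'.trans h2').ne']

end Accessors

section AccessorMaps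

variable {N : ℕ} {R S : Type*} [CommRing R] [Algebra ℂ R] [CommRing S] [Algebra ℂ S]

lemma map_cc (φ : R →ₐ[ℂ] S) (V : Coord (dims₂ N) → R) (i j : Fin N) :
    φ (cc V i j) = cc (fun c => φ (V c)) i j := by
  unfold cc
  split_ifs <;> simp

lemma map_xx (φ : R →ₐ[ℂ] S) (X : ImgIndex N → R) (m : Fin N) (r : Fin 3) :
    φ (xx X m r) = xx (fun t => φ (X t)) m r := by
  fin_cases r <;> rfl

/-- The common factor `a` is all that remains of the ordering of the pair; it cancels in every
relation between the `cc`. -/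
lemma cc_graphVec (P : Fin N → Matrix (Fin 3) (Fin 4) ℂ) (p : Fin 4 → R) (l : Blk N → R)
    {i j : Fin N} (hij : i ≠ j) :
    ∃ a, cc (graphVec P p l) i j = a * rowVal P i 2 p ∧
      cc (graphVec P p l) j i = a * rowVal P j 2 p := by
  obtain ⟨t, r, r', h1, h2, rfl, rfl, -⟩ := exists_pair_of_ne (graphVec P p l) hij
  exact ⟨l (Sum.inr t), h1, h2⟩

lemma pB_graphVec (P : Fin N → Matrix (Fin 3) (Fin 4) ℂ) (p : Fin 4 → R) (l : Blk N → R) :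
    pB (graphVec P p l) = fun j => l (Sum.inl (Sum.inl ())) * p j := rfl

lemma rowVal_pB_graphVec (P : Fin N → Matrix (Fin 3) (Fin 4) ℂ) (p : Fin 4 → R) (l : Blk N → R)
    (i : Fin N) (r : Fin 3) :
    rowVal P i r (pB (graphVec P p l)) = l (Sum.inl (Sum.inl ())) * rowVal P i r p :=
  rowVal_smul ..

lemma aB_graphVec (P : Fin N → Matrix (Fin 3) (Fin 4) ℂ) (p : Fin 4 → R) (l : Blk N → R)
    (i : Fin N) (r : Fin 3) :
    aB (graphVec P p l) i r = l (Sum.inl (Sum.inr (Sum.inl i))) * rowVal P i r p := rfl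

lemma bB_graphVec (P : Fin N → Matrix (Fin 3) (Fin 4) ℂ) (p : Fin 4 → R) (l : Blk N → R)
    (t : Triple N) (r : Fin 3) :
    bB (graphVec P p l) t r = l (Sum.inl (Sum.inr (Sum.inr t))) * rowVal P (t.cam r) 2 p := rfl

end AccessorMaps

/-! ### Bilinear and cocycle relations between the blocks. -/

section Relations

variable {N : ℕ} {R : Type*} [CommRing R] [Algebra ℂ R]
  {P : Fin N → Matrix (Fin 3) (Fin 4) ℂ} {V : Coord (dims₂ N) → R}

lemma aeval_cc (V : Coord (dims₂ N) → R) (i j : Fin N) :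
    aeval V (cc (X : Coord (dims₂ N) → MvPolynomial _ ℂ) i j) = cc V i j := by
  rw [map_cc]; simp

lemma aeval_rowVal_pB (V : Coord (dims₂ N) → R) (i : Fin N) (r : Fin 3) :
    aeval V (rowVal P i r (pB (X : Coord (dims₂ N) → MvPolynomial _ ℂ)))
      = rowVal P i r (pB V) := by
  rw [map_rowVal]; simp only [pB, aeval_X]; rfl

lemma aeval_aB (V : Coord (dims₂ N) → R) (i : Fin N) (r : Fin 3) :
    aeval V (aB (X : Coord (dims₂ N) → MvPolynomial _ ℂ) i r) = aB V i r := aeval_X ..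

lemma aeval_bB (V : Coord (dims₂ N) → R) (t : Triple N) (r : Fin 3) :
    aeval V (bB (X : Coord (dims₂ N) → MvPolynomial _ ℂ) t r) = bB V t r := aeval_X ..

/-- The block over a camera center is proportional to the image point of that camera. -/
lemma IPoint.a_row (hV : IPoint P V) (m : Fin N) (r r' : Fin 3) :
    aB V m r * rowVal P m r' (pB V) = aB V m r' * rowVal P m r (pB V) := by
  have := hV (aB X m r * rowVal P m r' (pB X) - aB X m r' * rowVal P m r (pB X)) (by
    simp only [pullback, map_sub, map_mul, aeval_rowVal_pB, aeval_aB, aB_graphVec,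
      rowVal_pB_graphVec]
    ring)
  simp only [map_sub, map_mul, aeval_rowVal_pB, aeval_aB] at this
  exact sub_eq_zero.1 this

lemma IPoint.b_row (hV : IPoint P V) (t : Triple N) (r r' : Fin 3) :
    bB V t r * rowVal P (t.cam r') 2 (pB V) = bB V t r' * rowVal P (t.cam r) 2 (pB V) := by
  have := hV (bB X t r * rowVal P (t.cam r') 2 (pB X) - bB X t r' * rowVal P (t.cam r) 2 (pB X))
    (by
      simp only [pullback, map_sub, map_mul, aeval_rowVal_pB, aeval_bB, bB_graphVec,
        rowVal_pB_graphVec]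
      ring)
  simp only [map_sub, map_mul, aeval_rowVal_pB, aeval_bB] at this
  exact sub_eq_zero.1 this

/-- In other words `cc V i j : cc V j i` represents `h_i : h_j`. In particular `cc V j i ≠ 0` over ℂ
means that `h_j` divides `h_i` near the point. -/
lemma IPoint.cc_row (hV : IPoint P V) (i j : Fin N) :
    cc V i j * rowVal P j 2 (pB V) = cc V j i * rowVal P i 2 (pB V) := by
  by_cases hij : i = j
  · rw [hij]
  have := hV (cc X i j * rowVal P j 2 (pB X) - cc X j i * rowVal P i 2 (pB X)) (by
    simp only [pullback, map_sub, map_mul, aeval_rowVal_pB, aeval_cc, rowVal_pB_graphVec]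
    obtain ⟨a, h1, h2⟩ := cc_graphVec (R := ParamRing N) P (fun j => X (Sum.inl j))
      (fun a => X (Sum.inr a)) hij
    rw [h1, h2]
    ring)
  simp only [map_sub, map_mul, aeval_rowVal_pB, aeval_cc] at this
  exact sub_eq_zero.1 this

lemma IPoint.b_cc (hV : IPoint P V) (t : Triple N) (r r' : Fin 3) :
    bB V t r * cc V (t.cam r') (t.cam r) = bB V t r' * cc V (t.cam r) (t.cam r') := by
  by_cases hr : r = r'
  · rw [hr]
  have := hV (bB X t r * cc X (t.cam r') (t.cam r) - bB X t r' * cc X (t.cam r) (t.cam r')) (by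
    simp only [pullback, map_sub, map_mul, aeval_bB, aeval_cc, bB_graphVec]
    obtain ⟨a, h1, h2⟩ := cc_graphVec (R := ParamRing N) P (fun j => X (Sum.inl j))
      (fun a => X (Sum.inr a)) (t.cam_injective.ne hr)
    rw [h1, h2]
    ring)
  simp only [map_sub, map_mul, aeval_bB, aeval_cc] at this
  exact sub_eq_zero.1 this

/-- At the generic point both sides are the same multiple of `h_i h_j h_k`. Over ℂ this makes
divisibility among the `h_i` transitive. -/
lemma IPoint.cc_cocycle (hV : IPoint P V) (i j k : Fin N) :
    cc V i j * cc V j k * cc V k i = cc V j i * cc V k j * cc V i k := by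
  by_cases hij : i = j
  · subst hij; ring
  by_cases hjk : j = k
  · subst hjk; ring
  by_cases hik : i = k
  · subst hik; rw [cc_self]; ring
  have := hV (cc X i j * cc X j k * cc X k i - cc X j i * cc X k j * cc X i k) (by
    simp only [pullback, map_sub, map_mul, aeval_cc]
    obtain ⟨a, h1, h2⟩ := cc_graphVec (R := ParamRing N) P (fun j => X (Sum.inl j))
      (fun a => X (Sum.inr a)) hij
    obtain ⟨b, h3, h4⟩ := cc_graphVec (R := ParamRing N) P (fun j => X (Sum.inl j))
      (fun a => X (Sum.inr a)) hjk
    obtain ⟨c, h5, h6⟩ := cc_graphVec (R := ParamRing N) P (fun j => X (Sum.inl j))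
      (fun a => X (Sum.inr a)) hik
    rw [h1, h2, h3, h4, h5, h6]
    ring)
  simp only [map_sub, map_mul, aeval_cc] at this
  exact sub_eq_zero.1 this

end Relations

/-! ### Families of polynomials proportional to the camera forms. -/

section CompatibleFamilies

variable {N : ℕ} {R S : Type*} [CommRing R] [Algebra ℂ R] [CommRing S] [Algebra ℂ S]
  {P : Fin N → Matrix (Fin 3) (Fin 4) ℂ}

/-- The values of the forms that define the camera map at a vector over a `ℂ`-algebra. -/
def camR (P : Fin N → Matrix (Fin 3) (Fin 4) ℂ) (p : Fin 4 → R) (t : ImgIndex N) : R :=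
  aeval p (cameraForm P t)

lemma camR_none (P : Fin N → Matrix (Fin 3) (Fin 4) ℂ) (p : Fin 4 → R) :
    camR P p none = ∏ j, rowVal P j 2 p := by
  simp [camR, cameraForm, aeval_rowForm]

lemma camR_some (P : Fin N → Matrix (Fin 3) (Fin 4) ℂ) (p : Fin 4 → R) (i : Fin N) (b : Fin 2) :
    camR P p (some (i, b))
      = rowVal P i b.castSucc p * ∏ j ∈ Finset.univ.erase i, rowVal P j 2 p := by
  simp [camR, cameraForm, aeval_rowForm]

lemma xx_camR (P : Fin N → Matrix (Fin 3) (Fin 4) ℂ) (p : Fin 4 → R) (m : Fin N) (r : Fin 3) :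
    xx (camR P p) m r = rowVal P m r p * ∏ j ∈ Finset.univ.erase m, rowVal P j 2 p := by
  fin_cases r
  · exact camR_some P p m 0
  · exact camR_some P p m 1
  · exact (camR_none P p).trans
      (Finset.mul_prod_erase Finset.univ (fun j => rowVal P j 2 p) (Finset.mem_univ m)).symm

lemma map_camR (φ : R →ₐ[ℂ] S) (p : Fin 4 → R) (t : ImgIndex N) :
    φ (camR P p t) = camR P (fun j => φ (p j)) t := by
  rw [camR, ← AlgHom.comp_apply, MvPolynomial.comp_aeval]
  rfl

lemma camR_smul (a : R) (p : Fin 4 → R) (t : ImgIndex N) :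
    camR P (fun j => a * p j) t = a ^ N * camR P p t := by
  cases t with
  | none =>
    simp [camR_none, rowVal_smul, Finset.prod_mul_distrib]
  | some t =>
    obtain ⟨i, b⟩ := t
    have hN : a ^ N = a ^ (N - 1) * a := by
      rw [← pow_succ]
      congr 1
      have := i.pos
      omega
    simp only [camR_some, rowVal_smul, Finset.prod_mul_distrib, Finset.prod_const,
      Finset.card_erase_of_mem (Finset.mem_univ i), Finset.card_univ, Fintype.card_fin]
    rw [hN]
    ring

/-- The family `F` represents the camera map at the generic point of the resolution. -/
def Compatible (P : Fin N → Matrix (Fin 3) (Fin 4) ℂ)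
    (F : ImgIndex N → MvPolynomial (Coord (dims₂ N)) ℂ) : Prop :=
  ∀ s t, pullback P (F t) * camR P (fun j => (X (Sum.inl j) : ParamRing N)) s
    = pullback P (F s) * camR P (fun j => (X (Sum.inl j) : ParamRing N)) t

lemma camR_none_X_ne_zero (hN : 3 ≤ N) (hP : GeneralPosition P) :
    camR P (fun j => (X (Sum.inl j) : ParamRing N)) none ≠ 0 := by
  rw [camR_none]
  exact Finset.prod_ne_zero_iff.2 fun i _ => hP.rowVal_X_ne_zero hN Sum.inl_injective i 2

/-- The forms that define the camera map as polynomials in the coordinates of the resolution. -/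
def camPoly (P : Fin N → Matrix (Fin 3) (Fin 4) ℂ) (t : ImgIndex N) :
    MvPolynomial (Coord (dims₂ N)) ℂ := camR P (pB X) t

lemma aeval_camPoly (V : Coord (dims₂ N) → R) (t : ImgIndex N) :
    aeval V (camPoly P t) = camR P (pB V) t := by
  rw [camPoly, map_camR]
  simp only [pB, aeval_X]
  rfl

lemma pullback_camPoly (t : ImgIndex N) :
    pullback P (camPoly P t) = X (Sum.inr (Sum.inl (Sum.inl ()))) ^ N *
      camR P (fun j => (X (Sum.inl j) : ParamRing N)) t := by
  rw [pullback, aeval_camPoly, pB_graphVec, camR_smul]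

lemma compatible_iff {F : ImgIndex N → MvPolynomial (Coord (dims₂ N)) ℂ} :
    Compatible P F ↔ ∀ s t, pullback P (F t * camPoly P s - F s * camPoly P t) = 0 := by
  refine forall₂_congr fun s t => ?_
  rw [map_sub, map_mul, map_mul, pullback_camPoly, pullback_camPoly, sub_eq_zero]
  constructor
  · intro h
    linear_combination X (Sum.inr (Sum.inl (Sum.inl ()))) ^ N * h
  · intro h
    refine mul_left_cancel₀ (pow_ne_zero N (X_ne_zero (Sum.inr (Sum.inl (Sum.inl ()))))) ?_
    linear_combination h

lemma Compatible.aeval_mul_camR {F : ImgIndex N → MvPolynomial (Coord (dims₂ N)) ℂ}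
    (hF : Compatible P F) {V : Coord (dims₂ N) → R} (hV : IPoint P V) (s t : ImgIndex N) :
    aeval V (F t) * camR P (pB V) s = aeval V (F s) * camR P (pB V) t := by
  have := hV _ (compatible_iff.1 hF s t)
  rw [map_sub, map_mul, map_mul, aeval_camPoly, aeval_camPoly] at this
  exact sub_eq_zero.1 this

/-- A criterion for compatibility: proportionality to the camera forms. -/
lemma Compatible.of_proportional {F : ImgIndex N → MvPolynomial (Coord (dims₂ N)) ℂ}
    {G H : ParamRing N} (hG : G ≠ 0)
    (h : ∀ t, G * pullback P (F t) = H * camR P (fun j => (X (Sum.inl j) : ParamRing N)) t) :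
    Compatible P F := by
  intro s t
  refine mul_left_cancel₀ hG ?_
  linear_combination camR P (fun j => (X (Sum.inl j) : ParamRing N)) s * h t -
    camR P (fun j => (X (Sum.inl j) : ParamRing N)) t * h s

lemma Compatible.scaleHom {F : ImgIndex N → MvPolynomial (Coord (dims₂ N)) ℂ}
    (hF : Compatible P F) (μ : Blk N → ℂ) : Compatible P (fun t => scaleHom _ μ (F t)) := by
  have e : ∀ t, pullback P (Multiview.scaleHom _ μ (F t)) =
      aeval (Sum.elim (fun j => X (Sum.inl j)) (fun a => μ a • X (Sum.inr a)) :
        Fin 4 ⊕ Blk N → ParamRing N) (pullback P (F t)) := by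
    intro t
    rw [← aeval_graphVec, pullback, aeval_scaleHom]
    congr 2
    funext c
    simp [scaleVec, graphVec]
  intro s t
  have := congrArg (aeval (Sum.elim (fun j => X (Sum.inl j)) (fun a => μ a • X (Sum.inr a)) :
        Fin 4 ⊕ Blk N → ParamRing N)) (hF s t)
  rw [map_mul, map_mul, map_camR, map_camR] at this
  simp only [aeval_X, Sum.elim_inl] at this
  rw [e, e]
  exact this

/-- Both families are proportional to the camera forms at the generic point. Cancelling the square
of the nonzero form `∏ h_j` in a domain gives a relation that persists where all camera forms
vanish. -/
lemma Compatible.cross (hN : 3 ≤ N) (hP : GeneralPosition P)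
    {F G : ImgIndex N → MvPolynomial (Coord (dims₂ N)) ℂ}
    (hF : Compatible P F) (hG : Compatible P G) {V : Coord (dims₂ N) → R} (hV : IPoint P V)
    (s t : ImgIndex N) :
    aeval V (F t) * aeval V (G s) = aeval V (F s) * aeval V (G t) := by
  have h : pullback P (F t * G s - F s * G t) = 0 := by
    rw [map_sub, map_mul, map_mul]
    have h0 := camR_none_X_ne_zero hN hP
    refine mul_left_cancel₀ (mul_ne_zero h0 h0) ?_
    rw [mul_zero]
    have h1 := hF none t
    have h2 := hF none s
    have h3 := hG none s
    have h4 := hG none t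
    set C := camR P (fun j => (X (Sum.inl j) : ParamRing N))
    linear_combination (pullback P (G s) * C none) * h1 - (pullback P (G t) * C none) * h2
      + pullback P (F none) * C t * h3 - pullback P (F none) * C s * h4
  have := hV _ h
  rw [map_sub, map_mul, map_mul] at this
  exact sub_eq_zero.1 this

/-- The coordinates of camera `m`, together with the last one, share the factor `∏_{j ≠ m} h_j`;
without it they are the image of the point in camera `m`. -/
lemma Compatible.xx_pullback (hN : 3 ≤ N) (hP : GeneralPosition P)
    {F : ImgIndex N → MvPolynomial (Coord (dims₂ N)) ℂ}
    (hF : Compatible P F) (m : Fin N) (r : Fin 3) :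
    xx (fun t => pullback P (F t)) m r * rowVal P m 2 (fun j => (X (Sum.inl j) : ParamRing N))
      = pullback P (F none) * rowVal P m r (fun j => (X (Sum.inl j) : ParamRing N)) := by
  set p := fun j => (X (Sum.inl j) : ParamRing N)
  have h1 : xx (fun t => pullback P (F t)) m r * camR P p none
      = pullback P (F none) * xx (camR P p) m r := by
    fin_cases r
    · exact hF none (some (m, 0))
    · exact hF none (some (m, 1))
    · rfl
  have h2 : ∏ j ∈ Finset.univ.erase m, rowVal P j 2 p ≠ 0 :=
    Finset.prod_ne_zero_iff.2 fun i _ => hP.rowVal_X_ne_zero hN Sum.inl_injective i 2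
  rw [xx_camR, camR_none, ← Finset.mul_prod_erase Finset.univ _ (Finset.mem_univ m)] at h1
  refine mul_right_cancel₀ h2 ?_
  linear_combination h1

lemma Compatible.xx_a (hN : 3 ≤ N) (hP : GeneralPosition P)
    {F : ImgIndex N → MvPolynomial (Coord (dims₂ N)) ℂ} (hF : Compatible P F)
    {V : Coord (dims₂ N) → R} (hV : IPoint P V) (m : Fin N) (r r' : Fin 3) :
    xx (fun t => aeval V (F t)) m r * aB V m r' = xx (fun t => aeval V (F t)) m r' * aB V m r := by
  have h := hV (xx F m r * aB X m r' - xx F m r' * aB X m r) (by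
    rw [map_sub, map_mul, map_mul, map_xx, map_xx, pullback, aeval_aB, aeval_aB,
      aB_graphVec, aB_graphVec]
    have h0 := hP.rowVal_X_ne_zero hN (c := (Sum.inl : Fin 4 → Fin 4 ⊕ Blk N))
      Sum.inl_injective m 2
    refine mul_left_cancel₀ h0 ?_
    have h1 := hF.xx_pullback hN hP m r
    have h2 := hF.xx_pullback hN hP m r'
    simp only [pullback] at h1 h2
    rw [mul_sub, mul_zero]
    linear_combination X (Sum.inr (Sum.inl (Sum.inr (Sum.inl m)))) *
        rowVal P m r' (fun j => (X (Sum.inl j) : ParamRing N)) * h1 -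
      X (Sum.inr (Sum.inl (Sum.inr (Sum.inl m)))) *
        rowVal P m r (fun j => (X (Sum.inl j) : ParamRing N)) * h2)
  rw [map_sub, map_mul, map_mul, map_xx, map_xx, aeval_aB, aeval_aB] at h
  exact sub_eq_zero.1 h

/-- With `x_m = (F_none / h_m) • row_m` both sides are the same multiple of `row_m r * row_n r'`.
The relation ties the relative scale of two cameras in the image to the ratio `h_m : h_n`; it is the
source of injectivity and of the differential over the lines `L_{ij}`. -/
lemma Compatible.xx_cc (hN : 3 ≤ N) (hP : GeneralPosition P)
    {F : ImgIndex N → MvPolynomial (Coord (dims₂ N)) ℂ} (hF : Compatible P F)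
    {V : Coord (dims₂ N) → R} (hV : IPoint P V) (m n : Fin N) (r r' : Fin 3) :
    xx (fun t => aeval V (F t)) m r * rowVal P n r' (pB V) * cc V m n
      = xx (fun t => aeval V (F t)) n r' * rowVal P m r (pB V) * cc V n m := by
  have h := hV (xx F m r * rowVal P n r' (pB X) * cc X m n
      - xx F n r' * rowVal P m r (pB X) * cc X n m) (by
    simp only [map_sub, map_mul, map_xx, pullback, aeval_rowVal_pB, aeval_cc, rowVal_pB_graphVec]
    have h1 := hF.xx_pullback hN hP m r
    have h2 := hF.xx_pullback hN hP n r'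
    simp only [pullback] at h1 h2
    by_cases hmn : m = n
    · subst hmn
      have h0 := hP.rowVal_X_ne_zero hN (c := (Sum.inl : Fin 4 → Fin 4 ⊕ Blk N))
        Sum.inl_injective m 2
      refine mul_left_cancel₀ h0 ?_
      simp only [cc_self]
      rw [mul_zero, mul_sub]
      linear_combination X (Sum.inr (Sum.inl (Sum.inl ()))) *
          rowVal P m r' (fun j => (X (Sum.inl j) : ParamRing N)) * h1 -
        X (Sum.inr (Sum.inl (Sum.inl ()))) *
          rowVal P m r (fun j => (X (Sum.inl j) : ParamRing N)) * h2
    · obtain ⟨a, h3, h4⟩ := cc_graphVec (R := ParamRing N) P (fun j => X (Sum.inl j))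
        (fun a => X (Sum.inr a)) hmn
      rw [h3, h4]
      linear_combination a * X (Sum.inr (Sum.inl (Sum.inl ()))) *
          rowVal P n r' (fun j => (X (Sum.inl j) : ParamRing N)) * h1 -
        a * X (Sum.inr (Sum.inl (Sum.inl ()))) *
          rowVal P m r (fun j => (X (Sum.inl j) : ParamRing N)) * h2)
  simp only [map_sub, map_mul, map_xx, aeval_rowVal_pB, aeval_cc] at h
  exact sub_eq_zero.1 h

/-- Families that represent the resolved map are compatible. -/
lemma IsResolvedMap.compatible (hN : 3 ≤ N) (hP : GeneralPosition P)
    {φ' : resolution P → ℙ ℂ (ImgIndex N → ℂ)} (hφ : IsResolvedMap P φ')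
    {F : ImgIndex N → MvPolynomial (Coord (dims₂ N)) ℂ} (hF : Represents (resolution P) φ' F) :
    Compatible P F := by
  rw [compatible_iff]
  intro s t
  refine pullback_eq_zero_of_generic hN hP fun p l hp hl => ?_
  have i0 : Fin N := ⟨0, by omega⟩
  have hp0 : p ≠ 0 := by rintro rfl; exact hp i0 (rowVal_zero _ _)
  obtain ⟨hv, hy⟩ := graphVec_mem (P := P) (p := p) hp0 (fun i => ⟨2, hp i⟩)
    (fun i _ _ => Or.inl (hp i)) hl
  have hcam : cameraVec P p ≠ 0 := fun h => by
    have h1 : camR P p none = 0 := congrFun h none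
    rw [camR_none, Finset.prod_eq_zero_iff] at h1
    obtain ⟨i, -, hi⟩ := h1
    exact hp i hi
  have hφy := hφ.2 ⟨_, hy⟩ p hp0 ((Projectivization.mk_eq_mk_iff' ℂ _ _ _ _).2
    ⟨l (Sum.inl (Sum.inl ())), rfl⟩) hcam
  have e : ∀ t, eval (graphVec P p l) (camPoly P t) =
      l (Sum.inl (Sum.inl ())) ^ N * cameraVec P p t := fun t => by
    change aeval (graphVec P p l) _ = _
    rw [aeval_camPoly, pB_graphVec, camR_smul]
    rfl
  rw [map_sub, map_mul, map_mul, e, e]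
  by_cases h : (fun t => eval (graphVec P p l) (F t)) = 0
  · have := fun t => congrFun h t
    simp only [Pi.zero_apply] at this
    simp [this]
  · have := cross_of_mk_eq_mk ((hF ⟨_, hy⟩ _ (isLift_ofLift _ hv) h).trans hφy) s t
    linear_combination l (Sum.inl (Sum.inl ())) ^ N * this

/-- The resolved map exists if there are compatible families without common zeros on the
resolution. -/
lemma exists_isResolvedMap (hN : 3 ≤ N) (hP : GeneralPosition P)
    (h : ∀ v : Coord (dims₂ N) → ℂ, IPoint P v → (∀ a, (fun k => v ⟨a, k⟩) ≠ 0) →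
      ∃ F, Compatible P F ∧ (fun t => eval v (F t)) ≠ 0) : ∃ φ', IsResolvedMap P φ' := by
  have key : ∀ y : resolution P, ∃ v, IsLift v y.1 ∧ IPoint P v ∧ ∃ F, Compatible P F ∧
      (fun t => eval v (F t)) ≠ 0 := fun y => by
    obtain ⟨v, hv⟩ := exists_isLift y.1
    have hI := (mem_resolution_iff hN hP hv).1 y.2
    exact ⟨v, hv, hI, h v hI hv.ne_zero⟩
  choose v hv hI F hF hFv using key
  -- The families chosen point by point define one morphism because any two compatible families are
  -- proportional at every point.
  have hrep : ∀ G, Compatible P G →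
      Represents (resolution P) (fun y => Projectivization.mk ℂ _ (hFv y)) G := by
    intro G hG y u hu hGu
    obtain ⟨μ, hμ, rfl⟩ := (isLift_iff_exists_scaleVec (hv y)).1 hu
    exact mk_eq_mk_of_cross _ _ fun s t => by
      have := (hG.scaleHom μ).cross hN hP (hF y) (hI y) s t
      simp only [aeval_scaleHom] at this
      exact this
  refine ⟨fun y => Projectivization.mk ℂ _ (hFv y), fun y => ⟨F y, hrep _ (hF y), v y, hv y, hFv y⟩,
    fun y p hp hyp hcam => ?_⟩
  obtain ⟨h0, e⟩ := hv y (Sum.inl (Sum.inl ()))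
  obtain ⟨a, ha⟩ := (Projectivization.mk_eq_mk_iff' ℂ _ _ h0 hp).1 (e.trans hyp)
  have ha0 : a ≠ 0 := by
    rintro rfl
    exact h0 (ha.symm.trans (zero_smul ℂ p))
  have hpB : pB (v y) = fun j => a * p j := ha.symm
  refine mk_eq_mk_of_cross _ _ fun s t => ?_
  have h1 := (hF y).aeval_mul_camR (hI y) s t
  rw [hpB, camR_smul, camR_smul] at h1
  refine mul_left_cancel₀ (pow_ne_zero N ha0) ?_
  change a ^ N * (aeval (v y) (F y t) * camR P p s) = a ^ N * (aeval (v y) (F y s) * camR P p t)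
  linear_combination h1

end CompatibleFamilies

/-- A total transitive relation has an extremal element on every non-empty finite set. -/
lemma exists_forall_rel {α : Type*} {r : α → α → Prop} (ht : ∀ a b, r a b ∨ r b a)
    (htr : ∀ a b c, r a b → r b c → r a c) {s : Finset α} (hs : s.Nonempty) :
    ∃ m ∈ s, ∀ k ∈ s, r m k := by
  classical
  induction hs using Finset.Nonempty.cons_induction with
  | singleton a =>
    refine ⟨a, Finset.mem_singleton_self a, fun k hk => ?_⟩
    rw [Finset.mem_singleton.1 hk]
    exact (ht a a).elim id id
  | cons a s ha _ ih =>
    obtain ⟨m, hm, h⟩ := ih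
    rcases ht a m with h' | h'
    · refine ⟨a, Finset.mem_cons_self a s, fun k hk => ?_⟩
      rcases Finset.mem_cons.1 hk with rfl | hk
      · exact (ht k k).elim id id
      · exact htr _ _ _ h' (h k hk)
    · refine ⟨m, Finset.mem_cons_of_mem hm, fun k hk => ?_⟩
      rcases Finset.mem_cons.1 hk with rfl | hk
      · exact h'
      · exact h k hk

/-! ### Lifting points of projective space over valuation rings. -/

section Arcs

variable {N : ℕ} {P : Fin N → Matrix (Fin 3) (Fin 4) ℂ}

/-- In a valuation ring, the coordinates of a vector can be divided by one of them. -/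
lemma exists_eq_mul_of_valuationRing {O : Type*} [CommRing O] [IsDomain O] [ValuationRing O]
    {d : ℕ} (g : Fin d → O) (hg : g ≠ 0) :
    ∃ (m : O) (u : Fin d → O), m ≠ 0 ∧ (∀ k, m * u k = g k) ∧ ∃ k, u k = 1 := by
  obtain ⟨k1, hk1⟩ := Function.ne_iff.1 hg
  obtain ⟨k0, -, h⟩ := exists_forall_rel (r := fun a b => g a ∣ g b)
    (fun a b => ValuationRing.dvd_total (g a) (g b)) (fun a b c => dvd_trans)
    (s := Finset.univ) ⟨k1, Finset.mem_univ k1⟩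
  have hk0 : g k0 ≠ 0 := fun h0 => hk1 (zero_dvd_iff.1 (h0 ▸ h k1 (Finset.mem_univ _)))
  choose u hu using fun k => h k (Finset.mem_univ k)
  refine ⟨g k0, u, hk0, fun k => (hu k).symm, k0, ?_⟩
  exact mul_left_cancel₀ hk0 ((hu k0).symm.trans (mul_one _).symm)

/-- Points of `ℙ³` over a valuation ring lift to the resolution. -/
lemma exists_iPoint_of_valuationRing {O : Type} [CommRing O] [IsDomain O] [ValuationRing O]
    [Algebra ℂ O] {p : Fin 4 → O} (hp : ∀ i, rowVal P i 2 p ≠ 0) :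
    ∃ V : Coord (dims₂ N) → O, IPoint P V ∧ pB V = p ∧
      ∀ a, a ≠ Sum.inl (Sum.inl ()) → ∃ k, V ⟨a, k⟩ = 1 := by
  have h : ∀ a : Blk N, ∃ (m : O) (u : Fin (dims₂ N a) → O), m ≠ 0 ∧
      (∀ k, m * u k = blockForm P p a k) ∧ (a = Sum.inl (Sum.inl ()) → u = blockForm P p a) ∧
      (a ≠ Sum.inl (Sum.inl ()) → ∃ k, u k = 1) := by
    have aux : ∀ a : Blk N, a ≠ Sum.inl (Sum.inl ()) → blockForm P p a ≠ 0 →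
        ∃ (m : O) (u : Fin (dims₂ N a) → O), m ≠ 0 ∧
        (∀ k, m * u k = blockForm P p a k) ∧ (a = Sum.inl (Sum.inl ()) → u = blockForm P p a) ∧
        (a ≠ Sum.inl (Sum.inl ()) → ∃ k, u k = 1) := fun a ha hb => by
      obtain ⟨m, u, h1, h2, h3⟩ := exists_eq_mul_of_valuationRing _ hb
      exact ⟨m, u, h1, h2, fun h => (ha h).elim, fun _ => h3⟩
    rintro ((⟨⟩ | i | t) | t)
    · exact ⟨1, p, one_ne_zero, fun k => one_mul _, fun _ => rfl, fun h => (h rfl).elim⟩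
    · exact aux _ (by simp) fun h => hp i (congrFun h (2 : Fin 3))
    · exact aux _ (by simp) fun h => hp t.1.1 (congrFun h (0 : Fin 3))
    · exact aux _ (by simp) fun h => hp t.1.1 (congrFun h (0 : Fin 2))
  choose m u h1 h2 h3 h4 using h
  exact ⟨fun c => u c.1 c.2, IPoint.of_domain h1 h2, h3 _ rfl, h4⟩

end Arcs

/-! ### Existence of the resolved map. -/

section Existence

variable {N : ℕ} {R : Type*} [CommRing R] [Algebra ℂ R] {P : Fin N → Matrix (Fin 3) (Fin 4) ℂ}

lemma iPoint_graphVec (p : Fin 4 → R) (l : Blk N → R) : IPoint P (graphVec P p l) :=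
  fun F hF => by rw [aeval_graphVec, hF, map_zero]

lemma cc_ne_zero_or {v : Coord (dims₂ N) → ℂ} (hv : ∀ a, (fun k => v ⟨a, k⟩) ≠ 0) (i j : Fin N) :
    cc v i j ≠ 0 ∨ cc v j i ≠ 0 := by
  by_cases hij : i = j
  · subst hij
    simp [cc_self]
  obtain ⟨t, r, r', h1, h2, -, -, h3⟩ := exists_pair_of_ne v hij
  by_contra! hcon
  refine hv (Sum.inr t) (funext fun k => ?_)
  rcases h3 k with h | h
  · rw [h]; exact h1.symm.trans hcon.1
  · rw [h]; exact h2.symm.trans hcon.2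

/-- If `h_j` divides `h_i` and `h_k` divides `h_j`, then `h_k` divides `h_i`; the cocycle relation
says this at the level of the coordinates of `v`. -/
lemma IPoint.cc_trans {v : Coord (dims₂ N) → ℂ} (hI : IPoint P v)
    (hv : ∀ a, (fun k => v ⟨a, k⟩) ≠ 0) {i j k : Fin N} (h1 : cc v j i ≠ 0) (h2 : cc v k j ≠ 0) :
    cc v k i ≠ 0 := by
  intro h
  have := hI.cc_cocycle i j k
  rw [h, mul_zero] at this
  rcases mul_eq_zero.1 this.symm with h' | h'
  · exact (mul_ne_zero h1 h2) h'
  · exact (cc_ne_zero_or hv k i).elim (fun h'' => h'' h) (fun h'' => h'' h')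

/-- The camera map near the exceptional plane over the center of camera `m`. -/
def centerFamily (P : Fin N → Matrix (Fin 3) (Fin 4) ℂ) (m : Fin N) :
    ImgIndex N → MvPolynomial (Coord (dims₂ N)) ℂ
  | none => aB X m 2 * ∏ k ∈ Finset.univ.erase m, rowVal P k 2 (pB X)
  | some (j, b) =>
    if j = m then aB X m b.castSucc * ∏ k ∈ Finset.univ.erase m, rowVal P k 2 (pB X)
    else aB X m 2 * rowVal P j b.castSucc (pB X) *
      ∏ k ∈ (Finset.univ.erase m).erase j, rowVal P k 2 (pB X)

/-- The camera map near points over no camera center, where `h_m` is the smallest of the `h_k`. -/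
def planeFamily (P : Fin N → Matrix (Fin 3) (Fin 4) ℂ) (m : Fin N) :
    ImgIndex N → MvPolynomial (Coord (dims₂ N)) ℂ
  | none => rowVal P m 2 (pB X) * ∏ k, cc X k m
  | some (j, b) => rowVal P j b.castSucc (pB X) * cc X m j * ∏ k ∈ Finset.univ.erase j, cc X k m

/-- The row values of camera `m` are replaced by its exceptional block, which differs from them by
the ratio of the parameters `la` and `l0`. -/
lemma centerFamily_compatible (hN : 3 ≤ N) (hP : GeneralPosition P) (m : Fin N) :
    Compatible P (centerFamily P m) := by
  set l0 : ParamRing N := X (Sum.inr (Sum.inl (Sum.inl ()))) with hl0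
  set la : ParamRing N := X (Sum.inr (Sum.inl (Sum.inr (Sum.inl m)))) with hla
  set p := fun j => (X (Sum.inl j) : ParamRing N) with hp
  have hm : rowVal P m 2 p ≠ 0 := hP.rowVal_X_ne_zero hN Sum.inl_injective m 2
  refine Compatible.of_proportional (G := l0 * (l0 * rowVal P m 2 p))
    (H := la * (l0 * rowVal P m 2 p) * l0 ^ N)
    (mul_ne_zero (X_ne_zero _) (mul_ne_zero (X_ne_zero _) hm)) fun t => ?_
  rw [mul_assoc _ (l0 ^ N), ← camR_smul]
  rcases t with - | ⟨j, b⟩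
  · simp only [centerFamily, pullback, map_mul, map_prod, aeval_aB, aeval_rowVal_pB, aB_graphVec,
      pB_graphVec, camR_none]
    rw [← Finset.mul_prod_erase Finset.univ (fun j => rowVal P j 2 (fun j => l0 * p j))
      (Finset.mem_univ m)]
    simp only [rowVal_smul, ← hl0, ← hla, ← hp]
    ring
  · simp only [centerFamily]
    split_ifs with h
    · subst h
      simp only [pullback, map_mul, map_prod, aeval_aB, aeval_rowVal_pB, aB_graphVec,
        pB_graphVec, camR_some, rowVal_smul, ← hl0, ← hla, ← hp]
      ring
    · simp only [pullback, map_mul, map_prod, aeval_aB, aeval_rowVal_pB, aB_graphVec,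
        pB_graphVec, camR_some]
      rw [← Finset.mul_prod_erase (Finset.univ.erase j) (fun j => rowVal P j 2 (fun j => l0 * p j))
        (Finset.mem_erase.2 ⟨Ne.symm h, Finset.mem_univ m⟩), Finset.erase_right_comm]
      simp only [rowVal_smul, ← hl0, ← hla, ← hp]
      ring

/-- The family is the camera forms times `h_m ∏ cc k m / ∏ h_k`; the relation `h_m / h_j = cc m j /
cc j m` clears the denominators. -/
lemma planeFamily_compatible (hN : 3 ≤ N) (hP : GeneralPosition P) (m : Fin N) :
    Compatible P (planeFamily P m) := by
  set l0 : ParamRing N := X (Sum.inr (Sum.inl (Sum.inl ()))) with hl0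
  set p := fun j => (X (Sum.inl j) : ParamRing N) with hp
  set q : Fin 4 → ParamRing N := fun j => l0 * p j with hq
  set V0 : Coord (dims₂ N) → ParamRing N := graphVec P p (fun a => X (Sum.inr a)) with hV0
  have hI : IPoint P V0 := iPoint_graphVec _ _
  have hpB : pB V0 = q := rfl
  refine Compatible.of_proportional (G := ∏ j, rowVal P j 2 q)
    (H := (rowVal P m 2 q * ∏ k, cc V0 k m) * l0 ^ N)
    (Finset.prod_ne_zero_iff.2 fun i _ => ?_) fun t => ?_
  · rw [hq, rowVal_smul]
    exact mul_ne_zero (X_ne_zero _) (hP.rowVal_X_ne_zero hN Sum.inl_injective i 2)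
  rw [mul_assoc _ (l0 ^ N), ← camR_smul]
  rcases t with - | ⟨j, b⟩
  · simp only [planeFamily, pullback, map_mul, map_prod, aeval_rowVal_pB, camR_none, aeval_cc]
    change _ * (rowVal P m 2 q * ∏ k, cc V0 k m) = _
    ring
  · simp only [planeFamily, pullback, map_mul, map_prod, aeval_rowVal_pB, camR_some, aeval_cc]
    change _ * (rowVal P j b.castSucc q * cc V0 m j * ∏ k ∈ Finset.univ.erase j, cc V0 k m) =
      _ * (rowVal P j b.castSucc q * ∏ k ∈ Finset.univ.erase j, rowVal P k 2 q)
    rw [← Finset.mul_prod_erase Finset.univ (fun j => rowVal P j 2 q) (Finset.mem_univ j),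
      ← Finset.mul_prod_erase Finset.univ (fun k => cc V0 k m) (Finset.mem_univ j)]
    have := hI.cc_row m j
    rw [hpB] at this
    linear_combination ((∏ k ∈ Finset.univ.erase j, rowVal P k 2 q) *
      (rowVal P j b.castSucc q * ∏ k ∈ Finset.univ.erase j, cc V0 k m)) * this

/-- Over the center of `m` no other `h_k` vanishes, and the exceptional block is nonzero. Elsewhere
take `m` such that every `h_k` divides `h_m` near the point: after division the coordinates of
camera `m`, together with the last one, are its row values times nonzero factors, and not all row
values vanish. -/
theorem exists_resolvedMap (hN : 3 ≤ N) (hP : GeneralPosition P) : ∃ φ', IsResolvedMap P φ' := by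
  refine exists_isResolvedMap hN hP fun v hI hv => ?_
  have hp0 : pB v ≠ 0 := hv (Sum.inl (Sum.inl ()))
  by_cases hcenter : ∃ m, ∀ r, rowVal P m r (pB v) = 0
  · obtain ⟨m, hm⟩ := hcenter
    have hne : ∏ k ∈ Finset.univ.erase m, rowVal P k 2 (pB v) ≠ 0 :=
      Finset.prod_ne_zero_iff.2 fun k hk h0 =>
        hp0 (hP.eq_zero_of_center (Finset.ne_of_mem_erase hk).symm 2 hm h0)
    refine ⟨_, centerFamily_compatible hN hP m, fun h => ?_⟩
    have h1 : ∀ t, aeval v (centerFamily P m t) = 0 := fun t => congrFun h t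
    have h2 : ∀ b : Fin 2, aB v m b.castSucc = 0 := fun b => by
      have := h1 (some (m, b))
      simp only [centerFamily, if_true, map_mul, map_prod, aeval_aB, aeval_rowVal_pB] at this
      exact (mul_eq_zero.1 this).resolve_right hne
    have h3 : aB v m 2 = 0 := by
      have := h1 none
      simp only [centerFamily, map_mul, map_prod, aeval_aB, aeval_rowVal_pB] at this
      exact (mul_eq_zero.1 this).resolve_right hne
    have h4 : ∀ r : Fin 3, aB v m r = 0 := fun r => match r with
      | 0 => h2 0
      | 1 => h2 1
      | 2 => h3
    exact hv (Sum.inl (Sum.inr (Sum.inl m))) (funext h4)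
  · push Not at hcenter
    obtain ⟨m, -, hm⟩ := exists_forall_rel (r := fun a b => cc v b a ≠ 0)
      (fun a b => cc_ne_zero_or hv b a) (fun a b c h1 h2 => hI.cc_trans hv h1 h2)
      (s := Finset.univ) (⟨⟨0, by omega⟩, Finset.mem_univ _⟩)
    refine ⟨_, planeFamily_compatible hN hP m, fun h => ?_⟩
    have h1 : ∀ t, aeval v (planeFamily P m t) = 0 := fun t => congrFun h t
    obtain ⟨r, hr⟩ := hcenter m
    have h2 : ∀ b : Fin 2, rowVal P m b.castSucc (pB v) = 0 := fun b => by
      have := h1 (some (m, b))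
      simp only [planeFamily, map_mul, map_prod, aeval_cc, aeval_rowVal_pB, cc_self,
        mul_one] at this
      exact (mul_eq_zero.1 this).resolve_right
        (Finset.prod_ne_zero_iff.2 fun k _ => hm k (Finset.mem_univ k))
    have h3 : rowVal P m 2 (pB v) = 0 := by
      have := h1 none
      simp only [planeFamily, map_mul, map_prod, aeval_cc, aeval_rowVal_pB] at this
      exact (mul_eq_zero.1 this).resolve_right
        (Finset.prod_ne_zero_iff.2 fun k _ => hm k (Finset.mem_univ k))
    exact hr (match r with
      | 0 => h2 0
      | 1 => h2 1
      | 2 => h3)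

end Existence

/-! ### The image of the resolved map is the multiview variety. -/

section Image

variable {N : ℕ} {P : Fin N → Matrix (Fin 3) (Fin 4) ℂ}

lemma cameraVec_eq_camR (p : Fin 4 → ℂ) : cameraVec P p = camR P p := rfl

lemma cameraVec_ne_zero {p : Fin 4 → ℂ} (hp : ∀ i, rowVal P i 2 p ≠ 0) : cameraVec P p ≠ 0 :=
  fun h => by
    have h1 : camR P p none = 0 := congrFun h none
    rw [camR_none, Finset.prod_eq_zero_iff] at h1
    obtain ⟨i, -, hi⟩ := h1
    exact hp i hi

/-- The image of the resolved map lies in the multiview variety. -/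
theorem resolvedMap_mem_multiviewVariety (hN : 3 ≤ N) (hP : GeneralPosition P)
    {φ' : resolution P → ℙ ℂ (ImgIndex N → ℂ)} (hφ : IsResolvedMap P φ') (y : resolution P) :
    φ' y ∈ multiviewVariety P := by
  intro G hG u hu hux
  obtain ⟨v, hv⟩ := exists_isLift y.1
  have hI := (mem_resolution_iff hN hP hv).1 y.2
  obtain ⟨F, hF, hFv⟩ := hφ.1.exists_represents y hv
  have hc := hφ.compatible hN hP hF
  obtain ⟨c, hcu⟩ := (Projectivization.mk_eq_mk_iff' ℂ _ _ hu hFv).1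
    (hux.trans (hF y v hv hFv).symm)
  have hc0 : c ≠ 0 := by
    rintro rfl
    exact hu (by rw [← hcu, zero_smul])
  have hu' : u = fun t => aeval v (C c * F t) := by
    rw [← hcu]
    funext t
    rw [map_mul, aeval_C]
    rfl
  -- A polynomial vanishing on the image of `φ` vanishes identically after substitution of the
  -- family. The two additional factors have nonzero pull-back and are cancelled afterwards.
  have key : pullback P (aeval (fun t => C c * F t) G * F none * camPoly P none) = 0 := by
    refine pullback_eq_zero_of_generic hN hP fun p l hp hl => ?_
    set w := graphVec P p l
    rw [map_mul, map_mul]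
    by_cases h0 : eval w (F none) = 0
    · rw [h0]; ring
    have hcam := cameraVec_ne_zero hp
    have hw : (fun t => eval w (C c * F t)) ≠ 0 := fun h => by
      have := congrFun h none
      simp only [map_mul, eval_C, Pi.zero_apply] at this
      exact (mul_ne_zero hc0 h0) this
    have hz : eval (fun t => eval w (C c * F t)) G = 0 := by
      refine hG _ hw ⟨p, hcam, ?_⟩
      refine mk_eq_mk_of_cross _ _ fun s t => ?_
      have h1 := hc.aeval_mul_camR (iPoint_graphVec (P := P) p l) t s
      rw [pB_graphVec, camR_smul, camR_smul] at h1
      simp only [map_mul, eval_C]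
      refine mul_left_cancel₀ (pow_ne_zero N (hl (Sum.inl (Sum.inl ())))) ?_
      change l _ ^ N * (camR P p t * (c * aeval w (F s))) =
        l _ ^ N * (camR P p s * (c * aeval w (F t)))
      linear_combination c * h1
    have : eval w (aeval (fun t => C c * F t) G) = eval (fun t => eval w (C c * F t)) G := by
      change (aeval w) (aeval (fun t => C c * F t) G) = _
      rw [← AlgHom.comp_apply, MvPolynomial.comp_aeval]
      rfl
    rw [this, hz]
    ring
  rw [map_mul, map_mul, pullback_camPoly] at key
  have h1 := (mul_eq_zero.1 key).resolve_right
    (mul_ne_zero (pow_ne_zero N (X_ne_zero _)) (camR_none_X_ne_zero hN hP))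
  have h2 : pullback P (F none) ≠ 0 := fun h => by
    refine hFv (funext fun t => hI _ ?_)
    have := hc none t
    rw [h, zero_mul] at this
    exact (mul_eq_zero.1 this).resolve_right (camR_none_X_ne_zero hN hP)
  have h3 := hI _ ((mul_eq_zero.1 h1).resolve_right h2)
  rw [← AlgHom.comp_apply, MvPolynomial.comp_aeval] at h3
  rw [hu']
  exact h3

/-- Zariski's lemma: such a field is finite over the algebraically closed field ℂ. -/
lemma nonempty_algHom_of_finiteType (S : Type*) [Field S] [Algebra ℂ S] [Algebra.FiniteType ℂ S] :
    Nonempty (S →ₐ[ℂ] ℂ) := by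
  have := finite_of_finite_type_of_isJacobsonRing ℂ S
  exact ⟨IsAlgClosed.lift⟩

/-- Nullstellensatz: finitely many elements of a `ℂ`-algebra can be specialized to complex
numbers. -/
lemma exists_specialization {k : Type*} [CommRing k] [Nontrivial k] [Algebra ℂ k] {ι : Type*}
    [Finite ι] (V : ι → k) :
    ∃ v : ι → ℂ, ∀ F : MvPolynomial ι ℂ, aeval V F = 0 → aeval v F = 0 := by
  let A := (aeval (R := ℂ) V).range
  have hA : Algebra.FiniteType ℂ A :=
    Algebra.FiniteType.of_surjective (aeval (R := ℂ) V).rangeRestrict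
      (AlgHom.rangeRestrict_surjective _)
  obtain ⟨M, hM⟩ := Ideal.exists_maximal A
  let := Ideal.Quotient.field M
  obtain ⟨ψ⟩ := nonempty_algHom_of_finiteType (A ⧸ M)
  let θ : MvPolynomial ι ℂ →ₐ[ℂ] ℂ :=
    (ψ.comp (Ideal.Quotient.mkₐ ℂ M)).comp (aeval (R := ℂ) V).rangeRestrict
  refine ⟨fun i => θ (X i), fun F hF => ?_⟩
  have h1 : aeval (fun i => θ (X i)) F = θ F := by
    have : aeval (R := ℂ) (fun i => θ (X i)) = θ := by
      ext i
      simp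
    rw [this]
  have h2 : (aeval (R := ℂ) V).rangeRestrict F = 0 := Subtype.ext hF
  rw [h1]
  simp [θ, h2]

/-- Valuative criterion: a point of the multiview variety is the specialization of the generic
image point along a valuation ring. -/
lemma exists_valuationRing_of_mem_multiviewVariety (K : Type) [Field K]
    [Algebra (MvPolynomial (Option (Fin 4)) ℂ) K]
    [IsFractionRing (MvPolynomial (Option (Fin 4)) ℂ) K] [Algebra ℂ K]
    [IsScalarTower ℂ (MvPolynomial (Option (Fin 4)) ℂ) K] {u : ImgIndex N → ℂ} {hu : u ≠ 0}
    (hx : Projectivization.mk ℂ u hu ∈ multiviewVariety P) (hN : 3 ≤ N) (hP : GeneralPosition P) :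
    ∃ (O : Type) (_ : CommRing O) (_ : IsDomain O) (_ : ValuationRing O) (_ : Algebra ℂ O)
      (p : Fin 4 → O) (T : ImgIndex N → O), (∀ i, rowVal P i 2 p ≠ 0) ∧ (∃ j, p j = 1) ∧
      (∀ s t, T t * camR P p s = T s * camR P p t) ∧
      ∀ t, ¬ IsUnit (T t - algebraMap ℂ O (u t)) := by
  let U := MvPolynomial (Option (Fin 4)) ℂ
  let p0 : Fin 4 → U := fun j => X (some j)
  let p1 : Fin 4 → K := fun j => algebraMap U K (p0 j)
  -- The variable `X none` scales the generic image point, so the range of `κ` is the coordinate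
  -- ring of the cone over the multiview variety.
  let κ : MvPolynomial (ImgIndex N) ℂ →ₐ[ℂ] K :=
    aeval fun t => algebraMap U K (X none * camR P p0 t)
  let A : Subring K := κ.range.toSubring
  let ρ : MvPolynomial (ImgIndex N) ℂ →+* A := κ.toRingHom.rangeRestrict
  have hρ : Function.Surjective ρ := RingHom.rangeRestrict_surjective _
  have hker : ∀ G, κ G = 0 → eval u G = 0 := by
    intro G hG
    refine hx G (fun w hw hwS => ?_) u hu rfl
    obtain ⟨p, hp, hpw⟩ := hwS
    obtain ⟨a, ha⟩ := (Projectivization.mk_eq_mk_iff' ℂ _ _ hw hp).1 hpw.symm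
    have h1 : aeval (fun t => X none * camR P p0 t) G = (0 : U) := by
      apply IsFractionRing.injective U K
      rw [map_zero, ← hG]
      have : κ = (IsScalarTower.toAlgHom ℂ U K).comp (aeval fun t => X none * camR P p0 t) := by
        ext t
        simp [κ]
      rw [this]
      rfl
    have h2 := congrArg (aeval (fun o : Option (Fin 4) => o.elim a p)) h1
    rw [map_zero, ← AlgHom.comp_apply, MvPolynomial.comp_aeval] at h2
    have h3 : w = fun t => aeval (fun o : Option (Fin 4) => o.elim a p) (X none * camR P p0 t) := by
      funext t
      rw [map_mul, map_camR, ← ha]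
      simp only [aeval_X, p0]
      rfl
    rw [h3]
    exact h2
  -- The ideal of the point `u` on the cone; it is proper because every polynomial in the kernel of
  -- `κ` vanishes at `u`.
  let I : Ideal A := (RingHom.ker (eval u)).map ρ
  have hI : I ≠ ⊤ := by
    intro h
    have h1 : (1 : A) ∈ I := h ▸ Submodule.mem_top
    obtain ⟨G, hG, hG1⟩ := (Ideal.mem_map_iff_of_surjective ρ hρ).1 h1
    have h2 : κ (G - 1) = 0 := by
      rw [map_sub, map_one, sub_eq_zero]
      exact congrArg Subtype.val hG1
    have h3 := hker _ h2
    rw [map_sub, RingHom.mem_ker.1 hG, map_one] at h3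
    norm_num at h3
  obtain ⟨B, hAB, hIB⟩ := Ideal.image_subset_nonunits_valuationSubring I hI
  have hCB : ∀ c : ℂ, algebraMap ℂ K c ∈ B := fun c => hAB ⟨C c, by
    change κ (C c) = _
    rw [← MvPolynomial.algebraMap_eq, AlgHom.commutes]⟩
  let alg : Algebra ℂ B := ((algebraMap ℂ K).codRestrict B.toSubring hCB).toAlgebra
  let ιB : B →ₐ[ℂ] K := { B.subtype with commutes' := fun c => rfl }
  have hιB : Function.Injective ιB := Subtype.val_injective
  have hp1 : ∀ j, p1 j ≠ 0 := fun j => by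
    rw [Ne, IsFractionRing.to_map_eq_zero_iff]
    exact X_ne_zero _
  -- Division by a coordinate of least valuation makes the generic point of ℙ³ integral, with one
  -- coordinate equal to 1.
  obtain ⟨j0, -, hj0⟩ := exists_forall_rel (r := fun a b => p1 b / p1 a ∈ B)
    (fun a b => by
      rcases B.mem_or_inv_mem (p1 b / p1 a) with h | h
      · exact Or.inl h
      · right
        rwa [inv_div] at h)
    (fun a b c h1 h2 => by
      have : p1 c / p1 a = p1 c / p1 b * (p1 b / p1 a) :=
        (div_mul_div_cancel₀ (hp1 b)).symm
      rw [this]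
      exact B.mul_mem _ _ h2 h1) (s := Finset.univ) ⟨0, Finset.mem_univ _⟩
  let p : Fin 4 → B := fun j => ⟨p1 j / p1 j0, hj0 j (Finset.mem_univ j)⟩
  have hpp : p1 = fun j => p1 j0 * ιB (p j) := by
    funext j
    exact (mul_div_cancel₀ (p1 j) (hp1 j0)).symm
  let T : ImgIndex N → B := fun t => ⟨κ (X t), hAB ⟨X t, rfl⟩⟩
  have hT : ∀ t, ιB (T t) = algebraMap U K (X none) * camR P p1 t := by
    intro t
    change κ (X t) = _
    simp only [κ, aeval_X, map_mul]
    congr 1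
    exact map_camR (IsScalarTower.toAlgHom ℂ U K) p0 t
  refine ⟨B, inferInstance, inferInstance, inferInstance, alg, p, T, fun i h => ?_, ⟨j0, ?_⟩,
    fun s t => ?_, fun t ht => ?_⟩
  · have h1 := congrArg ιB h
    rw [map_rowVal, map_zero] at h1
    have h2 : rowVal P i 2 p1 = 0 := by
      rw [hpp, rowVal_smul, h1, mul_zero]
    have h3 := map_rowVal (IsScalarTower.toAlgHom ℂ U K) P i 2 p0
    refine hP.rowVal_X_ne_zero hN (c := (some : Fin 4 → Option (Fin 4)))
      (Option.some_injective _) i 2 (IsFractionRing.injective U K ?_)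
    rw [map_zero]
    exact h3.trans h2
  · exact Subtype.ext (div_self (hp1 j0))
  · apply hιB
    rw [map_mul, map_mul, map_camR, map_camR, hT, hT, hpp, camR_smul, camR_smul]
    ring
  · have h1 : κ (X t) - algebraMap ℂ K (u t) ∈ B.nonunits := by
      refine hIB ⟨ρ (X t - C (u t)), Ideal.mem_map_of_mem ρ ?_, ?_⟩
      · rw [RingHom.mem_ker]
        simp
      · change κ (X t - C (u t)) = _
        rw [map_sub, ← MvPolynomial.algebraMap_eq, AlgHom.commutes]
    have h2 := ValuationSubring.coe_mem_nonunits_iff (A := B)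
      (a := T t - algebraMap ℂ B (u t)) |>.1 h1
    exact h2 ht

/-- The resolved map is onto the multiview variety. -/
theorem exists_resolvedMap_eq (hN : 3 ≤ N) (hP : GeneralPosition P)
    {φ' : resolution P → ℙ ℂ (ImgIndex N → ℂ)} (hφ : IsResolvedMap P φ')
    {x : ℙ ℂ (ImgIndex N → ℂ)} (hx : x ∈ multiviewVariety P) : ∃ y, φ' y = x := by
  induction x using Projectivization.ind with | h u hu =>
  obtain ⟨O, _, _, _, _, p, T, hp, ⟨j0, hj0⟩, hT, hTu⟩ :=
    exists_valuationRing_of_mem_multiviewVariety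
      (FractionRing (MvPolynomial (Option (Fin 4)) ℂ)) hx hN hP
  obtain ⟨V, hV, hVp, hV1⟩ := exists_iPoint_of_valuationRing hp
  let res : O →ₐ[ℂ] IsLocalRing.ResidueField O := IsScalarTower.toAlgHom ℂ O _
  have hresT : ∀ t, res (T t) = algebraMap ℂ _ (u t) := fun t => by
    have h1 : res (T t - algebraMap ℂ O (u t)) = 0 := by
      have := (IsLocalRing.residue_eq_zero_iff (T t - algebraMap ℂ O (u t))).2
        ((IsLocalRing.mem_maximalIdeal _).2 (hTu t))
      exact this
    rw [map_sub, AlgHom.commutes, sub_eq_zero] at h1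
    exact h1
  -- The residue field may be larger than ℂ. A further specialization gives a complex point that
  -- keeps all equations over ℂ, including those that fix the image point.
  obtain ⟨v, hv⟩ := exists_specialization (fun c => res (V c))
  have hIres := hV.map res
  have hI : IPoint P v := fun F hF => hv F (hIres F hF)
  have h1 : ∀ c, V c = 1 → v c = 1 := fun c hc => by
    have := hv (X c - 1) (by simp [hc])
    simpa [sub_eq_zero] using this
  have hv0 : ∀ a, (fun k => v ⟨a, k⟩) ≠ 0 := fun a h => by
    by_cases ha : a = Sum.inl (Sum.inl ())
    · subst ha
      have h2 := h1 ⟨Sum.inl (Sum.inl ()), j0⟩ ((congrFun hVp j0).trans hj0)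
      exact one_ne_zero (h2.symm.trans (congrFun h j0))
    · obtain ⟨k, hk⟩ := hV1 a ha
      exact one_ne_zero ((h1 _ hk).symm.trans (congrFun h k))
  have hlift := isLift_ofLift v hv0
  have hy := (mem_resolution_iff hN hP hlift).2 hI
  obtain ⟨F, hF, hFv⟩ := hφ.1.exists_represents ⟨_, hy⟩ hlift
  have hc := hφ.compatible hN hP hF
  refine ⟨⟨_, hy⟩, (hF _ v hlift hFv).symm.trans (mk_eq_mk_of_cross _ _ fun s t => ?_)⟩
  -- Both vectors are proportional to the camera forms at `p`, whose last entry is nonzero in the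
  -- domain `O`.
  have hO : aeval V (F t) * T s = aeval V (F s) * T t := by
    have hcam : camR P p none ≠ 0 := by
      rw [camR_none]
      exact Finset.prod_ne_zero_iff.2 fun i _ => hp i
    have e1 := hc.aeval_mul_camR hV none t
    have e2 := hc.aeval_mul_camR hV none s
    rw [hVp] at e1 e2
    have e3 := hT none t
    have e4 := hT none s
    refine mul_left_cancel₀ (mul_ne_zero hcam hcam) ?_
    linear_combination T s * camR P p none * e1 - T t * camR P p none * e2 +
      aeval V (F none) * camR P p t * e4 - aeval V (F none) * camR P p s * e3
  have hG := hv (F t * C (u s) - F s * C (u t)) (by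
    have h2 := congrArg res hO
    have h3 : ∀ G : MvPolynomial (Coord (dims₂ N)) ℂ, aeval (fun c => res (V c)) G
        = res (aeval V G) := fun G => by
      rw [← AlgHom.comp_apply, MvPolynomial.comp_aeval]
    rw [map_mul, map_mul, hresT, hresT] at h2
    rw [map_sub, map_mul, map_mul, aeval_C, aeval_C, h3, h3, h2, sub_self])
  rw [map_sub, map_mul, map_mul, aeval_C, aeval_C, sub_eq_zero] at hG
  exact hG

end Image

/-- Vectors proportional to the same non-zero vector are proportional. -/
lemma cross_trans {τ : Type*} {A B Z : τ → ℂ} (hZ : ∃ s, Z s ≠ 0)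
    (hA : ∀ r r', A r * Z r' = A r' * Z r) (hB : ∀ r r', B r * Z r' = B r' * Z r) (r r' : τ) :
    A r * B r' = A r' * B r := by
  obtain ⟨s, hs⟩ := hZ
  refine mul_left_cancel₀ (mul_ne_zero hs hs) ?_
  linear_combination (B r' * Z s) * hA r s + (A s * Z r) * hB r' s - (B r * Z s) * hA r' s -
    A s * Z r' * hB r s

lemma exists_eq_mul_of_cross {τ : Type*} {A Z : τ → ℂ} (hZ : ∃ s, Z s ≠ 0)
    (hA : ∀ r r', A r * Z r' = A r' * Z r) : ∃ c, ∀ r, A r = c * Z r := by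
  obtain ⟨s, hs⟩ := hZ
  refine ⟨A s / Z s, fun r => ?_⟩
  have := hA r s
  field_simp
  linear_combination this

/-! ### Reconstruction of a point of space from its images. -/

section Geometry

variable {N : ℕ} {P : Fin N → Matrix (Fin 3) (Fin 4) ℂ}

/-- The center of a camera is unique. -/
lemma GeneralPosition.center_unique (hP : GeneralPosition P) (hN : 3 ≤ N) {m : Fin N}
    {p q : Fin 4 → ℂ} (hp : ∀ r, rowVal P m r p = 0) (hq : ∀ r, rowVal P m r q = 0) (hp0 : p ≠ 0) :
    ∃ c : ℂ, ∀ j, q j = c * p j := by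
  obtain ⟨j, hj⟩ := exists_ne_of_three_le hN m
  have h1 : rowVal P j 2 p ≠ 0 := fun h => hp0 (hP.eq_zero_of_center hj.symm 2 hp h)
  refine ⟨rowVal P j 2 q / rowVal P j 2 p, ?_⟩
  have : (fun k => q k + -(rowVal P j 2 q / rowVal P j 2 p) * p k) = 0 := by
    refine hP.eq_zero_of_center hj.symm 2 (fun r => ?_) ?_
    · rw [rowVal_add, rowVal_smul, hp, hq]; ring
    · rw [rowVal_add, rowVal_smul]; field_simp; ring
  intro k
  have e := congrFun this k
  simp only [Pi.zero_apply] at e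
  linear_combination e

/-- Two points with the same images in all cameras coincide, if the centers are not collinear. -/
lemma eq_mul_of_images_eq (hN : 3 ≤ N) (hP : GeneralPosition P) (hc : ¬ CollinearCenters P)
    {p p' : Fin 4 → ℂ} (hp : p ≠ 0)
    (h : ∀ m r r', rowVal P m r p * rowVal P m r' p' = rowVal P m r' p * rowVal P m r p') :
    ∃ c : ℂ, ∀ j, p' j = c * p j := by
  by_contra hcon
  have hli : LinearIndependent ℂ ![p, p'] := by
    rw [LinearIndependent.pair_iff' hp]
    rintro a rfl
    exact hcon ⟨a, fun j => rfl⟩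
  refine hc ⟨Submodule.span ℂ (Set.range ![p, p']), ?_, fun m q hq => ?_⟩
  · rw [finrank_span_eq_card hli]; simp
  have hq' : ∀ r, rowVal P m r q = 0 := fun r => congrFun (LinearMap.mem_ker.1 hq) r
  have hpL : p ∈ Submodule.span ℂ (Set.range ![p, p']) := Submodule.subset_span ⟨0, rfl⟩
  have hpL' : p' ∈ Submodule.span ℂ (Set.range ![p, p']) := Submodule.subset_span ⟨1, rfl⟩
  -- Either `p` represents the center of camera `m`, or the image of `p'` is `c` times that of `p`
  -- and `p' - c p` represents the center. In both cases the center lies on the line through `p` and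
  -- `p'`.
  by_cases h0 : ∀ r, rowVal P m r p = 0
  · obtain ⟨c, hc⟩ := hP.center_unique hN h0 hq' hp
    rw [show q = c • p from funext hc]
    exact Submodule.smul_mem _ _ hpL
  · push Not at h0
    obtain ⟨c, hc'⟩ := exists_eq_mul_of_cross (A := fun r => rowVal P m r p') h0
      (fun r r' => by linear_combination -(h m r r'))
    have hu : ∀ r, rowVal P m r (fun k => p' k + -c * p k) = 0 := fun r => by
      rw [rowVal_add, rowVal_smul, hc']; ring
    obtain ⟨a, ha⟩ := hP.center_unique hN hu hq' (fun h => hcon ⟨c, fun j => by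
      have e := congrFun h j
      simp only [Pi.zero_apply] at e
      linear_combination e⟩)
    rw [show q = a • (p' + -c • p) from funext ha]
    exact Submodule.smul_mem _ _ (Submodule.add_mem _ hpL' (Submodule.smul_mem _ _ hpL))

end Geometry

/-! ### Injectivity of the resolved map off the lines. -/

section Uniqueness

variable {N : ℕ} {P : Fin N → Matrix (Fin 3) (Fin 4) ℂ}

/-- The data that determine a point of the resolution. -/
lemma IPoint.ext_of_blocks {v v' : Coord (dims₂ N) → ℂ} (hI : IPoint P v) (hI' : IPoint P v')
    (hv : ∀ a, (fun k => v ⟨a, k⟩) ≠ 0) (hv' : ∀ a, (fun k => v' ⟨a, k⟩) ≠ 0)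
    (hp : ∃ c : ℂ, ∀ j, pB v' j = c * pB v j)
    (ha : ∀ m, (∃ r, rowVal P m r (pB v) ≠ 0) ∨
      ∀ r r', aB v m r * aB v' m r' = aB v m r' * aB v' m r)
    (hc : ∀ m n, m ≠ n → (rowVal P m 2 (pB v) ≠ 0 ∨ rowVal P n 2 (pB v) ≠ 0) ∨
      cc v m n * cc v' n m = cc v n m * cc v' m n) :
    ofLift v hv = ofLift v' hv' := by
  obtain ⟨c, hp⟩ := hp
  have hc0 : c ≠ 0 := by
    rintro rfl
    exact hv' (Sum.inl (Sum.inl ())) (funext fun j => (hp j).trans (zero_mul _))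
  have hrow : ∀ m r, rowVal P m r (pB v') = c * rowVal P m r (pB v) := fun m r => by
    rw [← rowVal_smul, ← funext hp]
  have hcc : ∀ m n, cc v m n * cc v' n m = cc v n m * cc v' m n := by
    intro m n
    by_cases hmn : m = n
    · subst hmn; ring
    rcases hc m n hmn with h | h
    · have e1 := hI.cc_row m n
      have e2 := hI'.cc_row m n
      rw [hrow, hrow] at e2
      rcases h with h | h
      · refine mul_left_cancel₀ (mul_ne_zero hc0 h) ?_
        linear_combination -cc v m n * e2 + c * cc v' m n * e1
      · refine mul_left_cancel₀ (mul_ne_zero hc0 h) ?_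
        linear_combination -cc v n m * e2 + c * cc v' n m * e1
    · exact h
  funext a
  refine mk_eq_mk_of_cross _ _ fun s r => ?_
  rcases a with (⟨⟩ | m | t) | t
  · have aux : ∀ r s : Fin 4, pB v r * pB v' s = pB v s * pB v' r := fun r s => by
      rw [hp, hp]
      ring
    exact aux r s
  · change aB v m r * aB v' m s = aB v m s * aB v' m r
    rcases ha m with h | h
    · refine cross_trans h (hI.a_row m) (fun r r' => ?_) r s
      have := hI'.a_row m r r'
      rw [hrow, hrow] at this
      refine mul_left_cancel₀ hc0 ?_
      linear_combination this
    · exact h r s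
  · change bB v t r * bB v' t s = bB v t s * bB v' t r
    -- Away from the common point of the three planes the block is determined by the point of ℙ³.
    -- Over the common point its ratios are those of the `cc`, by `IPoint.b_cc`.
    by_cases h : ∃ r, rowVal P (t.cam r) 2 (pB v) ≠ 0
    · refine cross_trans h (hI.b_row t) (fun r r' => ?_) r s
      have := hI'.b_row t r r'
      rw [hrow, hrow] at this
      refine mul_left_cancel₀ hc0 ?_
      linear_combination this
    · have e1 := hI.b_cc t r s
      have e2 := hI'.b_cc t r s
      have e3 := hcc (t.cam r) (t.cam s)
      rcases cc_ne_zero_or hv (t.cam r) (t.cam s) with h1 | h1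
      · have h2 : cc v' (t.cam r) (t.cam s) ≠ 0 := fun h2 => by
          rw [h2, mul_zero] at e3
          have h3 := (mul_eq_zero.1 e3).resolve_left h1
          exact (cc_ne_zero_or hv' (t.cam r) (t.cam s)).elim (fun h => h h2) (fun h => h h3)
        refine mul_left_cancel₀ (mul_ne_zero h1 h2) ?_
        linear_combination -bB v t r * cc v (t.cam r) (t.cam s) * e2 +
          bB v' t r * cc v' (t.cam r) (t.cam s) * e1 + bB v t r * bB v' t r * e3
      · have h2 : cc v' (t.cam s) (t.cam r) ≠ 0 := fun h2 => by
          rw [h2, mul_zero] at e3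
          have h3 := (mul_eq_zero.1 e3.symm).resolve_left h1
          exact (cc_ne_zero_or hv' (t.cam r) (t.cam s)).elim (fun h => h h3) (fun h => h h2)
        refine mul_left_cancel₀ (mul_ne_zero h1 h2) ?_
        linear_combination bB v' t s * cc v' (t.cam s) (t.cam r) * e1 -
          bB v t s * cc v (t.cam s) (t.cam r) * e2 + bB v t s * bB v' t s * e3
  · obtain ⟨h0, h1⟩ := cc_pair v t
    obtain ⟨h0', h1'⟩ := cc_pair v' t
    have := hcc t.1.1 t.1.2
    rw [h0, h1, h0', h1'] at this
    have aux : ∀ r s : Fin 2, v ⟨Sum.inr t, r⟩ * v' ⟨Sum.inr t, s⟩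
        = v ⟨Sum.inr t, s⟩ * v' ⟨Sum.inr t, r⟩ := by
      intro r s
      fin_cases r <;> fin_cases s
      · rfl
      · exact this
      · exact this.symm
      · rfl
    exact aux r s

/-- The relations between a point of the multicone over the resolution and its image. -/
structure ImgRel {R : Type*} [CommRing R] [Algebra ℂ R] (P : Fin N → Matrix (Fin 3) (Fin 4) ℂ)
    (V : Coord (dims₂ N) → R) (X : ImgIndex N → R) : Prop where
  xx_a : ∀ m r r', xx X m r * aB V m r' = xx X m r' * aB V m r
  xx_cc : ∀ m n r r', xx X m r * rowVal P n r' (pB V) * cc V m n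
      = xx X n r' * rowVal P m r (pB V) * cc V n m

section

variable {R : Type*} [CommRing R] [Algebra ℂ R]

lemma Compatible.imgRel (hN : 3 ≤ N) (hP : GeneralPosition P)
    {F : ImgIndex N → MvPolynomial (Coord (dims₂ N)) ℂ} (hF : Compatible P F)
    {V : Coord (dims₂ N) → R} (hV : IPoint P V) : ImgRel P V (fun t => aeval V (F t)) :=
  ⟨hF.xx_a hN hP hV, hF.xx_cc hN hP hV⟩

lemma ImgRel.xx_row {V : Coord (dims₂ N) → R} {X : ImgIndex N → R} (h : ImgRel P V X)
    (m : Fin N) (r r' : Fin 3) :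
    xx X m r * rowVal P m r' (pB V) = xx X m r' * rowVal P m r (pB V) := by
  simpa [cc_self] using h.xx_cc m m r r'

omit [Algebra ℂ R] in
lemma xx_mul (c : R) (X : ImgIndex N → R) (m : Fin N) (r : Fin 3) :
    xx (fun t => c * X t) m r = c * xx X m r := by
  fin_cases r <;> rfl

lemma ImgRel.of_mul {V : Coord (dims₂ N) → R} {X : ImgIndex N → R} {c : R} (hc : IsUnit c)
    (h : ImgRel P V (fun t => c * X t)) : ImgRel P V X := by
  refine ⟨fun m r r' => hc.mul_left_cancel ?_, fun m n r r' => hc.mul_left_cancel ?_⟩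
  · have := h.xx_a m r r'
    rw [xx_mul, xx_mul] at this
    linear_combination this
  · have := h.xx_cc m n r r'
    rw [xx_mul, xx_mul] at this
    linear_combination this

end

/-- The vector `u` represents a point of the line spanned by the coordinate points of camera `i`. -/
def OnLine (i : Fin N) (u : ImgIndex N → ℂ) : Prop := ∀ t, (∀ b, t ≠ some (i, b)) → u t = 0

lemma xx_ne_zero_of {X : ImgIndex N → ℂ} {i : Fin N} (h : ∃ b, X (some (i, b)) ≠ 0) :
    ∃ r, xx X i r ≠ 0 := by
  obtain ⟨b, hb⟩ := h
  exact ⟨b.castSucc, by rwa [xx_castSucc]⟩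

/-- An image point on no line and in the hyperplane `h = 0` involves two cameras. -/
lemma exists_two_of_not_onLine {X : ImgIndex N → ℂ} (hX : X ≠ 0) (h : ∀ i, ¬ OnLine i X)
    (h0 : X none = 0) : ∃ i j, i ≠ j ∧ (∃ b, X (some (i, b)) ≠ 0) ∧ ∃ b, X (some (j, b)) ≠ 0 := by
  obtain ⟨t, ht⟩ := Function.ne_iff.1 hX
  rcases t with - | ⟨i, b⟩
  · exact (ht h0).elim
  have := h i
  unfold OnLine at this
  push Not at this
  obtain ⟨t', ht', ht''⟩ := this
  rcases t' with - | ⟨j, b'⟩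
  · exact (ht'' h0).elim
  refine ⟨i, j, ?_, ⟨b, ht⟩, ⟨b', ht''⟩⟩
  rintro rfl
  exact ht' b' rfl

/-- Over points in the hyperplane `h = 0`, the camera planes of the involved cameras contain the
point of `ℙ³`. -/
lemma row_two_eq_zero {p : Fin 4 → ℂ} {X : ImgIndex N → ℂ} (h0 : X none = 0) {i : Fin N}
    (hi : ∃ b, X (some (i, b)) ≠ 0)
    (h : ∀ r r', xx X i r * rowVal P i r' p = xx X i r' * rowVal P i r p) :
    rowVal P i 2 p = 0 := by
  obtain ⟨b, hb⟩ := hi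
  have := h b.castSucc 2
  rw [xx_castSucc, xx_two, h0, zero_mul] at this
  exact (mul_eq_zero.1 this).resolve_left hb

/-- A camera is injective on each plane of another camera. -/
lemma GeneralPosition.eq_mul_of_rows (hP : GeneralPosition P) {i j : Fin N} (hij : i ≠ j)
    {p q : Fin 4 → ℂ} (hp : rowVal P j 2 p = 0) (hq : rowVal P j 2 q = 0) {c : ℂ}
    (h : ∀ r, rowVal P i r q = c * rowVal P i r p) : ∀ k, q k = c * p k := by
  have : (fun k => q k + -c * p k) = 0 := by
    refine hP.eq_zero_of_center hij 2 (fun r => ?_) ?_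
    · rw [rowVal_add, rowVal_smul, h]; ring
    · rw [rowVal_add, rowVal_smul, hp, hq]; ring
  intro k
  have e := congrFun this k
  simp only [Pi.zero_apply] at e
  linear_combination e

/-- A point in two camera planes is not the center of a camera. -/
lemma GeneralPosition.not_center (hP : GeneralPosition P) {i j : Fin N} (hij : i ≠ j)
    {p : Fin 4 → ℂ} (hp0 : p ≠ 0) (hi : rowVal P i 2 p = 0) (hj : rowVal P j 2 p = 0)
    (m : Fin N) : ∃ r, rowVal P m r p ≠ 0 := by
  by_contra! h
  by_cases hm : m = i
  · subst hm
    exact hp0 (hP.eq_zero_of_center hij 2 h hj)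
  · exact hp0 (hP.eq_zero_of_center hm 2 h hi)

/-- At most three camera planes pass through a point. -/
lemma GeneralPosition.mem_of_three (hP : GeneralPosition P) {i j k : Fin N} (hij : i ≠ j)
    (hik : i ≠ k) (hjk : j ≠ k) {p : Fin 4 → ℂ} (hp0 : p ≠ 0) (hi : rowVal P i 2 p = 0)
    (hj : rowVal P j 2 p = 0) (hk : rowVal P k 2 p = 0) {m : Fin N} (hm : rowVal P m 2 p = 0) :
    m = i ∨ m = j ∨ m = k := by
  by_contra! hcon
  refine hp0 (hP.eq_zero (ρ := ![(i, 2), (j, 2), (k, 2), (m, 2)]) ?_ fun b => ?_)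
  · intro a b h
    fin_cases a <;> fin_cases b <;>
      simp_all [hij.symm, hik.symm, hjk.symm, hcon.1.symm, hcon.2.1.symm, hcon.2.2.symm]
  · fin_cases b
    exacts [hi, hj, hk, hm]

/-- The image point determines the point of `ℙ³`, away from the lines. -/
lemma eq_mul_of_image (hN : 3 ≤ N) (hP : GeneralPosition P) (hc : ¬ CollinearCenters P)
    {X : ImgIndex N → ℂ} (hX0 : X ≠ 0) (hXl : ∀ i, ¬ OnLine i X) {p p' : Fin 4 → ℂ} (hp0 : p ≠ 0)
    (hX : ∀ m r r', xx X m r * rowVal P m r' p = xx X m r' * rowVal P m r p)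
    (hX' : ∀ m r r', xx X m r * rowVal P m r' p' = xx X m r' * rowVal P m r p') :
    ∃ c : ℂ, ∀ k, p' k = c * p k := by
  by_cases h0 : X none = 0
  · obtain ⟨i, j, hij, hi, hj⟩ := exists_two_of_not_onLine hX0 hXl h0
    have hpi := row_two_eq_zero h0 hi (hX i)
    have hpj := row_two_eq_zero h0 hj (hX j)
    have hpj' := row_two_eq_zero h0 hj (hX' j)
    obtain ⟨c, hc⟩ := exists_eq_mul_of_cross (A := fun r => rowVal P i r p')
      (hP.not_center hij hp0 hpi hpj i)
      (fun r r' => cross_trans (A := fun r => rowVal P i r p')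
        (B := fun r => rowVal P i r p) (Z := xx X i) (xx_ne_zero_of hi)
        (fun r r' => by linear_combination -(hX' i r r'))
        (fun r r' => by linear_combination -(hX i r r')) r r')
    exact ⟨c, hP.eq_mul_of_rows hij hpj hpj' hc⟩
  · have hxx : ∀ m, ∃ r, xx X m r ≠ 0 := fun m => ⟨2, h0⟩
    exact eq_mul_of_images_eq hN hP hc hp0
      (fun m => cross_trans (hxx m) (fun r r' => by linear_combination -(hX m r r'))
        (fun r r' => by linear_combination -(hX' m r r')))

/-- Away from the lines, the resolved map is injective. -/
lemma IPoint.ext_of_image (hN : 3 ≤ N) (hP : GeneralPosition P) (hc : ¬ CollinearCenters P)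
    {v v' : Coord (dims₂ N) → ℂ} (hI : IPoint P v) (hI' : IPoint P v')
    (hv : ∀ a, (fun k => v ⟨a, k⟩) ≠ 0) (hv' : ∀ a, (fun k => v' ⟨a, k⟩) ≠ 0)
    {X : ImgIndex N → ℂ} (hX : ImgRel P v X) (hX' : ImgRel P v' X) (hX0 : X ≠ 0)
    (hXl : ∀ i, ¬ OnLine i X) : ofLift v hv = ofLift v' hv' := by
  have hp0 : pB v ≠ 0 := hv (Sum.inl (Sum.inl ()))
  obtain ⟨c, hpp'⟩ := eq_mul_of_image hN hP hc hX0 hXl hp0 hX.xx_row hX'.xx_row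
  by_cases h0 : X none = 0
  · obtain ⟨i, j, hij, hi, hj⟩ := exists_two_of_not_onLine hX0 hXl h0
    have hpi := row_two_eq_zero h0 hi (hX.xx_row i)
    have hpj := row_two_eq_zero h0 hj (hX.xx_row j)
    have hnc := hP.not_center hij hp0 hpi hpj
    -- At most three camera planes pass through the point, and two of them belong to cameras `i`,
    -- `j` that occur in the image; hence any two of these planes include one of an occurring
    -- camera.
    have hsupp : ∀ n, rowVal P n 2 (pB v) = 0 → ∀ m, m ≠ n → rowVal P m 2 (pB v) = 0 →
        (∃ b, X (some (m, b)) ≠ 0) ∨ ∃ b, X (some (n, b)) ≠ 0 := by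
      intro n hn m hmn hm
      by_cases hmi : m = i
      · exact Or.inl (hmi ▸ hi)
      by_cases hmj : m = j
      · exact Or.inl (hmj ▸ hj)
      rcases hP.mem_of_three hij (Ne.symm hmi) (Ne.symm hmj) hp0 hpi hpj hm hn with h | h | h
      · exact Or.inr (h ▸ hi)
      · exact Or.inr (h ▸ hj)
      · exact (hmn h.symm).elim
    have hrow : ∀ m r, rowVal P m r (pB v') = c * rowVal P m r (pB v) := fun m r => by
      rw [← rowVal_smul, ← funext hpp']
    have hc0 : c ≠ 0 := by
      rintro rfl
      exact hv' (Sum.inl (Sum.inl ())) (funext fun j => (hpp' j).trans (zero_mul _))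
    refine hI.ext_of_blocks hI' hv hv' ⟨c, hpp'⟩ (fun m => Or.inl (hnc m)) fun m n hmn => ?_
    by_cases hm : rowVal P m 2 (pB v) = 0
    swap
    · exact Or.inl (Or.inl hm)
    by_cases hn : rowVal P n 2 (pB v) = 0
    swap
    · exact Or.inl (Or.inr hn)
    right
    -- If camera `m` occurs in the image, then `xx_cc` with a nonzero entry of `xx X m` recovers the
    -- ratio `h_m : h_n` from the image.
    have key : ∀ m n, m ≠ n → (∃ b, X (some (m, b)) ≠ 0) →
        cc v m n * cc v' n m = cc v n m * cc v' m n := by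
      intro m n hmn hmX
      obtain ⟨r, hr⟩ := xx_ne_zero_of hmX
      obtain ⟨s, hs⟩ := hnc n
      obtain ⟨r', hr'⟩ := hnc m
      have hrm : rowVal P m r (pB v) ≠ 0 := fun h => by
        have := hX.xx_row m r r'
        rw [h, mul_zero] at this
        exact (mul_ne_zero hr hr') this
      have e1 := hX.xx_cc m n r s
      have e2 := hX'.xx_cc m n r s
      rw [hrow, hrow] at e2
      refine mul_left_cancel₀ (mul_ne_zero hc0 (mul_ne_zero hr hs)) ?_
      linear_combination c * cc v' n m * e1 - cc v n m * e2
    rcases hsupp n hn m hmn hm with h | h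
    · exact key m n hmn h
    · linear_combination -(key n m hmn.symm h)
  · have hxx : ∀ m, ∃ r, xx X m r ≠ 0 := fun m => ⟨2, h0⟩
    refine hI.ext_of_blocks hI' hv hv' ⟨c, hpp'⟩ (fun m => Or.inr ?_) fun m n hmn => Or.inl ?_
    · exact cross_trans (hxx m) (fun r r' => by linear_combination -(hX.xx_a m r r'))
        (fun r r' => by linear_combination -(hX'.xx_a m r r'))
    · by_contra! hcon
      have hz : ∀ m, rowVal P m 2 (pB v) = 0 → ∀ r, rowVal P m r (pB v) = 0 := fun m hm r => by
        have := hX.xx_row m 2 r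
        rw [hm, mul_zero, xx_two] at this
        exact (mul_eq_zero.1 this).resolve_left h0
      exact hp0 (hP.eq_zero_of_center hmn 2 (hz m hcon.1) hcon.2)

end Uniqueness

/-! ### The images of the camera planes are coordinate lines. -/

section Lines

variable {N : ℕ} {P : Fin N → Matrix (Fin 3) (Fin 4) ℂ}

/-- A lift of a point of the resolution, with polynomials that represent the resolved map there. -/
structure PointData (P : Fin N → Matrix (Fin 3) (Fin 4) ℂ) (φ' : resolution P → ℙ ℂ (ImgIndex N → ℂ))
    (y : resolution P) (v : Coord (dims₂ N) → ℂ)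
    (F : ImgIndex N → MvPolynomial (Coord (dims₂ N)) ℂ) : Prop where
  lift : IsLift v y.1
  iPoint : IPoint P v
  rep : Represents (resolution P) φ' F
  compat : Compatible P F
  ne_zero : (fun t => aeval v (F t)) ≠ 0

lemma IsResolvedMap.exists_pointData_of_lift (hN : 3 ≤ N) (hP : GeneralPosition P)
    {φ' : resolution P → ℙ ℂ (ImgIndex N → ℂ)} (hφ : IsResolvedMap P φ') (y : resolution P)
    {v : Coord (dims₂ N) → ℂ} (hv : IsLift v y.1) : ∃ F, PointData P φ' y v F := by
  obtain ⟨F, hF, hFv⟩ := hφ.1.exists_represents y hv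
  exact ⟨F, hv, (mem_resolution_iff hN hP hv).1 y.2, hF, hφ.compatible hN hP hF, hFv⟩

lemma IsResolvedMap.exists_pointData (hN : 3 ≤ N) (hP : GeneralPosition P)
    {φ' : resolution P → ℙ ℂ (ImgIndex N → ℂ)} (hφ : IsResolvedMap P φ') (y : resolution P) :
    ∃ v F, PointData P φ' y v F := by
  obtain ⟨v, hv⟩ := exists_isLift y.1
  exact ⟨v, hφ.exists_pointData_of_lift hN hP y hv⟩

lemma PointData.map_eq {φ' : resolution P → ℙ ℂ (ImgIndex N → ℂ)} {y : resolution P}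
    {v : Coord (dims₂ N) → ℂ} {F : ImgIndex N → MvPolynomial (Coord (dims₂ N)) ℂ}
    (h : PointData P φ' y v F) : Projectivization.mk ℂ (fun t => aeval v (F t)) h.ne_zero = φ' y :=
  h.rep y v h.lift h.ne_zero

/-- The line in `ℙ^{2N}` spanned by the two coordinate points of camera `i`. -/
def coordLine (i : Fin N) : Set (ℙ ℂ (ImgIndex N → ℂ)) :=
  {x | ∃ (u : ImgIndex N → ℂ) (hu : u ≠ 0), OnLine i u ∧ Projectivization.mk ℂ u hu = x}

lemma OnLine.mk_mem {i : Fin N} {u : ImgIndex N → ℂ} (hu : u ≠ 0) :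
    Projectivization.mk ℂ u hu ∈ coordLine i ↔ OnLine i u := by
  refine ⟨?_, fun h => ⟨u, hu, h, rfl⟩⟩
  rintro ⟨w, hw, hwl, e⟩ t ht
  obtain ⟨a, ha⟩ := (Projectivization.mk_eq_mk_iff' ℂ _ _ hu hw).1 e.symm
  rw [← ha]
  simp [hwl t ht]

lemma OnLine.eq_zero {i j : Fin N} (hij : i ≠ j) {u : ImgIndex N → ℂ} (hi : OnLine i u)
    (hj : OnLine j u) : u = 0 := by
  funext t
  by_cases h : ∀ b, t ≠ some (i, b)
  · exact hi t h
  · push Not at h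
    obtain ⟨b, rfl⟩ := h
    exact hj _ fun b' h => hij (by simpa using congrArg (Option.map Prod.fst) h)

lemma coordLine_disjoint {i j : Fin N} (hij : i ≠ j) :
    Disjoint (coordLine i) (coordLine j) := by
  rw [Set.disjoint_left]
  rintro _ ⟨u, hu, hui, rfl⟩ huj
  exact hu (hui.eq_zero hij ((OnLine.mk_mem hu).1 huj))

lemma isProjectiveLine_coordLine (i : Fin N) : IsProjectiveLine (coordLine i) := by
  let L : (Fin 2 → ℂ) →ₗ[ℂ] (ImgIndex N → ℂ) :=
    { toFun := fun a t => t.elim 0 fun c => if c.1 = i then a c.2 else 0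
      map_add' := fun a b => by
        funext t
        rcases t with - | ⟨j, b⟩
        · simp
        · by_cases h : j = i <;> simp [h]
      map_smul' := fun c a => by
        funext t
        rcases t with - | ⟨j, b⟩
        · simp
        · by_cases h : j = i <;> simp [h] }
  have hLi : ∀ a b, L a (some (i, b)) = a b := fun a b => by simp [L]
  have hL : Function.Injective L := fun a b h => funext fun k => by
    rw [← hLi a, h, hLi]
  have hLl : ∀ a, OnLine i (L a) := by
    intro a t ht
    rcases t with - | ⟨j, b⟩
    · rfl
    · have : j ≠ i := by rintro rfl; exact ht b rfl
      simp [L, this]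
  refine ⟨L, hL, Set.ext fun x => ⟨?_, ?_⟩⟩
  · rintro ⟨u, hu, hul, rfl⟩
    have huL : u = L fun b => u (some (i, b)) := by
      funext t
      by_cases h : ∀ b, t ≠ some (i, b)
      · rw [hul t h, hLl _ t h]
      · push Not at h
        obtain ⟨b, rfl⟩ := h
        rw [hLi]
    have h0 : (fun b => u (some (i, b))) ≠ 0 := fun h => hu (by rw [huL, h, map_zero])
    refine ⟨Projectivization.mk ℂ _ h0, ?_⟩
    rw [Projectivization.map_mk]
    congr 1
    exact huL.symm
  · rintro ⟨z, rfl⟩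
    induction z using Projectivization.ind with | h a ha =>
    rw [Projectivization.map_mk]
    exact ⟨_, _, hLl a, rfl⟩

lemma camR_eq_zero_of_plane {p : Fin 4 → ℂ} {i : Fin N} (hi : rowVal P i 2 p = 0)
    {t : ImgIndex N} (ht : ∀ b, t ≠ some (i, b)) : camR P p t = 0 := by
  rcases t with - | ⟨j, b⟩
  · rw [camR_none]
    exact Finset.prod_eq_zero (Finset.mem_univ i) hi
  · have hj : i ≠ j := by rintro rfl; exact ht b rfl
    rw [camR_some, Finset.prod_eq_zero (Finset.mem_erase.2 ⟨hj, Finset.mem_univ i⟩) hi, mul_zero]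

lemma exists_camR_ne_zero_of_plane {p : Fin 4 → ℂ} {i : Fin N} (hi : rowVal P i 2 p = 0)
    (hpi : ∃ r, rowVal P i r p ≠ 0) (hj : ∀ j, j ≠ i → rowVal P j 2 p ≠ 0) :
    ∃ b, camR P p (some (i, b)) ≠ 0 := by
  have h1 : ∏ j ∈ Finset.univ.erase i, rowVal P j 2 p ≠ 0 :=
    Finset.prod_ne_zero_iff.2 fun j hji => hj j (Finset.ne_of_mem_erase hji)
  obtain ⟨r, hr⟩ := hpi
  have : ∃ b : Fin 2, rowVal P i b.castSucc p ≠ 0 := by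
    fin_cases r
    · exact ⟨0, hr⟩
    · exact ⟨1, hr⟩
    · exact (hr hi).elim
  obtain ⟨b, hb⟩ := this
  exact ⟨b, by rw [camR_some]; exact mul_ne_zero hb h1⟩

/-- All coordinates not belonging to camera `i` contain the factor `h_i`. They vanish over general
points of the plane, hence on the closure. -/
lemma cameraPlaneImage_subset (hN : 3 ≤ N) (hP : GeneralPosition P)
    {φ' : resolution P → ℙ ℂ (ImgIndex N → ℂ)} (hφ : IsResolvedMap P φ') (i : Fin N) :
    cameraPlaneImage P φ' i ⊆ coordLine i := by
  rintro _ ⟨y, hy, rfl⟩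
  obtain ⟨v, F, hd⟩ := hφ.exists_pointData hN hP y
  rw [← hd.map_eq, OnLine.mk_mem]
  intro t ht
  refine hy (F t) ?_ v hd.lift
  rintro z ⟨hz, p, hp0, hzp, hpi, hpq, hpL⟩ w hw
  obtain ⟨b, hb⟩ := exists_camR_ne_zero_of_plane (P := P) (p := p) hpi
    (Function.ne_iff.1 (hpq i)) fun j hj h => hpL j i hj ⟨h, hpi⟩
  have hcam : cameraVec P p ≠ 0 := fun h => hb (congrFun h _)
  by_cases h : (fun t => eval w (F t)) = 0
  · exact congrFun h t
  · have h1 := hd.rep ⟨z, hz⟩ w hw h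
    have h2 := cross_of_mk_eq_mk (h1.trans (hφ.2 ⟨z, hz⟩ p hp0 hzp hcam)) (some (i, b)) t
    rw [cameraVec_eq_camR, camR_eq_zero_of_plane hpi ht, mul_zero] at h2
    exact (mul_eq_zero.1 h2).resolve_right hb

/-- A point of a camera plane with prescribed image on none of the other camera planes. -/
lemma exists_generic_preimage (hN : 3 ≤ N) (hP : GeneralPosition P) (i : Fin N) (a : Fin 2 → ℂ) :
    ∃ p : Fin 4 → ℂ, (∀ b : Fin 2, rowVal P i b.castSucc p = a b) ∧ rowVal P i 2 p = 0 ∧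
      ∀ j, j ≠ i → rowVal P j 2 p ≠ 0 := by
  obtain ⟨j0, hj0⟩ := exists_ne_of_three_le hN i
  obtain ⟨e, he, -⟩ := hP.exists_dual_frame (injective_camera_rows hj0.symm 2)
  have e0 : ∀ b, rowVal P i 0 (e b) = _ := he 0
  have e1 : ∀ b, rowVal P i 1 (e b) = _ := he 1
  have e2 : ∀ b, rowVal P i 2 (e b) = _ := he 2
  have e3 : ∀ b, rowVal P j0 2 (e b) = _ := he 3
  have hq : ∀ j, j ≠ i → rowVal P j 2 (e 3) ≠ 0 := fun j hj h => by
    have h3 : e 3 = 0 := hP.eq_zero_of_center hj.symm 2 (fun r => match r with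
      | 0 => by rw [e0]; rfl
      | 1 => by rw [e1]; rfl
      | 2 => by rw [e2]; rfl) h
    have := e3 3
    rw [h3, rowVal_zero] at this
    simp at this
  let r : Fin 4 → ℂ := fun k => a 0 * e 0 k + a 1 * e 1 k
  -- The vector `e 3` represents the center of camera `i`, so its multiples do not alter the image
  -- in that camera; only finitely many multiples lead into another camera plane.
  obtain ⟨τ, hτ⟩ := Infinite.exists_notMem_finset
    (Finset.univ.image fun j => -rowVal P j 2 r / rowVal P j 2 (e 3))
  refine ⟨fun k => r k + τ * e 3 k, fun b => ?_, ?_, fun j hj h => hτ ?_⟩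
  · have : ∀ s : Fin 3, rowVal P i s (fun k => r k + τ * e 3 k) =
        a 0 * rowVal P i s (e 0) + a 1 * rowVal P i s (e 1) + τ * rowVal P i s (e 3) := fun s => by
      rw [rowVal_add, rowVal_smul, rowVal_add, rowVal_smul, rowVal_smul]
    rw [this]
    fin_cases b
    · change a 0 * rowVal P i 0 _ + a 1 * rowVal P i 0 _ + τ * rowVal P i 0 _ = _
      rw [e0, e0, e0]; simp
    · change a 0 * rowVal P i 1 _ + a 1 * rowVal P i 1 _ + τ * rowVal P i 1 _ = _
      rw [e1, e1, e1]; simp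
  · rw [rowVal_add, rowVal_smul, rowVal_add, rowVal_smul, rowVal_smul, e2, e2, e2]
    simp
  · refine Finset.mem_image.2 ⟨j, Finset.mem_univ j, ?_⟩
    rw [rowVal_add, rowVal_smul] at h
    have := hq j hj
    field_simp
    linear_combination -h

/-- The image of the proper transform of a camera plane is a coordinate line. -/
theorem cameraPlaneImage_eq (hN : 3 ≤ N) (hP : GeneralPosition P)
    {φ' : resolution P → ℙ ℂ (ImgIndex N → ℂ)} (hφ : IsResolvedMap P φ') (i : Fin N) :
    cameraPlaneImage P φ' i = coordLine i := by
  refine (cameraPlaneImage_subset hN hP hφ i).antisymm ?_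
  rintro _ ⟨u, hu, hul, rfl⟩
  obtain ⟨p, hpa, hpi, hpj⟩ := exists_generic_preimage hN hP i fun b => u (some (i, b))
  have hub : ∃ b, u (some (i, b)) ≠ 0 := by
    by_contra! h
    refine hu (funext fun t => ?_)
    by_cases ht : ∀ b, t ≠ some (i, b)
    · exact hul t ht
    · push Not at ht
      obtain ⟨b, rfl⟩ := ht
      exact h b
  have hnc : ∀ m, ∃ r, rowVal P m r p ≠ 0 := fun m => by
    by_cases hm : m = i
    · subst hm
      obtain ⟨b, hb⟩ := hub
      exact ⟨b.castSucc, by rwa [hpa]⟩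
    · exact ⟨2, hpj m hm⟩
  have hp0 : p ≠ 0 := by
    rintro rfl
    obtain ⟨r, hr⟩ := hnc i
    exact hr (rowVal_zero _ _)
  have hL : ∀ j k, j ≠ k → rowVal P j 2 p ≠ 0 ∨ rowVal P k 2 p ≠ 0 := fun j k hjk => by
    by_cases h : j = i
    · exact Or.inr (hpj k (h ▸ hjk.symm))
    · exact Or.inl (hpj j h)
  obtain ⟨hv, hy⟩ := graphVec_mem (P := P) hp0 hnc hL (l := fun _ => 1) (fun _ => one_ne_zero)
  have hyp : blowDown (ofLift (graphVec P p fun _ => 1) hv) = Projectivization.mk ℂ p hp0 :=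
    (Projectivization.mk_eq_mk_iff' ℂ _ _ _ _).2 ⟨1, funext fun k => rfl⟩
  obtain ⟨b, hb⟩ := exists_camR_ne_zero_of_plane hpi (hnc i) hpj
  have hcam : cameraVec P p ≠ 0 := fun h => hb (congrFun h _)
  refine ⟨⟨_, hy⟩, subset_zariskiClosure _ ⟨hy, p, hp0, hyp, hpi, fun j h => ?_,
    fun j k hjk h => (hL j k hjk).elim (fun h' => h' h.1) (fun h' => h' h.2)⟩, ?_⟩
  · obtain ⟨r, hr⟩ := hnc j
    exact hr (congrFun h r)
  · rw [hφ.2 ⟨_, hy⟩ p hp0 hyp hcam]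
    refine mk_eq_mk_of_cross _ _ fun s t => ?_
    rw [cameraVec_eq_camR]
    have aux : ∀ t, camR P p t = (∏ j ∈ Finset.univ.erase i, rowVal P j 2 p) * u t := by
      intro t
      by_cases ht : ∀ b, t ≠ some (i, b)
      · rw [camR_eq_zero_of_plane hpi ht, hul t ht, mul_zero]
      · push Not at ht
        obtain ⟨b, rfl⟩ := ht
        rw [camR_some, hpa, mul_comm]
    rw [aux, aux]
    ring

end Lines

/-! ### Ranks and tangent spaces of projective space. -/

section LinearAlgebra

lemma finrank_map_le_of_ker {E E₁ E₂ : Type*} [AddCommGroup E] [Module ℂ E] [FiniteDimensional ℂ E]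
    [AddCommGroup E₁] [Module ℂ E₁] [AddCommGroup E₂] [Module ℂ E₂] (W : Submodule ℂ E)
    (f : E →ₗ[ℂ] E₁) (g : E →ₗ[ℂ] E₂) (h : ∀ w ∈ W, g w = 0 → f w = 0) :
    Module.finrank ℂ (W.map f) ≤ Module.finrank ℂ (W.map g) := by
  have e : ∀ {E' : Type _} [AddCommGroup E'] [Module ℂ E'] (f : E →ₗ[ℂ] E'),
      Module.finrank ℂ (W.map f) + Module.finrank ℂ (LinearMap.ker (f ∘ₗ W.subtype))
        = Module.finrank ℂ W := by
    intro E' _ _ f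
    rw [← LinearMap.finrank_range_add_finrank_ker (f ∘ₗ W.subtype), LinearMap.range_comp,
      Submodule.range_subtype]
  have e1 := e f
  have hk : LinearMap.ker (g ∘ₗ W.subtype) ≤ LinearMap.ker (f ∘ₗ W.subtype) :=
    fun w hw => h w w.2 hw
  have e2 : Module.finrank ℂ (W.map g) + Module.finrank ℂ (LinearMap.ker (g ∘ₗ W.subtype))
        = Module.finrank ℂ W := by
    rw [← LinearMap.finrank_range_add_finrank_ker (g ∘ₗ W.subtype), LinearMap.range_comp,
      Submodule.range_subtype]
  have := Submodule.finrank_mono hk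
  omega

lemma finrank_projTangent {N : ℕ} (x : ℙ ℂ (ImgIndex N → ℂ)) :
    Module.finrank ℂ (ProjTangent x) = 2 * N := by
  have h := Submodule.finrank_quotient_add_finrank x.submodule
  rw [Projectivization.finrank_submodule] at h
  simp only [Module.finrank_fintype_fun_eq_card, Fintype.card_option, Fintype.card_prod,
    Fintype.card_fin] at h
  unfold ProjTangent
  omega

lemma mem_projectivization_submodule {τ : Type} {u w : τ → ℂ} {hu : u ≠ 0} :
    w ∈ (Projectivization.mk ℂ u hu).submodule ↔ ∃ c : ℂ, ∀ t, w t = c * u t := by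
  rw [Projectivization.submodule_mk, Submodule.mem_span_singleton]
  exact exists_congr fun c => ⟨fun h t => (congrFun h t).symm, fun h => (funext h).symm⟩

end LinearAlgebra

/-! ### Linearized relations for tangent vectors. -/

section Dual

open TrivSqZeroExt

variable {N : ℕ} {P : Fin N → Matrix (Fin 3) (Fin 4) ℂ}

/-- The vector `v + ε w` with entries in the dual numbers. -/
abbrev dualVec {σ : Type*} (v w : σ → ℂ) : σ → DualNumber ℂ := fun c => inl (v c) + inr (w c)

/-- The `cc`-coordinates of a tangent vector. -/
def ccLin (w : Coord (dims₂ N) → ℂ) (i j : Fin N) : ℂ :=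
  if h : i < j then w ⟨Sum.inr ⟨(i, j), h⟩, (0 : Fin 2)⟩
  -- On the diagonal `cc` is the constant 1, whose derivative is 0.
  else if h : j < i then w ⟨Sum.inr ⟨(j, i), h⟩, (1 : Fin 2)⟩ else 0

lemma ccLin_add (w w' : Coord (dims₂ N) → ℂ) (i j : Fin N) :
    ccLin (w + w') i j = ccLin w i j + ccLin w' i j := by
  unfold ccLin
  split_ifs <;> simp

lemma ccLin_smul (c : ℂ) (w : Coord (dims₂ N) → ℂ) (i j : Fin N) :
    ccLin (c • w) i j = c * ccLin w i j := by
  unfold ccLin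
  split_ifs <;> simp

lemma cc_dualVec (v w : Coord (dims₂ N) → ℂ) (i j : Fin N) :
    cc (dualVec v w) i j = inl (cc v i j) + inr (ccLin w i j) := by
  unfold cc ccLin
  split_ifs <;> simp

lemma xx_dualVec (x u : ImgIndex N → ℂ) (m : Fin N) (r : Fin 3) :
    xx (dualVec x u) m r = inl (xx x m r) + inr (xx u m r) := by
  fin_cases r <;> rfl

lemma rowVal_dualVec (p q : Fin 4 → ℂ) (m : Fin N) (r : Fin 3) :
    rowVal P m r (dualVec p q) = inl (rowVal P m r p) + inr (rowVal P m r q) := by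
  ext <;> simp [rowVal, TrivSqZeroExt.algebraMap_eq_inl, TrivSqZeroExt.fst_sum,
    TrivSqZeroExt.snd_sum]

lemma pB_dualVec (v w : Coord (dims₂ N) → ℂ) : pB (dualVec v w) = dualVec (pB v) (pB w) := rfl

lemma aB_dualVec (v w : Coord (dims₂ N) → ℂ) (m : Fin N) (r : Fin 3) :
    aB (dualVec v w) m r = inl (aB v m r) + inr (aB w m r) := rfl

/-- A tangent vector `w` of the multicone over the resolution at `v` and its image `u` under the
differential of a map of multicones that represents the resolved map and sends `v` to `x`. -/
structure TangentData (P : Fin N → Matrix (Fin 3) (Fin 4) ℂ) (v w : Coord (dims₂ N) → ℂ)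
    (x u : ImgIndex N → ℂ) : Prop where
  a_row : ∀ m r r', aB v m r * rowVal P m r' (pB w) + aB w m r * rowVal P m r' (pB v)
    = aB v m r' * rowVal P m r (pB w) + aB w m r' * rowVal P m r (pB v)
  cc_row : ∀ m n, cc v m n * rowVal P n 2 (pB w) + ccLin w m n * rowVal P n 2 (pB v)
    = cc v n m * rowVal P m 2 (pB w) + ccLin w n m * rowVal P m 2 (pB v)
  xx_a : ∀ m r r', xx x m r * aB w m r' + xx u m r * aB v m r'
    = xx x m r' * aB w m r + xx u m r' * aB v m r
  xx_cc : ∀ m n r r', xx x m r * rowVal P n r' (pB v) * ccLin w m n +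
      (xx x m r * rowVal P n r' (pB w) + xx u m r * rowVal P n r' (pB v)) * cc v m n
    = xx x n r' * rowVal P m r (pB v) * ccLin w n m +
      (xx x n r' * rowVal P m r (pB w) + xx u n r' * rowVal P m r (pB v)) * cc v n m

lemma TangentData.mk' {v w : Coord (dims₂ N) → ℂ} {x u : ImgIndex N → ℂ}
    (hI : IPoint P (dualVec v w)) (hX : ImgRel P (dualVec v w) (dualVec x u)) :
    TangentData P v w x u := by
  refine ⟨fun m r r' => ?_, fun m n => ?_, fun m r r' => ?_, fun m n r r' => ?_⟩
  · have := congrArg snd (hI.a_row m r r')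
    simp only [pB_dualVec, rowVal_dualVec, aB_dualVec] at this
    simpa [mul_comm] using this
  · have := congrArg snd (hI.cc_row m n)
    simp only [pB_dualVec, rowVal_dualVec, cc_dualVec] at this
    simpa [mul_comm] using this
  · have := congrArg snd (hX.xx_a m r r')
    simp only [xx_dualVec, aB_dualVec] at this
    simp only [snd_mul, snd_add, fst_add, snd_inl, snd_inr, fst_inl, fst_inr, smul_eq_mul,
      MulOpposite.smul_eq_mul_unop, MulOpposite.unop_op] at this
    linear_combination this
  · have := congrArg snd (hX.xx_cc m n r r')
    simp only [xx_dualVec, cc_dualVec, pB_dualVec, rowVal_dualVec] at this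
    simp only [snd_mul, snd_add, fst_add, fst_mul, snd_inl, snd_inr, fst_inl, fst_inr, smul_eq_mul,
      MulOpposite.smul_eq_mul_unop, MulOpposite.unop_op] at this
    linear_combination this

lemma TangentData.xx_row {v w : Coord (dims₂ N) → ℂ} {x u : ImgIndex N → ℂ}
    (h : TangentData P v w x u) (m : Fin N) (r r' : Fin 3) :
    xx x m r * rowVal P m r' (pB w) + xx u m r * rowVal P m r' (pB v)
    = xx x m r' * rowVal P m r (pB w) + xx u m r' * rowVal P m r (pB v) := by
  have := h.xx_cc m m r r'
  simp only [cc_self] at this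
  have h0 : ccLin w m m = 0 := by simp [ccLin]
  rw [h0] at this
  linear_combination this

/-- The vector `v + εw` is an `IPoint` over the dual numbers, and the compatible family sends it to
image plus `ε` times derivative. The linearized relations are the `ε`-parts of the relations already
proved over any ℂ-algebra. -/
lemma PointData.tangentData (hN : 3 ≤ N) (hP : GeneralPosition P)
    {φ' : resolution P → ℙ ℂ (ImgIndex N → ℂ)} {y : resolution P}
    {v : Coord (dims₂ N) → ℂ} {F : ImgIndex N → MvPolynomial (Coord (dims₂ N)) ℂ}
    (h : PointData P φ' y v F) {w : Coord (dims₂ N) → ℂ} (hw : w ∈ coneTangent (resolution P) v) :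
    TangentData P v w (fun t => aeval v (F t)) (familyDifferential F v w) := by
  have hI := (mem_coneTangent_resolution_iff hN hP y.2 h.lift).1 hw
  refine TangentData.mk' hI ?_
  have := h.compat.imgRel hN hP hI
  have e : (fun t => aeval (fun c => (inl (v c) + inr (w c) : DualNumber ℂ)) (F t))
      = dualVec (fun t => aeval v (F t)) (familyDifferential F v w) :=
    funext fun t => aeval_dual v w (F t)
  rwa [e] at this

lemma PointData.differentialRange_eq {φ' : resolution P → ℙ ℂ (ImgIndex N → ℂ)} {y : resolution P}
    {v : Coord (dims₂ N) → ℂ} {F : ImgIndex N → MvPolynomial (Coord (dims₂ N)) ℂ}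
    (h : PointData P φ' y v F) {x : ℙ ℂ (ImgIndex N → ℂ)} (hx : φ' y = x) :
    differentialRange (resolution P) φ' y x
      = (coneTangent (resolution P) v).map (x.submodule.mkQ ∘ₗ familyDifferential F v) :=
  Multiview.differentialRange_eq hx h.rep h.lift h.ne_zero

lemma PointData.imgRel (hN : 3 ≤ N) (hP : GeneralPosition P)
    {φ' : resolution P → ℙ ℂ (ImgIndex N → ℂ)} {y : resolution P}
    {v : Coord (dims₂ N) → ℂ} {F : ImgIndex N → MvPolynomial (Coord (dims₂ N)) ℂ}
    (h : PointData P φ' y v F) : ImgRel P v (fun t => aeval v (F t)) :=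
  h.compat.imgRel hN hP h.iPoint

end Dual

/-! ### Power series arcs and their tangent vectors. -/

section Arcs

/-- The first order part of a power series. -/
def jet : PowerSeries ℂ →ₐ[ℂ] DualNumber ℂ where
  toFun f := TrivSqZeroExt.inl (PowerSeries.constantCoeff f) + TrivSqZeroExt.inr (PowerSeries.coeff 1 f)
  map_one' := by ext <;> simp [PowerSeries.coeff_one]
  map_mul' f g := by
    ext
    · simp
    · simp [PowerSeries.coeff_one_mul]; ring
  map_zero' := by ext <;> simp
  map_add' f g := by ext <;> simp
  commutes' c := by
    ext <;> simp [TrivSqZeroExt.algebraMap_eq_inl]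

variable {N : ℕ} {P : Fin N → Matrix (Fin 3) (Fin 4) ℂ}

/-- Evaluation of power series at `0`. -/
def evalZero : PowerSeries ℂ →ₐ[ℂ] ℂ :=
  { PowerSeries.constantCoeff (R := ℂ) with
    commutes' := fun c => by simp }

lemma evalZero_apply (f : PowerSeries ℂ) : evalZero f = PowerSeries.constantCoeff f := rfl

/-- Arcs in the resolution over arcs in `ℙ³`. -/
lemma exists_arc {p : Fin 4 → PowerSeries ℂ} (hp : ∀ i, rowVal P i 2 p ≠ 0)
    (hp0 : (fun j => evalZero (p j)) ≠ 0) :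
    ∃ V : Coord (dims₂ N) → PowerSeries ℂ, IPoint P V ∧ pB V = p ∧
      ∀ a, (fun k => evalZero (V ⟨a, k⟩)) ≠ 0 := by
  obtain ⟨V, hV, hVp, h1⟩ := exists_iPoint_of_valuationRing hp
  refine ⟨V, hV, hVp, fun a => ?_⟩
  by_cases ha : a = Sum.inl (Sum.inl ())
  · subst ha
    rw [← hVp] at hp0
    exact hp0
  · obtain ⟨k, hk⟩ := h1 a ha
    intro h
    have := congrFun h k
    rw [hk, map_one] at this
    exact one_ne_zero this

/-- Arcs in the multicone over the resolution through a given point. -/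
lemma IPoint.exists_arc {v : Coord (dims₂ N) → ℂ} (hI : IPoint P v)
    (hv : ∀ a, (fun k => v ⟨a, k⟩) ≠ 0)
    {p : Fin 4 → PowerSeries ℂ} (hp : ∀ i, rowVal P i 2 p ≠ 0)
    (hp0 : ∀ j, evalZero (p j) = pB v j)
    (hmatch : ∀ V : Coord (dims₂ N) → PowerSeries ℂ, IPoint P V → pB V = p →
      (∀ m, (∃ r, rowVal P m r (pB v) ≠ 0) ∨
        ∀ r r', aB v m r * evalZero (aB V m r') = aB v m r' * evalZero (aB V m r)) ∧
      ∀ m n, m ≠ n → (rowVal P m 2 (pB v) ≠ 0 ∨ rowVal P n 2 (pB v) ≠ 0) ∨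
        cc v m n * evalZero (cc V n m) = cc v n m * evalZero (cc V m n)) :
    ∃ V : Coord (dims₂ N) → PowerSeries ℂ, IPoint P V ∧ pB V = p ∧ ∀ c, evalZero (V c) = v c := by
  obtain ⟨V, hV, hVp, hne⟩ := Multiview.exists_arc hp
    (by rw [funext hp0]; exact hv (Sum.inl (Sum.inl ())))
  obtain ⟨h1, h2⟩ := hmatch V hV hVp
  have hpV : ∀ j, pB (fun c => evalZero (V c)) j = pB v j := fun j => by
    rw [← hp0, ← hVp]; rfl
  -- The limit of the lifted arc and `v` represent the same point. The lifts then differ by block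
  -- scalars, with scalar 1 on ℙ³, and rescaling the arc makes it start at `v`.
  have := hI.ext_of_blocks (hV.map evalZero) hv hne ⟨1, fun j => by rw [hpV, one_mul]⟩ h1
    (fun m n hmn => by
      rw [← map_cc, ← map_cc]
      exact h2 m n hmn)
  obtain ⟨μ, hμ, e⟩ := (isLift_iff_exists_scaleVec (isLift_ofLift _ hne)).1
    (this ▸ isLift_ofLift v hv)
  have hμ1 : μ (Sum.inl (Sum.inl ())) = 1 := by
    obtain ⟨j, hj⟩ := Function.ne_iff.1 (hv (Sum.inl (Sum.inl ())))
    have e1 : pB v j = μ (Sum.inl (Sum.inl ())) * pB (fun c => evalZero (V c)) j := congrFun e _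
    exact mul_right_cancel₀ hj ((e1.trans (congrArg _ (hpV j))).symm.trans (one_mul (pB v j)).symm)
  refine ⟨Multiview.scaleVec μ V, hV.scaleVec μ, ?_, fun c => ?_⟩
  · rw [← hVp]
    funext j
    exact (congrArg (fun m : ℂ => m • pB V j) hμ1).trans (one_smul ..)
  · rw [e]
    simp [Multiview.scaleVec]

/-- The tangent vector of an arc. -/
lemma IPoint.tangent_mem (hN : 3 ≤ N) (hP : GeneralPosition P) {y : resolution P}
    {v : Coord (dims₂ N) → ℂ} (hv : IsLift v y.1)
    {V : Coord (dims₂ N) → PowerSeries ℂ} (hV : IPoint P V) (hVv : ∀ c, evalZero (V c) = v c) :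
    (fun c => PowerSeries.coeff 1 (V c)) ∈ coneTangent (resolution P) v := by
  rw [mem_coneTangent_resolution_iff hN hP y.2 hv]
  have := hV.map jet
  have e : (fun c => jet (V c)) = dualVec v (fun c => PowerSeries.coeff 1 (V c)) := by
    funext c
    rw [dualVec, ← hVv]
    rfl
  rwa [e] at this

lemma ccLin_coeff (V : Coord (dims₂ N) → PowerSeries ℂ) {i j : Fin N} (hij : i ≠ j) :
    ccLin (fun c => PowerSeries.coeff 1 (V c)) i j = PowerSeries.coeff 1 (cc V i j) := by
  unfold cc ccLin
  split_ifs with h1 h2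
  · rfl
  · rfl
  · omega

lemma rowVal_coeff (p : Fin 4 → PowerSeries ℂ) (m : Fin N) (r : Fin 3) (n : ℕ) :
    rowVal P m r (fun j => PowerSeries.coeff n (p j)) = PowerSeries.coeff n (rowVal P m r p) := by
  simp [rowVal]

lemma rowVal_evalZero (p : Fin 4 → PowerSeries ℂ) (m : Fin N) (r : Fin 3) :
    rowVal P m r (fun j => evalZero (p j)) = evalZero (rowVal P m r p) :=
  (map_rowVal ..).symm

end Arcs

/-! ### Ordering the camera planes through a point by divisibility. -/

section Chain

variable {N : ℕ} {P : Fin N → Matrix (Fin 3) (Fin 4) ℂ}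

/-- A total relation orders any three elements in a chain. -/
lemma exists_chain_of_total {r : Fin N → Fin N → Prop} (ht : ∀ a b, r a b ∨ r b a)
    {a b c : Fin N} (hab : a ≠ b) (hac : a ≠ c)
    (hbc : b ≠ c) : ∃ i j k, i ≠ j ∧ i ≠ k ∧ j ≠ k ∧ r i j ∧ r j k ∧
      ∀ m, (m = a ∨ m = b ∨ m = c) → m = i ∨ m = j ∨ m = k := by
  rcases ht a b with h1 | h1 <;> rcases ht b c with h2 | h2
  · exact ⟨a, b, c, hab, hac, hbc, h1, h2, by tauto⟩
  · rcases ht a c with h3 | h3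
    · exact ⟨a, c, b, hac, hab, hbc.symm, h3, h2, by tauto⟩
    · exact ⟨c, a, b, hac.symm, hbc.symm, hab, h3, h1, by tauto⟩
  · rcases ht a c with h3 | h3
    · exact ⟨b, a, c, hab.symm, hbc, hac, h1, h3, by tauto⟩
    · exact ⟨b, c, a, hbc, hab.symm, hac.symm, h2, h3, by tauto⟩
  · exact ⟨c, b, a, hbc.symm, hac.symm, hab.symm, h2, h1, by tauto⟩

/-- Three cameras whose planes include all camera planes through a point. -/
lemma GeneralPosition.exists_three (hN : 3 ≤ N) (hP : GeneralPosition P) {p : Fin 4 → ℂ}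
    (hp : p ≠ 0) : ∃ a b c, a ≠ b ∧ a ≠ c ∧ b ≠ c ∧
      ∀ m, rowVal P m 2 p = 0 → m = a ∨ m = b ∨ m = c := by
  classical
  have hcard : (Finset.univ.filter fun m => rowVal P m 2 p = 0).card ≤ 3 := by
    by_contra! h
    obtain ⟨s, hs, hs4⟩ := Finset.exists_subset_card_eq (Nat.succ_le_of_lt h)
    have hs4' : s.card = 4 := hs4
    let f := s.orderEmbOfFin hs4'
    refine hp (hP.eq_zero (ρ := fun b => (f b, 2)) (fun a b h => ?_) fun b => ?_)
    · exact f.injective (Prod.ext_iff.1 h).1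
    · exact (Finset.mem_filter.1 (hs (s.orderEmbOfFin_mem hs4' b))).2
  obtain ⟨s, hs, -, hs3⟩ := Finset.exists_subsuperset_card_eq
    (Finset.subset_univ (Finset.univ.filter fun m => rowVal P m 2 p = 0)) hcard
    (by simpa using hN)
  obtain ⟨a, b, c, hab, hac, hbc, rfl⟩ := Finset.card_eq_three.1 hs3
  refine ⟨a, b, c, hab, hac, hbc, fun m hm => ?_⟩
  have := hs (Finset.mem_filter.2 ⟨Finset.mem_univ m, hm⟩)
  simpa using this

/-- Near a point of the resolution, the forms of the camera planes through it are ordered by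
divisibility. -/
lemma exists_chain (hN : 3 ≤ N) (hP : GeneralPosition P) {v : Coord (dims₂ N) → ℂ}
    (hv : ∀ a, (fun k => v ⟨a, k⟩) ≠ 0) :
    ∃ i j k, i ≠ j ∧ i ≠ k ∧ j ≠ k ∧ cc v j i ≠ 0 ∧ cc v k j ≠ 0 ∧
      ∀ m, rowVal P m 2 (pB v) = 0 → m = i ∨ m = j ∨ m = k := by
  obtain ⟨a, b, c, hab, hac, hbc, h⟩ := hP.exists_three hN (p := pB v) (hv (Sum.inl (Sum.inl ())))
  obtain ⟨i, j, k, hij, hik, hjk, h1, h2, h3⟩ := exists_chain_of_total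
    (r := fun i j => cc v j i ≠ 0) (fun a b => cc_ne_zero_or hv b a)
    hab hac hbc
  exact ⟨i, j, k, hij, hik, hjk, h1, h2, fun m hm => h3 m (h m hm)⟩

end Chain

/-! ### Rank bounds from four homogeneous coordinates modulo one scaling direction. -/

section Charts

variable {E E₁ : Type*} [AddCommGroup E] [Module ℂ E] [FiniteDimensional ℂ E]
    [AddCommGroup E₁] [Module ℂ E₁] {W : Submodule ℂ E} {f : E →ₗ[ℂ] E₁}
    {M : E →ₗ[ℂ] (Fin 4 → ℂ)} {z : Fin 4 → ℂ}

lemma finrank_quotient_span_singleton_four (hz : z ≠ 0) :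
    Module.finrank ℂ ((Fin 4 → ℂ) ⧸ Submodule.span ℂ {z}) = 3 := by
  have h := Submodule.finrank_quotient_add_finrank (Submodule.span ℂ {z})
  rw [finrank_span_singleton hz] at h
  simp at h
  omega

/-- The coordinates `M` modulo `z` take values in a space of dimension 3, and `f` kills on `W`
everything that they kill. -/
lemma finrank_map_le_three (hz : z ≠ 0) (h : ∀ w ∈ W, ∀ c : ℂ, M w = c • z → f w = 0) :
    Module.finrank ℂ (W.map f) ≤ 3 := by
  refine (finrank_map_le_of_ker W f ((Submodule.span ℂ {z}).mkQ ∘ₗ M) fun w hw h0 => ?_).trans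
    ((Submodule.finrank_le _).trans (finrank_quotient_span_singleton_four hz).le)
  obtain ⟨c, hc⟩ := Submodule.mem_span_singleton.1 ((Submodule.Quotient.mk_eq_zero _).1 h0)
  exact h w hw c hc.symm

/-- The reverse comparison of kernels; here the coordinates modulo `z` must also take all values on
`W`. -/
lemma three_le_finrank_map (hz : z ≠ 0) (h : ∀ w ∈ W, f w = 0 → ∃ c : ℂ, M w = c • z)
    (hM : ∀ u, ∃ w ∈ W, ∃ c : ℂ, M w = u + c • z) : 3 ≤ Module.finrank ℂ (W.map f) := by
  refine le_trans ?_ (finrank_map_le_of_ker W ((Submodule.span ℂ {z}).mkQ ∘ₗ M) f fun w hw h0 => ?_)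
  · have : W.map ((Submodule.span ℂ {z}).mkQ ∘ₗ M) = ⊤ := by
      rw [eq_top_iff]
      rintro u -
      obtain ⟨u, rfl⟩ := Submodule.mkQ_surjective _ u
      obtain ⟨w, hw, c, hc⟩ := hM u
      refine ⟨w, hw, ?_⟩
      change Submodule.Quotient.mk (M w) = Submodule.Quotient.mk u
      rw [Submodule.Quotient.eq, hc, add_sub_cancel_left]
      exact Submodule.smul_mem _ _ (Submodule.mem_span_singleton_self z)
    rw [this, finrank_top, finrank_quotient_span_singleton_four hz]
  · obtain ⟨c, hc⟩ := h w hw h0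
    refine (Submodule.Quotient.mk_eq_zero _).2 ?_
    rw [hc]
    exact Submodule.smul_mem _ _ (Submodule.mem_span_singleton_self z)

end Charts

/-! ### The chart at points over no camera center. -/

section ChainChart

variable {N : ℕ} {P : Fin N → Matrix (Fin 3) (Fin 4) ℂ}

/-- The point `v` of the multicone lies over no camera center, the cameras `i`, `j`, `k` include
all those whose planes contain the point of `ℙ³`, and near `v` the form `h_k` divides `h_j` and
`h_j` divides `h_i`. -/
structure IsFlag (P : Fin N → Matrix (Fin 3) (Fin 4) ℂ) (v : Coord (dims₂ N) → ℂ)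
    (i j k : Fin N) : Prop where
  ij : i ≠ j
  ik : i ≠ k
  jk : j ≠ k
  ji : cc v j i ≠ 0
  kj : cc v k j ≠ 0
  mem : ∀ m, rowVal P m 2 (pB v) = 0 → m = i ∨ m = j ∨ m = k
  center : ∀ m, ∃ r, rowVal P m r (pB v) ≠ 0

lemma exists_isFlag (hN : 3 ≤ N) (hP : GeneralPosition P) {v : Coord (dims₂ N) → ℂ}
    (hv : ∀ a, (fun k => v ⟨a, k⟩) ≠ 0) (h : ∀ m, ∃ r, rowVal P m r (pB v) ≠ 0) :
    ∃ i j k, IsFlag P v i j k := by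
  obtain ⟨i, j, k, hij, hik, hjk, h1, h2, h3⟩ := exists_chain hN hP hv
  exact ⟨i, j, k, hij, hik, hjk, h1, h2, h3, h⟩

/-- The relations that determine the image of a point in terms of a flag of cameras. -/
structure FlagRel (P : Fin N → Matrix (Fin 3) (Fin 4) ℂ) (v : Coord (dims₂ N) → ℂ)
    (i j k : Fin N) (X : ImgIndex N → ℂ) : Prop where
  xx_row : ∀ m r r', xx X m r * rowVal P m r' (pB v) = xx X m r' * rowVal P m r (pB v)
  xx_ij : ∀ r r', xx X i r * rowVal P j r' (pB v) * cc v i j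
    = xx X j r' * rowVal P i r (pB v) * cc v j i
  xx_jk : ∀ r r', xx X j r * rowVal P k r' (pB v) * cc v j k
    = xx X k r' * rowVal P j r (pB v) * cc v k j

lemma ImgRel.flagRel {v : Coord (dims₂ N) → ℂ} {X : ImgIndex N → ℂ} (h : ImgRel P v X)
    (i j k : Fin N) : FlagRel P v i j k X :=
  ⟨h.xx_row, h.xx_cc i j, h.xx_cc j k⟩

variable {v : Coord (dims₂ N) → ℂ} {i j k : Fin N} {X : ImgIndex N → ℂ}

/-- The image is a multiple of the image of the point of `ℙ³` in each camera. -/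
structure IsCoef (P : Fin N → Matrix (Fin 3) (Fin 4) ℂ) (v : Coord (dims₂ N) → ℂ)
    (i j k : Fin N) (X : ImgIndex N → ℂ) (κ : Fin N → ℂ) : Prop where
  xx_eq : ∀ m r, xx X m r = κ m * rowVal P m r (pB v)
  ij : κ i * cc v i j = κ j * cc v j i
  jk : κ j * cc v j k = κ k * cc v k j

lemma IsCoef.none {κ : Fin N → ℂ} (h : IsCoef P v i j k X κ) (m : Fin N) :
    X none = κ m * rowVal P m 2 (pB v) := h.xx_eq m 2

lemma IsCoef.some {κ : Fin N → ℂ} (h : IsCoef P v i j k X κ) (m : Fin N) (b : Fin 2) :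
    X (some (m, b)) = κ m * rowVal P m b.castSucc (pB v) := by
  rw [← h.xx_eq, xx_castSucc]

lemma IsFlag.exists_isCoef (h : IsFlag P v i j k) (hX : FlagRel P v i j k X) :
    ∃ κ, IsCoef P v i j k X κ := by
  have key : ∀ m, ∃ c, ∀ r, xx X m r = c * rowVal P m r (pB v) := fun m =>
    exists_eq_mul_of_cross (h.center m) (hX.xx_row m)
  choose κ hκ using key
  refine ⟨κ, hκ, ?_, ?_⟩
  · obtain ⟨r, hr⟩ := h.center i
    obtain ⟨r', hr'⟩ := h.center j
    have := hX.xx_ij r r'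
    rw [hκ, hκ] at this
    refine mul_left_cancel₀ (mul_ne_zero hr hr') ?_
    linear_combination this
  · obtain ⟨r, hr⟩ := h.center j
    obtain ⟨r', hr'⟩ := h.center k
    have := hX.xx_jk r r'
    rw [hκ, hκ] at this
    refine mul_left_cancel₀ (mul_ne_zero hr hr') ?_
    linear_combination this

/-- The coefficients of all cameras are determined by that of the first camera of the flag. -/
lemma IsFlag.coef_mul (h : IsFlag P v i j k) {X' : ImgIndex N → ℂ} {κ κ' : Fin N → ℂ}
    (hκ : IsCoef P v i j k X κ) (hκ' : IsCoef P v i j k X' κ') (m : Fin N) :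
    κ i * κ' m = κ' i * κ m := by
  have hj : κ i * κ' j = κ' i * κ j := by
    refine mul_right_cancel₀ h.ji ?_
    linear_combination -κ i * hκ'.ij + κ' i * hκ.ij
  by_cases hm : rowVal P m 2 (pB v) = 0
  · rcases h.mem m hm with rfl | rfl | rfl
    · ring
    · exact hj
    · refine mul_right_cancel₀ h.kj ?_
      linear_combination -κ i * hκ'.jk + κ' i * hκ.jk + cc v j m * hj
  · refine mul_right_cancel₀ hm ?_
    have e1 := (hκ.none m).symm.trans (hκ.none i)
    have e2 := (hκ'.none m).symm.trans (hκ'.none i)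
    linear_combination κ i * e2 - κ' i * e1

lemma IsCoef.eq_zero_of_forall {κ : Fin N → ℂ} (hκ : IsCoef P v i j k X κ) (h0 : ∀ m, κ m = 0) :
    X = 0 := by
  funext t
  rcases t with - | ⟨m, b⟩
  · rw [hκ.none i, h0, zero_mul]; rfl
  · rw [hκ.some, h0, zero_mul]; rfl

/-- Vanishing of the coefficient of `i` passes to `j` and `k` along the flag, and to cameras whose
planes miss the point through the last coordinate. -/
lemma IsFlag.coef_ne_zero (h : IsFlag P v i j k) (hX : X ≠ 0) {κ : Fin N → ℂ}
    (hκ : IsCoef P v i j k X κ) : κ i ≠ 0 := by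
  intro h0
  have hj : κ j = 0 := by
    have := hκ.ij
    rw [h0, zero_mul] at this
    exact (mul_eq_zero.1 this.symm).resolve_right h.ji
  have hk : κ k = 0 := by
    have := hκ.jk
    rw [hj, zero_mul] at this
    exact (mul_eq_zero.1 this.symm).resolve_right h.kj
  refine hX (hκ.eq_zero_of_forall fun m => ?_)
  by_cases hm : rowVal P m 2 (pB v) = 0
  · rcases h.mem m hm with rfl | rfl | rfl <;> assumption
  · have e1 := (hκ.none m).symm.trans (hκ.none i)
    rw [h0, zero_mul] at e1
    exact (mul_eq_zero.1 e1).resolve_right hm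

/-- The flag relations are linear in the image vector and have at most a line of solutions. This is
applied to derivatives that satisfy the same relations. -/
lemma IsFlag.exists_eq_mul (h : IsFlag P v i j k) (hX0 : X ≠ 0) (hX : FlagRel P v i j k X)
    {X' : ImgIndex N → ℂ} (hX' : FlagRel P v i j k X') : ∃ c, ∀ t, X' t = c * X t := by
  obtain ⟨κ, hκ⟩ := h.exists_isCoef hX
  obtain ⟨κ', hκ'⟩ := h.exists_isCoef hX'
  have h0 := h.coef_ne_zero hX0 hκ
  refine ⟨κ' i / κ i, fun t => ?_⟩
  have e := h.coef_mul hκ hκ'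
  rcases t with - | ⟨m, b⟩
  · rw [hκ.none i, hκ'.none i]
    field_simp
  · rw [hκ.some, hκ'.some]
    field_simp
    linear_combination rowVal P m b.castSucc (pB v) * e m

/-- Coordinates of tangent vectors near a point over no camera center. -/
def flagMap (P : Fin N → Matrix (Fin 3) (Fin 4) ℂ) (v : Coord (dims₂ N) → ℂ) (i j k : Fin N) :
    (Coord (dims₂ N) → ℂ) →ₗ[ℂ] (Fin 4 → ℂ) where
  toFun w := ![ccLin w i j * cc v j i - cc v i j * ccLin w j i,
    ccLin w j k * cc v k j - cc v j k * ccLin w k j, rowVal P k 2 (pB w), rowVal P i 0 (pB w)]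
  map_add' w w' := by
    have e : ∀ m r, rowVal P m r (pB (w + w')) = rowVal P m r (pB w) + rowVal P m r (pB w') :=
      fun m r => rowVal_add ..
    funext b
    fin_cases b
    · simp [ccLin_add]; ring
    · simp [ccLin_add]; ring
    · exact e k 2
    · exact e i 0
  map_smul' c w := by
    have e : ∀ m r, rowVal P m r (pB (c • w)) = c * rowVal P m r (pB w) :=
      fun m r => rowVal_smul ..
    funext b
    fin_cases b
    · simp [ccLin_smul]; ring
    · simp [ccLin_smul]; ring
    · exact e k 2
    · exact e i 0

/-- The coordinates of the direction that scales the point of `ℙ³`. -/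
def flagVec (P : Fin N → Matrix (Fin 3) (Fin 4) ℂ) (v : Coord (dims₂ N) → ℂ) (i k : Fin N) :
    Fin 4 → ℂ := ![0, 0, rowVal P k 2 (pB v), rowVal P i 0 (pB v)]

lemma injective_flag_rows (hij : i ≠ j) (hik : i ≠ k) (hjk : j ≠ k) :
    Function.Injective (![(i, 0), (i, 2), (j, 2), (k, 2)] : Fin 4 → Fin N × Fin 3) := by
  intro a b h
  fin_cases a <;> fin_cases b <;> simp_all [hij.symm, hik.symm, hjk.symm]

/-- Vectors whose coordinates along the flag are proportional. -/
lemma IsFlag.eq_mul_of_rows (h : IsFlag P v i j k) (hP : GeneralPosition P) {p q : Fin 4 → ℂ} {c : ℂ}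
    (h1 : rowVal P i 0 q = c * rowVal P i 0 p) (h2 : rowVal P i 2 q = c * rowVal P i 2 p)
    (h3 : rowVal P j 2 q = c * rowVal P j 2 p) (h4 : rowVal P k 2 q = c * rowVal P k 2 p) :
    ∀ l, q l = c * p l := by
  have : (fun l => q l + -c * p l) = 0 := by
    refine hP.eq_zero (injective_flag_rows h.ij h.ik h.jk) fun b => ?_
    rw [rowVal_add, rowVal_smul]
    fin_cases b
    · change rowVal P i 0 q + -c * rowVal P i 0 p = 0
      rw [h1]; ring
    · change rowVal P i 2 q + -c * rowVal P i 2 p = 0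
      rw [h2]; ring
    · change rowVal P j 2 q + -c * rowVal P j 2 p = 0
      rw [h3]; ring
    · change rowVal P k 2 q + -c * rowVal P k 2 p = 0
      rw [h4]; ring
  intro l
  have e := congrFun this l
  simp only [Pi.zero_apply] at e
  linear_combination e

/-- If `h_k` vanishes then so do its multiples `h_j` and `h_i`; together with `f_i` this would be
four planes with a common point. -/
lemma IsFlag.flagVec_ne_zero (h : IsFlag P v i j k) (hP : GeneralPosition P) (hI : IPoint P v)
    (hp : pB v ≠ 0) : flagVec P v i k ≠ 0 := by
  intro h0
  have h1 : rowVal P k 2 (pB v) = 0 := congrFun h0 2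
  have h2 : rowVal P i 0 (pB v) = 0 := congrFun h0 3
  have h3 : rowVal P j 2 (pB v) = 0 := by
    have := hI.cc_row j k
    rw [h1, mul_zero] at this
    exact (mul_eq_zero.1 this.symm).resolve_left h.kj
  have h4 : rowVal P i 2 (pB v) = 0 := by
    have := hI.cc_row i j
    rw [h3, mul_zero] at this
    exact (mul_eq_zero.1 this.symm).resolve_left h.ji
  refine hp (hP.eq_zero (injective_flag_rows h.ij h.ik h.jk) fun b => ?_)
  fin_cases b
  exacts [h2, h4, h3, h1]

variable {w : Coord (dims₂ N) → ℂ} {U : ImgIndex N → ℂ}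

/-- Tangent vectors in the direction that scales the point of `ℙ³` are sent to zero. -/
lemma IsFlag.image_eq_mul (h : IsFlag P v i j k) (hP : GeneralPosition P) (hI : IPoint P v)
    (hX0 : X ≠ 0) (hX : ImgRel P v X) (hT : TangentData P v w X U) {c : ℂ}
    (hM : flagMap P v i j k w = c • flagVec P v i k) : ∃ a, ∀ t, U t = a * X t := by
  have h1 : ccLin w i j * cc v j i - cc v i j * ccLin w j i = c * 0 := congrFun hM 0
  have h2 : ccLin w j k * cc v k j - cc v j k * ccLin w k j = c * 0 := congrFun hM 1
  have h3 : rowVal P k 2 (pB w) = c * rowVal P k 2 (pB v) := congrFun hM 2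
  have h4 : rowVal P i 0 (pB w) = c * rowVal P i 0 (pB v) := congrFun hM 3
  -- The derivative of `h_j / h_k` vanishes by `h2`, so `h_j` is scaled by the same factor as `h_k`.
  have h5 : rowVal P j 2 (pB w) = c * rowVal P j 2 (pB v) := by
    refine mul_left_cancel₀ (mul_ne_zero h.kj h.kj) ?_
    linear_combination -cc v k j * hT.cc_row j k + rowVal P k 2 (pB v) * h2 +
      cc v k j * cc v j k * h3 + (c * cc v k j + ccLin w k j) * hI.cc_row j k
  have h6 : rowVal P i 2 (pB w) = c * rowVal P i 2 (pB v) := by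
    refine mul_left_cancel₀ (mul_ne_zero h.ji h.ji) ?_
    linear_combination -cc v j i * hT.cc_row i j + rowVal P j 2 (pB v) * h1 +
      cc v j i * cc v i j * h5 + (c * cc v j i + ccLin w j i) * hI.cc_row i j
  have hp := h.eq_mul_of_rows hP h4 h6 h5 h3
  have hrow : ∀ m r, rowVal P m r (pB w) = c * rowVal P m r (pB v) := fun m r => by
    rw [← rowVal_smul, ← funext hp]
  -- Since `pB w` is a multiple of `pB v` and the ratios are stationary, the linearized relations
  -- reduce to the original relations for `U`.
  refine h.exists_eq_mul hX0 (hX.flagRel i j k) ⟨fun m r r' => ?_, fun r r' => ?_, fun r r' => ?_⟩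
  · have := hT.xx_row m r r'
    rw [hrow, hrow] at this
    linear_combination this - c * hX.xx_row m r r'
  · have := hT.xx_cc i j r r'
    rw [hrow, hrow] at this
    refine mul_left_cancel₀ h.ji ?_
    linear_combination cc v j i * this - (c * cc v j i + ccLin w j i) * hX.xx_cc i j r r' -
      xx X i r * rowVal P j r' (pB v) * h1
  · have := hT.xx_cc j k r r'
    rw [hrow, hrow] at this
    refine mul_left_cancel₀ h.kj ?_
    linear_combination cc v k j * this - (c * cc v k j + ccLin w k j) * hX.xx_cc j k r r' -
      xx X j r * rowVal P k r' (pB v) * h2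

/-- At points over no line, only those tangent vectors are sent to zero. -/
lemma IsFlag.flagMap_eq (h : IsFlag P v i j k) (hN : 3 ≤ N) (hP : GeneralPosition P)
    (hc : ¬ CollinearCenters P) (hp0 : pB v ≠ 0)
    (hX0 : X ≠ 0) (hXl : ∀ i, ¬ OnLine i X) (hX : ImgRel P v X) (hT : TangentData P v w X U)
    {a : ℂ} (hU : ∀ t, U t = a * X t) : ∃ c : ℂ, flagMap P v i j k w = c • flagVec P v i k := by
  have hUx : ∀ m r, xx U m r = a * xx X m r := fun m r => by
    rw [funext hU, xx_mul]
  obtain ⟨c, hpc⟩ := eq_mul_of_image hN hP hc hX0 hXl hp0 hX.xx_row (p' := pB w) fun m r r' => by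
    have := hT.xx_row m r r'
    rw [hUx, hUx] at this
    linear_combination this - a * hX.xx_row m r r'
  have hrow : ∀ m r, rowVal P m r (pB w) = c * rowVal P m r (pB v) := fun m r => by
    rw [← rowVal_smul, ← funext hpc]
  have hdiff : ∀ m n r r', xx X m r * rowVal P n r' (pB v) * ccLin w m n
      = xx X n r' * rowVal P m r (pB v) * ccLin w n m := fun m n r r' => by
    have := hT.xx_cc m n r r'
    rw [hrow, hrow, hUx, hUx] at this
    linear_combination this - (a + c) * hX.xx_cc m n r r'
  have key : ccLin w i j * cc v j i = cc v i j * ccLin w j i ∧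
      ccLin w j k * cc v k j = cc v j k * ccLin w k j := by
    obtain ⟨κ, hκ⟩ := h.exists_isCoef (hX.flagRel i j k)
    have hi := h.coef_ne_zero hX0 hκ
    -- If camera `j` did not contribute, neither would any camera other than `i`, and the image
    -- would lie on the line of `i`.
    have hj : κ j ≠ 0 := by
      intro hj
      have hij : cc v i j = 0 := by
        have := hκ.ij
        rw [hj, zero_mul] at this
        exact (mul_eq_zero.1 this).resolve_left hi
      have hk : κ k = 0 := by
        have := hκ.jk
        rw [hj, zero_mul] at this
        exact (mul_eq_zero.1 this.symm).resolve_right h.kj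
      have h0 : X none = 0 := by rw [hκ.none j, hj, zero_mul]
      refine hXl i fun t ht => ?_
      rcases t with - | ⟨m, b⟩
      · exact h0
      · rw [hκ.some]
        by_cases hm : rowVal P m 2 (pB v) = 0
        · rcases h.mem m hm with rfl | rfl | rfl
          · exact (ht b rfl).elim
          · rw [hj, zero_mul]
          · rw [hk, zero_mul]
        · have := hκ.none m
          rw [h0] at this
          rw [(mul_eq_zero.1 this.symm).resolve_right hm, zero_mul]
    constructor
    · obtain ⟨r, hr⟩ := h.center i
      obtain ⟨r', hr'⟩ := h.center j
      have := hdiff i j r r'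
      rw [hκ.xx_eq, hκ.xx_eq] at this
      refine mul_left_cancel₀ (mul_ne_zero hi (mul_ne_zero hr hr')) ?_
      linear_combination cc v j i * this - rowVal P i r (pB v) * rowVal P j r' (pB v) *
        ccLin w j i * hκ.ij
    · obtain ⟨r, hr⟩ := h.center j
      obtain ⟨r', hr'⟩ := h.center k
      have := hdiff j k r r'
      rw [hκ.xx_eq, hκ.xx_eq] at this
      refine mul_left_cancel₀ (mul_ne_zero hj (mul_ne_zero hr hr')) ?_
      linear_combination cc v k j * this - rowVal P j r (pB v) * rowVal P k r' (pB v) *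
        ccLin w k j * hκ.jk
  refine ⟨c, funext fun b => ?_⟩
  fin_cases b
  · change ccLin w i j * cc v j i - cc v i j * ccLin w j i = c * 0
    rw [key.1]; ring
  · change ccLin w j k * cc v k j - cc v j k * ccLin w k j = c * 0
    rw [key.2]; ring
  · exact hrow k 2
  · exact hrow i 0

end ChainChart

/-! ### Power series with prescribed first jet. -/

section Series

/-- The power series `a + b t + t²`. -/
def ser (a b : ℂ) : PowerSeries ℂ :=
  PowerSeries.C a + PowerSeries.C b * PowerSeries.X + PowerSeries.X ^ 2

lemma evalZero_ser (a b : ℂ) : evalZero (ser a b) = a := by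
  simp [ser, evalZero_apply]

lemma coeff_one_ser (a b : ℂ) : PowerSeries.coeff 1 (ser a b) = b := by
  simp [ser, PowerSeries.coeff_C, PowerSeries.coeff_X_pow]

lemma ser_ne_zero (a b : ℂ) : ser a b ≠ 0 := fun h => by
  have := congrArg (PowerSeries.coeff 2) h
  simp [ser, PowerSeries.coeff_X_pow] at this

lemma coeff_one_mul (f g : PowerSeries ℂ) : PowerSeries.coeff 1 (f * g)
    = evalZero f * PowerSeries.coeff 1 g + PowerSeries.coeff 1 f * evalZero g := by
  rw [PowerSeries.coeff_one_mul, evalZero_apply, evalZero_apply]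
  ring

variable {N : ℕ} {P : Fin N → Matrix (Fin 3) (Fin 4) ℂ}

/-- Vectors with prescribed coordinates along four different rows of the camera matrices. -/
lemma GeneralPosition.exists_rowVal_eq (hP : GeneralPosition P) {R : Type} [CommRing R]
    [Algebra ℂ R] {ρ : Fin 4 → Fin N × Fin 3} (hρ : Function.Injective ρ) (g : Fin 4 → R) :
    ∃ p : Fin 4 → R, ∀ b, rowVal P (ρ b).1 (ρ b).2 p = g b := by
  obtain ⟨e, he, -⟩ := hP.exists_dual_frame hρ
  refine ⟨fun l => ∑ b, g b * algebraMap ℂ R (e b l), fun a => ?_⟩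
  have h1 : ∀ b, ∑ l, algebraMap ℂ R (P (ρ a).1 (ρ a).2 l) * algebraMap ℂ R (e b l)
      = if a = b then 1 else 0 := fun b => by
    rw [show (if a = b then (1 : R) else 0) = algebraMap ℂ R (if a = b then 1 else 0) by
      split_ifs <;> simp, ← he a b, rowVal, map_sum]
    simp
  calc ∑ l, algebraMap ℂ R (P (ρ a).1 (ρ a).2 l) * ∑ b, g b * algebraMap ℂ R (e b l)
      = ∑ b, g b * ∑ l, algebraMap ℂ R (P (ρ a).1 (ρ a).2 l) * algebraMap ℂ R (e b l) := by
        simp only [Finset.mul_sum]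
        rw [Finset.sum_comm]
        exact Finset.sum_congr rfl fun _ _ => Finset.sum_congr rfl fun _ _ => by ring
    _ = g a := by simp [h1]

/-- Vectors with the same coordinates along four different rows of the camera matrices. -/
lemma GeneralPosition.ext_rowVal (hP : GeneralPosition P) {R : Type} [CommRing R]
    [Algebra ℂ R] {ρ : Fin 4 → Fin N × Fin 3} (hρ : Function.Injective ρ) {p q : Fin 4 → R}
    (h : ∀ b, rowVal P (ρ b).1 (ρ b).2 p = rowVal P (ρ b).1 (ρ b).2 q) : p = q := by
  obtain ⟨e, -, he⟩ := hP.exists_dual_frame hρ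
  funext j
  rw [he p, he q]
  simp only [h]

end Series

/-! ### Arcs in the flag chart. -/

section FlagArcs

variable {N : ℕ} {P : Fin N → Matrix (Fin 3) (Fin 4) ℂ} {v : Coord (dims₂ N) → ℂ} {i j k : Fin N}

/-- The chart is smooth: `α`, `β`, `s`, `τ` are the values of `h_i/h_j`, `h_j/h_k`, `h_k`, `f_i`
along the arc and can be prescribed freely, apart from their initial values and the condition that
`α`, `β`, `s` are nonzero. -/
lemma IsFlag.exists_arc (h : IsFlag P v i j k) (hP : GeneralPosition P) (hI : IPoint P v)
    (hv : ∀ a, (fun k => v ⟨a, k⟩) ≠ 0) {α β s τ : PowerSeries ℂ} (hα0 : α ≠ 0) (hβ0 : β ≠ 0)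
    (hs0 : s ≠ 0) (hα : evalZero α * cc v j i = cc v i j) (hβ : evalZero β * cc v k j = cc v j k)
    (hs : evalZero s = rowVal P k 2 (pB v)) (hτ : evalZero τ = rowVal P i 0 (pB v)) :
    ∃ V : Coord (dims₂ N) → PowerSeries ℂ, IPoint P V ∧ (∀ c, evalZero (V c) = v c) ∧
      rowVal P i 0 (pB V) = τ ∧ rowVal P k 2 (pB V) = s ∧ cc V i j = cc V j i * α ∧
      cc V j k = cc V k j * β := by
  have hρ := injective_flag_rows h.ij h.ik h.jk
  obtain ⟨p, hp⟩ := hP.exists_rowVal_eq hρ ![τ, s * β * α, s * β, s]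
  have p0 : rowVal P i 0 p = τ := hp 0
  have p1 : rowVal P i 2 p = s * β * α := hp 1
  have p2 : rowVal P j 2 p = s * β := hp 2
  have p3 : rowVal P k 2 p = s := hp 3
  have hj : evalZero β * rowVal P k 2 (pB v) = rowVal P j 2 (pB v) := by
    refine mul_left_cancel₀ h.kj ?_
    linear_combination hI.cc_row j k + rowVal P k 2 (pB v) * hβ
  have hi : evalZero α * rowVal P j 2 (pB v) = rowVal P i 2 (pB v) := by
    refine mul_left_cancel₀ h.ji ?_
    linear_combination hI.cc_row i j + rowVal P j 2 (pB v) * hα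
  have hpv : (fun l => evalZero (p l)) = pB v := by
    refine hP.ext_rowVal hρ fun b => ?_
    rw [rowVal_evalZero, hp]
    fin_cases b
    · exact hτ
    · change evalZero (s * β * α) = rowVal P i 2 (pB v)
      rw [map_mul, map_mul, ← hi, ← hj, hs]; ring
    · change evalZero (s * β) = rowVal P j 2 (pB v)
      rw [map_mul, ← hj, hs]; ring
    · exact hs
  have hne : ∀ m, rowVal P m 2 p ≠ 0 := fun m hm => by
    by_cases h0 : rowVal P m 2 (pB v) = 0
    · rcases h.mem m h0 with rfl | rfl | rfl
      · exact mul_ne_zero (mul_ne_zero hs0 hβ0) hα0 (p1.symm.trans hm)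
      · exact mul_ne_zero hs0 hβ0 (p2.symm.trans hm)
      · exact hs0 (p3.symm.trans hm)
    · refine h0 ?_
      rw [← hpv, rowVal_evalZero, hm, map_zero]
  have hcc : ∀ V : Coord (dims₂ N) → PowerSeries ℂ, IPoint P V → pB V = p →
      cc V i j = cc V j i * α ∧ cc V j k = cc V k j * β ∧ cc V i k = cc V k i * (α * β) := by
    intro V hV hVp
    have e1 := hV.cc_row i j
    have e2 := hV.cc_row j k
    have e3 := hV.cc_row i k
    rw [hVp, p1, p2] at e1
    rw [hVp, p2, p3] at e2
    rw [hVp, p1, p3] at e3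
    refine ⟨mul_right_cancel₀ (mul_ne_zero hs0 hβ0) ?_, mul_right_cancel₀ hs0 ?_,
      mul_right_cancel₀ hs0 ?_⟩
    · linear_combination e1
    · linear_combination e2
    · linear_combination e3
  obtain ⟨V, hV, hVp, hVv⟩ : ∃ V : Coord (dims₂ N) → PowerSeries ℂ,
      IPoint P V ∧ pB V = p ∧ ∀ c, evalZero (V c) = v c := by
    refine hI.exists_arc hv hne (fun l => congrFun hpv l)
      fun V hV hVp => ⟨fun m => Or.inl (h.center m), fun m n hmn => ?_⟩
    by_cases hm : rowVal P m 2 (pB v) = 0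
    swap
    · exact Or.inl (Or.inl hm)
    by_cases hn : rowVal P n 2 (pB v) = 0
    swap
    · exact Or.inl (Or.inr hn)
    right
    obtain ⟨h1, h2, h3⟩ := hcc V hV hVp
    have g1 : cc v i j * evalZero (cc V j i) = cc v j i * evalZero (cc V i j) := by
      rw [h1, map_mul, ← hα]; ring
    have g2 : cc v j k * evalZero (cc V k j) = cc v k j * evalZero (cc V j k) := by
      rw [h2, map_mul, ← hβ]; ring
    have g3 : cc v i k * evalZero (cc V k i) = cc v k i * evalZero (cc V i k) := by
      have e := hI.cc_cocycle i j k
      rw [← hα, ← hβ] at e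
      rw [h3, map_mul, map_mul]
      refine mul_left_cancel₀ (mul_ne_zero h.ji h.kj) ?_
      linear_combination -evalZero (cc V k i) * e
    rcases h.mem m hm with rfl | rfl | rfl <;> rcases h.mem n hn with rfl | rfl | rfl
    exacts [(hmn rfl).elim, g1, g3, g1.symm, (hmn rfl).elim, g2, g3.symm, g2.symm, (hmn rfl).elim]
  obtain ⟨h1, h2, -⟩ := hcc V hV hVp
  exact ⟨V, hV, hVv, by rw [hVp, p0], by rw [hVp, p3], h1, h2⟩

/-- Tangent vectors with prescribed coordinates. -/
lemma IsFlag.exists_tangent (h : IsFlag P v i j k) (hN : 3 ≤ N) (hP : GeneralPosition P)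
    {y : resolution P} (hl : IsLift v y.1) (z : Fin 4 → ℂ) :
    ∃ w ∈ coneTangent (resolution P) v, flagMap P v i j k w = z := by
  have hI := (mem_resolution_iff hN hP hl).1 y.2
  obtain ⟨V, hV, hVv, h1, h2, h3, h4⟩ := h.exists_arc hP hI hl.ne_zero
    -- The first entry of `flagMap` is `(cc v j i)²` times the derivative of the ratio, which
    -- explains the square; similarly for `β`.
    (α := ser (cc v i j / cc v j i) (z 0 / (cc v j i) ^ 2))
    (β := ser (cc v j k / cc v k j) (z 1 / (cc v k j) ^ 2))
    (s := ser (rowVal P k 2 (pB v)) (z 2)) (τ := ser (rowVal P i 0 (pB v)) (z 3))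
    (ser_ne_zero _ _) (ser_ne_zero _ _) (ser_ne_zero _ _)
    (by rw [evalZero_ser, div_mul_cancel₀ _ h.ji]) (by rw [evalZero_ser, div_mul_cancel₀ _ h.kj])
    (evalZero_ser _ _) (evalZero_ser _ _)
  refine ⟨_, hV.tangent_mem hN hP hl hVv, funext fun b => ?_⟩
  have hcc : ∀ m n, evalZero (cc V m n) = cc v m n := fun m n => by
    rw [map_cc, funext hVv]
  have hrow : ∀ m r, rowVal P m r (pB fun c => PowerSeries.coeff 1 (V c))
      = PowerSeries.coeff 1 (rowVal P m r (pB V)) := fun m r => rowVal_coeff _ _ _ _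
  have hji := h.ji
  have hkj := h.kj
  fin_cases b
  · change ccLin _ i j * cc v j i - cc v i j * ccLin _ j i = z 0
    rw [ccLin_coeff V h.ij, ccLin_coeff V h.ij.symm, h3, coeff_one_mul, coeff_one_ser,
      evalZero_ser, hcc]
    field_simp
    ring
  · change ccLin _ j k * cc v k j - cc v j k * ccLin _ k j = z 1
    rw [ccLin_coeff V h.jk, ccLin_coeff V h.jk.symm, h4, coeff_one_mul, coeff_one_ser,
      evalZero_ser, hcc]
    field_simp
    ring
  · exact (hrow k 2).trans (by rw [h2, coeff_one_ser]; rfl)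
  · exact (hrow i 0).trans (by rw [h1, coeff_one_ser]; rfl)

end FlagArcs

/-! ### The chart over a camera center. -/

section CenterChart

variable {N : ℕ} {P : Fin N → Matrix (Fin 3) (Fin 4) ℂ} {v : Coord (dims₂ N) → ℂ} {i : Fin N}
  {r₀ : Fin 3}

/-- The point `v` of the multicone lies over the center of camera `i`. -/
structure IsOverCenter (P : Fin N → Matrix (Fin 3) (Fin 4) ℂ) (v : Coord (dims₂ N) → ℂ)
    (i : Fin N) (r₀ : Fin 3) : Prop where
  center : ∀ r, rowVal P i r (pB v) = 0
  other : ∀ m, m ≠ i → rowVal P m 2 (pB v) ≠ 0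
  ne_zero : aB v i r₀ ≠ 0

lemma exists_isOverCenter (hP : GeneralPosition P) (hv : ∀ a, (fun k => v ⟨a, k⟩) ≠ 0)
    (h : ∀ r, rowVal P i r (pB v) = 0) : ∃ r₀, IsOverCenter P v i r₀ := by
  obtain ⟨r, hr⟩ := Function.ne_iff.1 (hv (Sum.inl (Sum.inr (Sum.inl i))))
  exact ⟨r, h, fun m hm h0 => hv (Sum.inl (Sum.inl ())) (hP.eq_zero_of_center hm.symm 2 h h0), hr⟩

/-- The relations that determine the image of a point over the center of camera `i`. -/
structure CenterRel (P : Fin N → Matrix (Fin 3) (Fin 4) ℂ) (v : Coord (dims₂ N) → ℂ)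
    (i : Fin N) (X : ImgIndex N → ℂ) : Prop where
  xx_row : ∀ m r r', xx X m r * rowVal P m r' (pB v) = xx X m r' * rowVal P m r (pB v)
  xx_a : ∀ r r', xx X i r * aB v i r' = xx X i r' * aB v i r

lemma ImgRel.centerRel {X : ImgIndex N → ℂ} (h : ImgRel P v X) (i : Fin N) : CenterRel P v i X :=
  ⟨h.xx_row, h.xx_a i⟩

/-- The exceptional block fixes the coordinates of camera `i` and the last one. The last coordinate
fixes all other cameras because their planes miss the center. -/
lemma IsOverCenter.exists_eq (h : IsOverCenter P v i r₀) {X : ImgIndex N → ℂ}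
    (hX : CenterRel P v i X) : ∃ κ : ℂ, (∀ r, xx X i r = κ * aB v i r) ∧
      ∀ m, m ≠ i → ∀ b : Fin 2, X (some (m, b)) =
        κ * (aB v i 2 * rowVal P m b.castSucc (pB v) / rowVal P m 2 (pB v)) := by
  obtain ⟨κ, hκ⟩ := exists_eq_mul_of_cross ⟨r₀, h.ne_zero⟩ hX.xx_a
  refine ⟨κ, hκ, fun m hm b => ?_⟩
  have h0 := h.other m hm
  have := hX.xx_row m b.castSucc 2
  rw [xx_castSucc, xx_two, ← xx_two X i, hκ] at this
  field_simp
  linear_combination this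

lemma IsOverCenter.coef_ne_zero (h : IsOverCenter P v i r₀) {X : ImgIndex N → ℂ} (hX0 : X ≠ 0)
    (hX : CenterRel P v i X) : ∃ r, xx X i r ≠ 0 := by
  obtain ⟨κ, h1, h2⟩ := h.exists_eq hX
  refine ⟨r₀, fun h0 => hX0 (funext fun t => ?_)⟩
  rw [h1] at h0
  have hκ : κ = 0 := (mul_eq_zero.1 h0).resolve_right h.ne_zero
  rcases t with - | ⟨m, b⟩
  · exact (h1 2).trans (by rw [hκ, zero_mul]; rfl)
  · by_cases hm : m = i
    · subst hm
      rw [← xx_castSucc X m, h1, hκ, zero_mul]; rfl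
    · rw [h2 m hm, hκ, zero_mul]; rfl

lemma IsOverCenter.exists_eq_mul (h : IsOverCenter P v i r₀) {X X' : ImgIndex N → ℂ} (hX0 : X ≠ 0)
    (hX : CenterRel P v i X) (hX' : CenterRel P v i X') : ∃ c, ∀ t, X' t = c * X t := by
  obtain ⟨r, hr⟩ := h.coef_ne_zero hX0 hX
  obtain ⟨κ, h1, h2⟩ := h.exists_eq hX
  obtain ⟨κ', h1', h2'⟩ := h.exists_eq hX'
  have hκ : κ ≠ 0 := by
    rintro rfl
    exact hr ((h1 r).trans (zero_mul _))
  refine ⟨κ' / κ, fun t => ?_⟩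
  rcases t with - | ⟨m, b⟩
  · rw [← xx_two X i, ← xx_two X' i, h1, h1']
    field_simp
  · by_cases hm : m = i
    · subst hm
      rw [← xx_castSucc X m, ← xx_castSucc X' m, h1, h1']
      field_simp
    · rw [h2 m hm, h2' m hm]
      field_simp

/-- Coordinates of tangent vectors near a point over the center of camera `i`. -/
def centerMap (P : Fin N → Matrix (Fin 3) (Fin 4) ℂ) (i : Fin N) (r₀ : Fin 3) :
    (Coord (dims₂ N) → ℂ) →ₗ[ℂ] (Fin 4 → ℂ) where
  toFun w := ![aB w i 0, aB w i 1, aB w i 2, rowVal P i r₀ (pB w)]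
  map_add' w w' := by
    funext b
    fin_cases b
    · rfl
    · rfl
    · rfl
    · exact rowVal_add P i r₀ (pB w) (pB w')
  map_smul' c w := by
    funext b
    fin_cases b
    · rfl
    · rfl
    · rfl
    · exact rowVal_smul P i r₀ c (pB w)

/-- The coordinates of the direction that scales the block over the center. -/
def centerVec (v : Coord (dims₂ N) → ℂ) (i : Fin N) : Fin 4 → ℂ :=
  ![aB v i 0, aB v i 1, aB v i 2, 0]

lemma centerMap_eq_iff {w : Coord (dims₂ N) → ℂ} {u : Fin 4 → ℂ} : centerMap P i r₀ w = u ↔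
    (∀ r : Fin 3, aB w i r = u r.castSucc) ∧ rowVal P i r₀ (pB w) = u 3 := by
  constructor
  · rintro rfl
    refine ⟨fun r => ?_, rfl⟩
    fin_cases r <;> rfl
  · rintro ⟨h1, h2⟩
    funext b
    fin_cases b
    exacts [h1 0, h1 1, h1 2, h2]

lemma centerVec_castSucc (r : Fin 3) : centerVec v i r.castSucc = aB v i r := by
  fin_cases r <;> rfl

lemma IsOverCenter.centerVec_ne_zero (h : IsOverCenter P v i r₀) : centerVec v i ≠ 0 := fun h0 =>
  h.ne_zero ((centerVec_castSucc r₀).symm.trans (congrFun h0 _))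

variable {w : Coord (dims₂ N) → ℂ} {X U : ImgIndex N → ℂ}

lemma IsOverCenter.image_eq_mul (h : IsOverCenter P v i r₀) (hN : 3 ≤ N) (hP : GeneralPosition P)
    (hp0 : pB v ≠ 0)
    (hX0 : X ≠ 0) (hX : ImgRel P v X) (hT : TangentData P v w X U) {c : ℂ}
    (hM : centerMap P i r₀ w = c • centerVec v i) : ∃ a, ∀ t, U t = a * X t := by
  obtain ⟨h1, h2⟩ := centerMap_eq_iff.1 hM
  have h1' : ∀ r, aB w i r = c * aB v i r := fun r =>
    (h1 r).trans (congrArg (c * ·) (centerVec_castSucc r))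
  have h2' : rowVal P i r₀ (pB w) = 0 := h2.trans (mul_zero c)
  obtain ⟨d, hd⟩ := hP.center_unique hN h.center (q := pB w) (fun r => by
    have := hT.a_row i r₀ r
    rw [h.center, h.center, h2'] at this
    refine mul_left_cancel₀ h.ne_zero ?_
    linear_combination this) hp0
  have hrow : ∀ m r, rowVal P m r (pB w) = d * rowVal P m r (pB v) := fun m r => by
    rw [← rowVal_smul, ← funext hd]
  refine h.exists_eq_mul hX0 (hX.centerRel i) ⟨fun m r r' => ?_, fun r r' => ?_⟩
  · have := hT.xx_row m r r'
    rw [hrow, hrow] at this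
    linear_combination this - d * hX.xx_row m r r'
  · have := hT.xx_a i r r'
    rw [h1', h1'] at this
    linear_combination this - c * hX.xx_a i r r'

/-- A stationary image forces `pB w` to be proportional to `pB v` by reconstruction from the images,
and the derivative of the exceptional block to be proportional to the block. -/
lemma IsOverCenter.centerMap_eq (h : IsOverCenter P v i r₀) (hN : 3 ≤ N) (hP : GeneralPosition P)
    (hc : ¬ CollinearCenters P) (hp0 : pB v ≠ 0)
    (hX0 : X ≠ 0) (hXl : ∀ i, ¬ OnLine i X) (hX : ImgRel P v X) (hT : TangentData P v w X U)
    {a : ℂ} (hU : ∀ t, U t = a * X t) : ∃ c : ℂ, centerMap P i r₀ w = c • centerVec v i := by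
  have hUx : ∀ m r, xx U m r = a * xx X m r := fun m r => by
    rw [funext hU, xx_mul]
  obtain ⟨d, hd⟩ := eq_mul_of_image hN hP hc hX0 hXl hp0 hX.xx_row (p' := pB w) fun m r r' => by
    have := hT.xx_row m r r'
    rw [hUx, hUx] at this
    linear_combination this - a * hX.xx_row m r r'
  obtain ⟨c, hc⟩ := exists_eq_mul_of_cross (A := aB w i) (Z := aB v i) ⟨r₀, h.ne_zero⟩
    (cross_trans (Z := xx X i) (h.coef_ne_zero hX0 (hX.centerRel i))
      (fun r r' => by
        have := hT.xx_a i r r'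
        rw [hUx, hUx] at this
        linear_combination a * hX.xx_a i r r' - this)
      (fun r r' => by linear_combination -(hX.xx_a i r r')))
  refine ⟨c, centerMap_eq_iff.2 ⟨fun r => ?_, ?_⟩⟩
  · exact (hc r).trans (congrArg (c * ·) (centerVec_castSucc r).symm)
  · rw [funext hd, rowVal_smul, h.center, mul_zero]
    exact (mul_zero c).symm

/-- Tangent vectors with prescribed coordinates, up to scaling of the block over the center. -/
lemma IsOverCenter.exists_tangent (h : IsOverCenter P v i r₀) (hN : 3 ≤ N)
    (hP : GeneralPosition P) {y : resolution P} (hl : IsLift v y.1) (z : Fin 4 → ℂ) :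
    ∃ w ∈ coneTangent (resolution P) v, ∃ c : ℂ,
      centerMap P i r₀ w = z + c • centerVec v i := by
  have hI := (mem_resolution_iff hN hP hl).1 y.2
  obtain ⟨m0, hm0⟩ := exists_ne_of_three_le hN i
  have hρ := injective_camera_rows hm0.symm 2
  set a : Fin 3 → PowerSeries ℂ := fun r => ser (aB v i r) (z r.castSucc) with ha
  -- Here `s` is the equation of the exceptional plane along the arc: the rows of camera `i` are `s
  -- • a`. As `s` starts at 0, the derivative of row `r₀` is `s'(0) * aB v i r₀ = z 3`.
  set s : PowerSeries ℂ := ser 0 (z 3 / aB v i r₀) with hs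
  have hs0 : s ≠ 0 := ser_ne_zero _ _
  obtain ⟨p, hp⟩ := hP.exists_rowVal_eq hρ
    ![s * a 0, s * a 1, s * a 2, PowerSeries.C (rowVal P m0 2 (pB v))]
  have hpi : ∀ r, rowVal P i r p = s * a r := fun r => match r with
    | 0 => hp 0
    | 1 => hp 1
    | 2 => hp 2
  have hpv : (fun l => evalZero (p l)) = pB v := by
    refine hP.ext_rowVal hρ fun b => ?_
    rw [rowVal_evalZero]
    have e : ∀ r, evalZero (rowVal P i r p) = rowVal P i r (pB v) := fun r => by
      rw [hpi, map_mul, hs, evalZero_ser, zero_mul, h.center]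
    fin_cases b
    · exact e 0
    · exact e 1
    · exact e 2
    · exact (congrArg evalZero (hp 3)).trans (by simp [evalZero_apply])
  have hne : ∀ m, rowVal P m 2 p ≠ 0 := fun m hm => by
    by_cases h0 : m = i
    · subst h0
      exact mul_ne_zero hs0 (ser_ne_zero _ _) ((hpi 2).symm.trans hm)
    · refine h.other m h0 ?_
      rw [← hpv, rowVal_evalZero, hm, map_zero]
  have hcross : ∀ V : Coord (dims₂ N) → PowerSeries ℂ, IPoint P V → pB V = p →
      ∀ r r', aB V i r * a r' = aB V i r' * a r := by
    intro V hV hVp r r'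
    have := hV.a_row i r r'
    rw [hVp, hpi, hpi] at this
    refine mul_left_cancel₀ hs0 ?_
    linear_combination this
  have ha0 : ∀ r, evalZero (a r) = aB v i r := fun r => evalZero_ser _ _
  have ha1 : ∀ r, PowerSeries.coeff 1 (a r) = z r.castSucc := fun r => coeff_one_ser _ _
  obtain ⟨V, hV, hVp, hVv⟩ : ∃ V : Coord (dims₂ N) → PowerSeries ℂ,
      IPoint P V ∧ pB V = p ∧ ∀ c, evalZero (V c) = v c := by
    refine hI.exists_arc hl.ne_zero hne (fun l => congrFun hpv l)
      fun V hV hVp => ⟨fun m => ?_, fun m n hmn => Or.inl ?_⟩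
    · by_cases hm : m = i
      · subst hm
        right
        intro r r'
        have := congrArg evalZero (hcross V hV hVp r r')
        rw [map_mul, map_mul, ha0, ha0] at this
        linear_combination -this
      · exact Or.inl ⟨2, h.other m hm⟩
    · by_cases hm : m = i
      · exact Or.inr (h.other n (hm ▸ hmn.symm))
      · exact Or.inl (h.other m hm)
  set w : Coord (dims₂ N) → ℂ := fun c => PowerSeries.coeff 1 (V c) with hw
  have hwa : ∀ r, aB w i r = PowerSeries.coeff 1 (aB V i r) := fun r => rfl
  have hVa : ∀ r, evalZero (aB V i r) = aB v i r := fun r => hVv _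
  -- The lifted block is only proportional to `a`, so its derivative is correct up to a multiple of
  -- the block itself.
  obtain ⟨c, hc⟩ := exists_eq_mul_of_cross (A := fun r => aB w i r - z r.castSucc) (Z := aB v i)
    ⟨r₀, h.ne_zero⟩ fun r r' => by
      have := congrArg (PowerSeries.coeff 1) (hcross V hV hVp r r')
      simp only [coeff_one_mul, ha0, ha1, hVa, ← hwa] at this
      linear_combination this
  refine ⟨w, hV.tangent_mem hN hP hl hVv, c, centerMap_eq_iff.2 ⟨fun r => ?_, ?_⟩⟩
  · have := hc r
    rw [Pi.add_apply, Pi.smul_apply, centerVec_castSucc, smul_eq_mul]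
    linear_combination this
  · have e : rowVal P i r₀ (pB w) = PowerSeries.coeff 1 (rowVal P i r₀ (pB V)) :=
      rowVal_coeff _ _ _ _
    rw [e, hVp, hpi, coeff_one_mul, ha0, ha1, hs, coeff_one_ser, evalZero_ser]
    change _ = z 3 + c * 0
    have := h.ne_zero
    field_simp
    ring

end CenterChart

/-! ### Subspaces of prescribed dimension. -/

section Subspaces

variable {T : Type*} [AddCommGroup T] [Module ℂ T] [FiniteDimensional ℂ T]

lemma exists_le_finrank_eq_add_one {V : Submodule ℂ T}
    (h : Module.finrank ℂ V < Module.finrank ℂ T) :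
    ∃ V', V ≤ V' ∧ Module.finrank ℂ V' = Module.finrank ℂ V + 1 := by
  have hV : V ≠ ⊤ := by
    rintro rfl
    simp at h
  obtain ⟨t, -, ht⟩ := SetLike.exists_of_lt hV.lt_top
  refine ⟨V ⊔ Submodule.span ℂ {t}, le_sup_left, ?_⟩
  have ht0 : t ≠ 0 := fun h0 => ht (h0 ▸ V.zero_mem)
  have hd : V ⊓ Submodule.span ℂ {t} = ⊥ :=
    disjoint_iff.1 ((Submodule.disjoint_span_singleton' ht0).2 ht)
  have := Submodule.finrank_sup_add_finrank_inf_eq V (Submodule.span ℂ {t})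
  rw [hd, finrank_bot, finrank_span_singleton ht0] at this
  exact this

lemma exists_finrank_eq {n : ℕ} (h : n ≤ Module.finrank ℂ T) :
    ∃ V : Submodule ℂ T, Module.finrank ℂ V = n := by
  induction n with
  | zero => exact ⟨⊥, finrank_bot ℂ T⟩
  | succ n ih =>
    obtain ⟨V, hV⟩ := ih (by omega)
    obtain ⟨V', -, hV'⟩ := exists_le_finrank_eq_add_one (V := V) (by omega)
    exact ⟨V', by omega⟩

/-- A subspace of complementary dimension that is transversal to `R`. -/
lemma exists_sup_eq_top {R : Submodule ℂ T} {n : ℕ} (hn : n ≤ Module.finrank ℂ T)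
    (h : Module.finrank ℂ T ≤ n + Module.finrank ℂ R) :
    ∃ V : Submodule ℂ T, Module.finrank ℂ V = n ∧ V ⊔ R = ⊤ := by
  induction n with
  | zero =>
    have hR : R = ⊤ := Submodule.eq_top_of_finrank_eq
      (le_antisymm (Submodule.finrank_le R) (by omega))
    exact ⟨⊥, finrank_bot ℂ T, by rw [hR]; simp⟩
  | succ n ih =>
    by_cases h' : Module.finrank ℂ T ≤ n + Module.finrank ℂ R
    · obtain ⟨V, hV, hVR⟩ := ih (by omega) h'
      obtain ⟨V', hle, hV'⟩ := exists_le_finrank_eq_add_one (V := V) (by omega)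
      exact ⟨V', by omega, eq_top_iff.2 (hVR ▸ sup_le_sup_right hle R)⟩
    · obtain ⟨V, hV⟩ := R.exists_isCompl
      refine ⟨V, ?_, hV.symm.sup_eq_top⟩
      have := Submodule.finrank_add_eq_of_isCompl hV
      omega

end Subspaces

/-! ### Rank of the differential and the first two discriminants. -/

section Discriminants

/-- Enlarge `V` by one dimension; failure to span for the larger space implies it for `V`. -/
lemma higherDiscriminant_succ_subset {ι : Type} [Fintype ι] {d : ι → ℕ} {N : ℕ}
    {Y : Set (MultiProj d)} {f : Y → ℙ ℂ (ImgIndex N → ℂ)} {m : ℕ} (hm : m < 2 * N) :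
    higherDiscriminant Y f (m + 1) ⊆ higherDiscriminant Y f m := by
  intro x hx V hV
  obtain ⟨V', hle, hV'⟩ := exists_le_finrank_eq_add_one (V := V)
    (by rw [finrank_projTangent]; omega)
  obtain ⟨y, hy, h⟩ := hx V' (by omega)
  exact ⟨y, hy, fun h' => h (eq_top_iff.2 (h' ▸ sup_le_sup_right hle _))⟩

variable {N : ℕ} {P : Fin N → Matrix (Fin 3) (Fin 4) ℂ} {φ' : resolution P → ℙ ℂ (ImgIndex N → ℂ)}
  {y : resolution P} {v : Coord (dims₂ N) → ℂ} {F : ImgIndex N → MvPolynomial (Coord (dims₂ N)) ℂ}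

lemma PointData.mkQ_eq_zero_iff (h : PointData P φ' y v F) {x : ℙ ℂ (ImgIndex N → ℂ)}
    (hx : φ' y = x) (w : Coord (dims₂ N) → ℂ) :
    (x.submodule.mkQ ∘ₗ familyDifferential F v) w = 0 ↔
      ∃ a : ℂ, ∀ t, familyDifferential F v w t = a * aeval v (F t) := by
  subst hx
  rw [← h.map_eq, ← mem_projectivization_submodule]
  exact Submodule.Quotient.mk_eq_zero _

/-- Every point lies over no camera center, with a flag of cameras, or over a camera center. -/
lemma PointData.flag_or_center (hN : 3 ≤ N) (hP : GeneralPosition P) (h : PointData P φ' y v F) :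
    (∃ i j k, IsFlag P v i j k) ∨ ∃ i r₀, IsOverCenter P v i r₀ := by
  by_cases hcenter : ∃ i, ∀ r, rowVal P i r (pB v) = 0
  · obtain ⟨i, hi⟩ := hcenter
    obtain ⟨r₀, hr₀⟩ := exists_isOverCenter hP h.lift.ne_zero hi
    exact Or.inr ⟨i, r₀, hr₀⟩
  · push Not at hcenter
    exact Or.inl (exists_isFlag hN hP h.lift.ne_zero hcenter)

lemma PointData.pB_ne_zero (h : PointData P φ' y v F) : pB v ≠ 0 :=
  h.lift.ne_zero (Sum.inl (Sum.inl ()))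

lemma PointData.finrank_differentialRange_le (hN : 3 ≤ N) (hP : GeneralPosition P)
    (h : PointData P φ' y v F) {x : ℙ ℂ (ImgIndex N → ℂ)} (hx : φ' y = x) :
    Module.finrank ℂ (differentialRange (resolution P) φ' y x) ≤ 3 := by
  rw [h.differentialRange_eq hx]
  rcases h.flag_or_center hN hP with ⟨i, j, k, hf⟩ | ⟨i, r₀, hc⟩
  · exact finrank_map_le_three (hf.flagVec_ne_zero hP h.iPoint h.pB_ne_zero) fun w hw c hM =>
      (h.mkQ_eq_zero_iff hx w).2 (hf.image_eq_mul hP h.iPoint h.ne_zero (h.imgRel hN hP)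
        (h.tangentData hN hP hw) hM)
  · exact finrank_map_le_three hc.centerVec_ne_zero fun w hw c hM =>
      (h.mkQ_eq_zero_iff hx w).2 (hc.image_eq_mul hN hP h.pB_ne_zero h.ne_zero (h.imgRel hN hP)
        (h.tangentData hN hP hw) hM)

/-- In either chart the coordinates take all values modulo scaling, and off the lines only scalings
have stationary image. -/
lemma PointData.three_le_finrank_differentialRange (hN : 3 ≤ N) (hP : GeneralPosition P)
    (hcol : ¬ CollinearCenters P) (h : PointData P φ' y v F) {x : ℙ ℂ (ImgIndex N → ℂ)}
    (hx : φ' y = x) (hxl : ∀ i, x ∉ coordLine i) :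
    3 ≤ Module.finrank ℂ (differentialRange (resolution P) φ' y x) := by
  have hXl : ∀ i, ¬ OnLine i (fun t => aeval v (F t)) := fun i hi =>
    hxl i (by rw [← hx, ← h.map_eq]; exact (OnLine.mk_mem h.ne_zero).2 hi)
  rw [h.differentialRange_eq hx]
  rcases h.flag_or_center hN hP with ⟨i, j, k, hf⟩ | ⟨i, r₀, hc⟩
  · refine three_le_finrank_map (M := flagMap P v i j k)
      (hf.flagVec_ne_zero hP h.iPoint h.pB_ne_zero) (fun w hw h0 => ?_) fun z => ?_
    · obtain ⟨a, ha⟩ := (h.mkQ_eq_zero_iff hx w).1 h0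
      exact hf.flagMap_eq hN hP hcol h.pB_ne_zero h.ne_zero hXl (h.imgRel hN hP)
        (h.tangentData hN hP hw) ha
    · obtain ⟨w, hw, e⟩ := hf.exists_tangent hN hP h.lift z
      exact ⟨w, hw, 0, by rw [e]; simp⟩
  · refine three_le_finrank_map (M := centerMap P i r₀) hc.centerVec_ne_zero
      (fun w hw h0 => ?_) fun z => hc.exists_tangent hN hP h.lift z
    obtain ⟨a, ha⟩ := (h.mkQ_eq_zero_iff hx w).1 h0
    exact hc.centerMap_eq hN hP hcol h.pB_ne_zero h.ne_zero hXl (h.imgRel hN hP)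
      (h.tangentData hN hP hw) ha

/-- The resolved map is injective over the complement of the lines. -/
lemma IsResolvedMap.eq_of_notMem_coordLine (hN : 3 ≤ N) (hP : GeneralPosition P)
    (hcol : ¬ CollinearCenters P) (hφ : IsResolvedMap P φ') {y y' : resolution P}
    (hyy : φ' y = φ' y') (hl : ∀ i, φ' y ∉ coordLine i) : y = y' := by
  obtain ⟨v, F, h⟩ := hφ.exists_pointData hN hP y
  obtain ⟨v', F', h'⟩ := hφ.exists_pointData hN hP y'
  have e := h.map_eq.trans (hyy.trans h'.map_eq.symm)
  obtain ⟨a, ha⟩ := (Projectivization.mk_eq_mk_iff' ℂ _ _ _ _).1 e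
  have ha0 : a ≠ 0 := by
    rintro rfl
    exact h.ne_zero (ha.symm.trans (zero_smul ..))
  have hX' : ImgRel P v' (fun t => aeval v (F t)) := by
    refine ImgRel.of_mul (c := a⁻¹) (isUnit_iff_ne_zero.2 (inv_ne_zero ha0)) ?_
    have : (fun t => a⁻¹ * aeval v (F t)) = fun t => aeval v' (F' t) := by
      funext t
      rw [← congrFun ha t]
      simp [ha0]
    rw [this]
    exact h'.imgRel hN hP
  have := IPoint.ext_of_image hN hP hcol h.iPoint h'.iPoint h.lift.ne_zero h'.lift.ne_zero
    (h.imgRel hN hP) hX' h.ne_zero fun i hi => hl i (by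
      rw [← h.map_eq]
      exact (OnLine.mk_mem h.ne_zero).2 hi)
  refine Subtype.ext (h.lift.ext (y' := y'.1) ?_)
  rw [(h'.lift.ext (isLift_ofLift v' h'.lift.ne_zero)), ← this]
  exact isLift_ofLift v _

/-- The first non-trivial discriminant is the image. -/
theorem higherDiscriminant_eq_multiviewVariety (hN : 3 ≤ N) (hP : GeneralPosition P)
    (hφ : IsResolvedMap P φ') :
    higherDiscriminant (resolution P) φ' (2 * N - 3) = multiviewVariety P := by
  refine Set.Subset.antisymm (fun x hx => ?_) fun x hx V hV => ?_
  -- Any subspace of the right dimension serves, since only a point of the fibre is wanted.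
  · obtain ⟨V, hV⟩ := exists_finrank_eq (T := ProjTangent x) (n := 2 * N - 4)
      (by rw [finrank_projTangent]; omega)
    obtain ⟨y, rfl, -⟩ := hx V (by omega)
    exact resolvedMap_mem_multiviewVariety hN hP hφ y
  · obtain ⟨y, hy⟩ := exists_resolvedMap_eq hN hP hφ hx
    obtain ⟨v, F, h⟩ := hφ.exists_pointData hN hP y
    refine ⟨y, hy, fun htop => ?_⟩
    have h1 := h.finrank_differentialRange_le hN hP hy
    -- The dimensions add up to at most `(2N - 4) + 3 < 2N`.
    have h2 := Submodule.finrank_add_le_finrank_add_finrank V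
      (differentialRange (resolution P) φ' y x)
    rw [htop, finrank_top, finrank_projTangent] at h2
    omega

/-- Off the lines the fibre has at most one point, and there the differential has rank 3; a
complement of its image has dimension `2N - 3` and is transversal over the whole fibre. -/
lemma higherDiscriminant_subset_iUnion (hN : 3 ≤ N) (hP : GeneralPosition P)
    (hcol : ¬ CollinearCenters P) (hφ : IsResolvedMap P φ') :
    higherDiscriminant (resolution P) φ' (2 * N - 2) ⊆ ⋃ i, coordLine i := by
  intro x hx
  by_contra hxl
  rw [Set.mem_iUnion] at hxl
  push Not at hxl
  obtain ⟨V, hV⟩ := exists_finrank_eq (T := ProjTangent x) (n := 2 * N - 3)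
      (by rw [finrank_projTangent]; omega)
  obtain ⟨y, hy, -⟩ := hx V (by omega)
  obtain ⟨v, F, h⟩ := hφ.exists_pointData hN hP y
  have h3 := h.three_le_finrank_differentialRange hN hP hcol hy hxl
  obtain ⟨V', hV', htop⟩ := exists_sup_eq_top (n := 2 * N - 3)
    (R := differentialRange (resolution P) φ' y x) (by rw [finrank_projTangent]; omega)
    (by rw [finrank_projTangent]; omega)
  obtain ⟨y', hy', h'⟩ := hx V' (by omega)
  have := hφ.eq_of_notMem_coordLine hN hP hcol (hy.trans hy'.symm) (by rwa [hy])
  subst this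
  exact h' htop

end Discriminants

/-! ### A zero or a vanishing residue of a rational function. -/

section Residues

/-- A rational function `c + ∑ ρ / (t - τ)` has a zero or a zero residue. -/
lemma exists_zero_or_residue {ι : Type*} (s : Finset ι) (hs : s.Nonempty) {c : ℂ} (hc : c ≠ 0)
    (ρ τ : ι → ℂ) : ∃ t, ((∃ m ∈ s, τ m = t) ∧ ∑ m ∈ s with τ m = t, ρ m = 0) ∨
      ((∀ m ∈ s, τ m ≠ t) ∧ c + ∑ m ∈ s, ρ m / (t - τ m) = 0) := by
  classical
  set S := s.image τ with hS
  set r : ℂ → ℂ := fun d => ∑ m ∈ s with τ m = d, ρ m with hr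
  -- `A + B` is the numerator over the common denominator, coinciding poles being merged with total
  -- residue `r d`. Since `c ≠ 0` and there is a pole, it has positive degree, hence a root; at a
  -- root in `S` only the term of that pole survives.
  set A : Polynomial ℂ := Polynomial.C c * ∏ d ∈ S, (Polynomial.X - Polynomial.C d) with hA
  set B : Polynomial ℂ :=
    ∑ d ∈ S, r d • ∏ d' ∈ S.erase d, (Polynomial.X - Polynomial.C d') with hB
  have hSc : 0 < S.card := Finset.card_pos.2 (hs.image τ)
  have hdA : A.degree = S.card := by
    rw [hA, Polynomial.degree_C_mul hc,
      Polynomial.degree_prod_of_monic _ _ fun d _ => Polynomial.monic_X_sub_C d]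
    simp
  have hdB : B ∈ Polynomial.degreeLT ℂ S.card := by
    refine Submodule.sum_mem _ fun d hd =>
      Submodule.smul_mem _ _ (Polynomial.mem_degreeLT.2 ?_)
    rw [Polynomial.degree_prod_of_monic _ _ fun d _ => Polynomial.monic_X_sub_C d]
    simp only [Polynomial.degree_X_sub_C, Finset.sum_const, Finset.card_erase_of_mem hd, nsmul_eq_mul, mul_one]
    exact_mod_cast Nat.sub_lt hSc one_pos
  have hdeg : (A + B).degree = S.card := by
    rw [Polynomial.degree_add_eq_left_of_degree_lt (hdA ▸ Polynomial.mem_degreeLT.1 hdB), hdA]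
  obtain ⟨t, ht⟩ := IsAlgClosed.exists_root (A + B) (by rw [hdeg]; exact_mod_cast hSc.ne')
  have ht' : c * ∏ d ∈ S, (t - d) + ∑ d ∈ S, r d * ∏ d' ∈ S.erase d, (t - d') = 0 := by
    have := ht.eq_zero
    simpa [hA, hB, Polynomial.eval_finsetSum, Polynomial.eval_prod] using this
  refine ⟨t, ?_⟩
  by_cases htS : t ∈ S
  · left
    refine ⟨Finset.mem_image.1 htS, ?_⟩
    rw [Finset.prod_eq_zero htS (sub_self t), mul_zero, zero_add,
      Finset.sum_eq_single_of_mem t htS fun d _ hdt => by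
        rw [Finset.prod_eq_zero (Finset.mem_erase.2 ⟨hdt.symm, htS⟩) (sub_self t), mul_zero]] at ht'
    refine (mul_eq_zero.1 ht').resolve_right (Finset.prod_ne_zero_iff.2 fun d hd => ?_)
    exact sub_ne_zero.2 (Finset.ne_of_mem_erase hd).symm
  · right
    have hne : ∀ m ∈ s, τ m ≠ t := fun m hm h => htS (Finset.mem_image.2 ⟨m, hm, h⟩)
    have hne' : ∀ d ∈ S, t - d ≠ 0 := fun d hd h => htS (sub_eq_zero.1 h ▸ hd)
    refine ⟨hne, ?_⟩
    have e : ∑ m ∈ s, ρ m / (t - τ m) = ∑ d ∈ S, r d / (t - d) := by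
      rw [← Finset.sum_fiberwise_of_maps_to (t := S) (g := τ)
        (fun m hm => Finset.mem_image_of_mem τ hm)]
      refine Finset.sum_congr rfl fun d _ => ?_
      rw [hr, Finset.sum_div]
      exact Finset.sum_congr rfl fun m hm => by rw [(Finset.mem_filter.1 hm).2]
    refine mul_right_cancel₀ (Finset.prod_ne_zero_iff.2 hne') ?_
    rw [e, zero_mul, ← ht', add_mul, Finset.sum_mul]
    congr 1
    refine Finset.sum_congr rfl fun d hd => ?_
    rw [← Finset.mul_prod_erase S _ hd]
    have := hne' d hd
    field_simp

end Residues

/-! ### Quadratic arcs and their limits on the resolution. -/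

section QuadraticArcs

/-- The power series `a + b t + c t²`. -/
def quad (a b c : ℂ) : PowerSeries ℂ :=
  PowerSeries.C a + PowerSeries.C b * PowerSeries.X + PowerSeries.C c * PowerSeries.X ^ 2

lemma evalZero_quad (a b c : ℂ) : evalZero (quad a b c) = a := by
  simp [quad, evalZero_apply]

lemma quad_zero (b c : ℂ) : quad 0 b c = PowerSeries.X * quad b c 0 := by
  simp [quad]
  ring

lemma quad_ne_zero_of_left {a : ℂ} (b c : ℂ) (ha : a ≠ 0) : quad a b c ≠ 0 := fun h => by
  have := congrArg evalZero h
  rw [evalZero_quad, map_zero] at this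
  exact ha this

lemma quad_ne_zero_of_middle (a : ℂ) {b : ℂ} (c : ℂ) (hb : b ≠ 0) : quad a b c ≠ 0 := by
  by_cases ha : a = 0
  · rw [ha, quad_zero]
    exact mul_ne_zero PowerSeries.X_ne_zero (quad_ne_zero_of_left _ _ hb)
  · exact quad_ne_zero_of_left _ _ ha

lemma quad_zero_zero_one_ne_zero : quad 0 0 1 ≠ 0 := by
  rw [quad_zero]
  exact mul_ne_zero PowerSeries.X_ne_zero (quad_ne_zero_of_middle _ _ one_ne_zero)

variable {N : ℕ} {P : Fin N → Matrix (Fin 3) (Fin 4) ℂ}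

lemma rowVal_quad (p q u : Fin 4 → ℂ) (m : Fin N) (r : Fin 3) :
    rowVal P m r (fun l => quad (p l) (q l) (u l))
      = quad (rowVal P m r p) (rowVal P m r q) (rowVal P m r u) := by
  have h : ∀ p : Fin 4 → ℂ, rowVal P m r (fun l => PowerSeries.C (p l))
      = PowerSeries.C (rowVal P m r p) := fun p => by
    simp [rowVal]
  unfold quad
  rw [rowVal_add, rowVal_add, h]
  have h1 : ∀ (p : Fin 4 → ℂ) (a : PowerSeries ℂ),
      rowVal P m r (fun l => PowerSeries.C (p l) * a) = PowerSeries.C (rowVal P m r p) * a :=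
    fun p a => by
      simp only [mul_comm _ a]
      rw [rowVal_smul, h]
  rw [h1, h1]

/-- The point of the resolution defined by a quadratic arc. -/
lemma exists_iPoint_of_quad {p q u : Fin 4 → ℂ} (hp : p ≠ 0)
    (h : ∀ m, quad (rowVal P m 2 p) (rowVal P m 2 q) (rowVal P m 2 u) ≠ 0) :
    ∃ V : Coord (dims₂ N) → PowerSeries ℂ, IPoint P V ∧
      (∀ m r, rowVal P m r (pB V) = quad (rowVal P m r p) (rowVal P m r q) (rowVal P m r u)) ∧
      (∀ a, (fun k => evalZero (V ⟨a, k⟩)) ≠ 0) ∧ pB (fun c => evalZero (V c)) = p := by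
  obtain ⟨V, hV, hVp, hne⟩ := exists_arc (P := P) (p := fun l => quad (p l) (q l) (u l))
    (fun m => by rw [rowVal_quad]; exact h m) (by simpa only [evalZero_quad] using hp)
  refine ⟨V, hV, fun m r => by rw [hVp, rowVal_quad], hne, funext fun l => ?_⟩
  exact (congrArg evalZero (congrFun hVp l)).trans (evalZero_quad _ _ _)

end QuadraticArcs

/-! ### Points of the fibre whose tangent image lies in a given hyperplane. -/

section LineFibre

variable {N : ℕ} {P : Fin N → Matrix (Fin 3) (Fin 4) ℂ}

/-- The part of a linear form on `ℂ^{2N+1}` that belongs to camera `m`, as a form on `ℂ⁴`. -/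
def lamRow (P : Fin N → Matrix (Fin 3) (Fin 4) ℂ) (L : (ImgIndex N → ℂ) →ₗ[ℂ] ℂ) (m : Fin N)
    (p : Fin 4 → ℂ) : ℂ :=
  ∑ b : Fin 2, L (Pi.single (some (m, b)) 1) * rowVal P m b.castSucc p

lemma lamRow_add_smul (L : (ImgIndex N → ℂ) →ₗ[ℂ] ℂ) (m : Fin N) (c : ℂ) (p q : Fin 4 → ℂ) :
    lamRow P L m (fun l => p l + c * q l) = lamRow P L m p + c * lamRow P L m q := by
  simp only [lamRow, rowVal_add, rowVal_smul, Finset.mul_sum, ← Finset.sum_add_distrib]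
  exact Finset.sum_congr rfl fun _ _ => by ring

lemma linearForm_eq_sum (L : (ImgIndex N → ℂ) →ₗ[ℂ] ℂ) (U : ImgIndex N → ℂ) :
    L U = L (Pi.single none 1) * U none +
      ∑ m, ∑ b, L (Pi.single (some (m, b)) 1) * U (some (m, b)) := by
  conv_lhs => rw [LinearMap.pi_apply_eq_sum_univ L U]
  rw [Fintype.sum_option, Fintype.sum_prod_type]
  have e : ∀ t : ImgIndex N, (fun j => if t = j then (1 : ℂ) else 0) = Pi.single t 1 := fun t => by
    funext j
    by_cases h : j = t
    · subst h; simp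
    · rw [Pi.single_eq_of_ne h, if_neg (Ne.symm h)]
  simp only [e, smul_eq_mul, mul_comm]

lemma linearForm_eq_of_rows {L : (ImgIndex N → ℂ) →ₗ[ℂ] ℂ} {i : Fin N}
    (hL : ∀ b, L (Pi.single (some (i, b)) 1) = 0) {U : ImgIndex N → ℂ} {p : Fin 4 → ℂ}
    {ν : Fin N → ℂ} (hU : ∀ m, m ≠ i → ∀ b : Fin 2, U (some (m, b)) = ν m * rowVal P m b.castSucc p) :
    L U = L (Pi.single none 1) * U none + ∑ m ∈ Finset.univ.erase i, ν m * lamRow P L m p := by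
  rw [linearForm_eq_sum, ← Finset.add_sum_erase Finset.univ _ (Finset.mem_univ i)]
  simp only [hL, zero_mul, Finset.sum_const_zero, zero_add]
  congr 1
  refine Finset.sum_congr rfl fun m hm => ?_
  rw [lamRow, Finset.mul_sum]
  exact Finset.sum_congr rfl fun b _ => by rw [hU m (Finset.ne_of_mem_erase hm)]; ring

/-- The center `q` of camera `i`, a point `r` of its plane with image `x`, and a point `u` off
the plane. -/
structure IsFibre (P : Fin N → Matrix (Fin 3) (Fin 4) ℂ) (i : Fin N) (x : Fin 2 → ℂ)
    (q r u : Fin 4 → ℂ) : Prop where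
  center : ∀ s, rowVal P i s q = 0
  other : ∀ m, m ≠ i → rowVal P m 2 q ≠ 0
  image : ∀ b : Fin 2, rowVal P i b.castSucc r = x b
  plane : rowVal P i 2 r = 0
  off : rowVal P i 2 u = 1
  image_off : ∀ b : Fin 2, rowVal P i b.castSucc u = 0

lemma exists_isFibre (hN : 3 ≤ N) (hP : GeneralPosition P) (i : Fin N) (x : Fin 2 → ℂ) :
    ∃ q r u, IsFibre P i x q r u := by
  obtain ⟨m, hm⟩ := exists_ne_of_three_le hN i
  have hρ := injective_camera_rows hm.symm 2
  obtain ⟨q, hq⟩ := hP.exists_rowVal_eq (R := ℂ) hρ ![0, 0, 0, 1]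
  obtain ⟨r, hr⟩ := hP.exists_rowVal_eq (R := ℂ) hρ ![x 0, x 1, 0, 0]
  obtain ⟨u, hu⟩ := hP.exists_rowVal_eq (R := ℂ) hρ ![0, 0, 1, 0]
  have hc : ∀ s, rowVal P i s q = 0 := fun s => match s with
    | 0 => hq 0
    | 1 => hq 1
    | 2 => hq 2
  refine ⟨q, r, u, hc, fun n hn h => ?_, fun b => ?_, hr 2, hu 2, fun b => ?_⟩
  · have h0 := hP.eq_zero_of_center hn.symm 2 hc h
    have h3 : rowVal P m 2 q = 1 := hq 3
    rw [h0, rowVal_zero] at h3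
    exact zero_ne_one h3
  · fin_cases b
    exacts [hr 0, hr 1]
  · fin_cases b
    exacts [hu 0, hu 1]

/-- The point `v` of the multicone lies over the point of the line of camera `i` with coordinates
`x`, and the linear form `L` annihilates the image of its tangent space. -/
def IsCritical (P : Fin N → Matrix (Fin 3) (Fin 4) ℂ) (i : Fin N) (x : Fin 2 → ℂ)
    (L : (ImgIndex N → ℂ) →ₗ[ℂ] ℂ) (v : Coord (dims₂ N) → ℂ) : Prop :=
  ∀ X, ImgRel P v X → (OnLine i X ∧ ∀ b b', X (some (i, b)) * x b' = X (some (i, b')) * x b) ∧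
    ∀ w U, TangentData P v w X U → L U = 0

variable {i : Fin N} {x : Fin 2 → ℂ} {q r u : Fin 4 → ℂ} {L : (ImgIndex N → ℂ) →ₗ[ℂ] ℂ}

lemma onLine_iff {X : ImgIndex N → ℂ} : OnLine i X ↔
    X none = 0 ∧ ∀ m, m ≠ i → ∀ b, X (some (m, b)) = 0 := by
  constructor
  · refine fun h => ⟨h _ fun b => by simp, fun m hm b => h _ fun b' e => hm ?_⟩
    simpa using congrArg (Option.map Prod.fst) e
  · rintro ⟨h1, h2⟩ t ht
    rcases t with - | ⟨m, b⟩
    · exact h1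
    · exact h2 m (by rintro rfl; exact ht b rfl) b

lemma OnLine.xx_eq_zero {X : ImgIndex N → ℂ} (h : OnLine i X) {m : Fin N} (hm : m ≠ i)
    (s : Fin 3) : xx X m s = 0 := by
  obtain ⟨h1, h2⟩ := onLine_iff.1 h
  fin_cases s
  exacts [h2 m hm 0, h2 m hm 1, h1]

/-- The point of the fibre over the camera center. -/
lemma IsFibre.exists_critical_center (h : IsFibre P i x q r u) (hN : 3 ≤ N) (hx : x ≠ 0)
    (hL : ∀ b, L (Pi.single (some (i, b)) 1) = 0)
    (h0 : L (Pi.single none 1) +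
      ∑ m ∈ Finset.univ.erase i, lamRow P L m q / rowVal P m 2 q = 0) :
    ∃ v, IPoint P v ∧ (∀ a, (fun k => v ⟨a, k⟩) ≠ 0) ∧ IsCritical P i x L v := by
  obtain ⟨m0, hm0⟩ := exists_ne_of_three_le hN i
  have hq0 : q ≠ 0 := by
    rintro rfl
    exact h.other m0 hm0 (rowVal_zero _ _)
  -- Along `q + t r + t² u` the rows of camera `i` are `t x` and `h_i = t²`, so the limit in the
  -- exceptional plane is `(x : 0)`. The quadratic term keeps `h_i` from vanishing identically.
  obtain ⟨V, hV, hVp, hne, hvp⟩ := exists_iPoint_of_quad (P := P) (p := q) (q := r) (u := u) hq0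
    fun m => by
      by_cases hm : m = i
      · subst hm
        rw [h.center, h.plane, h.off]
        exact quad_zero_zero_one_ne_zero
      · exact quad_ne_zero_of_left _ _ (h.other m hm)
  set v : Coord (dims₂ N) → ℂ := fun c => evalZero (V c) with hv
  obtain ⟨b0, hb0⟩ := Function.ne_iff.1 hx
  have hrow : ∀ (b : Fin 2), rowVal P i b.castSucc (pB V) = PowerSeries.X * quad (x b) 0 0 :=
    fun b => by rw [hVp, h.center, h.image, h.image_off, quad_zero]
  have hrow2 : rowVal P i 2 (pB V) = PowerSeries.X * quad 0 1 0 := by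
    rw [hVp, h.center, h.plane, h.off, quad_zero]
  have ha1 : ∀ b b' : Fin 2, aB v i b.castSucc * x b' = aB v i b'.castSucc * x b := fun b b' => by
    have := hV.a_row i b.castSucc b'.castSucc
    rw [hrow, hrow] at this
    have := congrArg evalZero (mul_left_cancel₀ PowerSeries.X_ne_zero
      (show PowerSeries.X * (aB V i b.castSucc * quad (x b') 0 0) =
        PowerSeries.X * (aB V i b'.castSucc * quad (x b) 0 0) by linear_combination this))
    rw [map_mul, map_mul, evalZero_quad, evalZero_quad] at this
    exact this
  have ha2 : aB v i 2 = 0 := by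
    have := hV.a_row i 2 b0.castSucc
    rw [hrow, hrow2] at this
    have := congrArg evalZero (mul_left_cancel₀ PowerSeries.X_ne_zero
      (show PowerSeries.X * (aB V i 2 * quad (x b0) 0 0) =
        PowerSeries.X * (aB V i b0.castSucc * quad 0 1 0) by linear_combination this))
    rw [map_mul, map_mul, evalZero_quad, evalZero_quad, mul_zero] at this
    exact (mul_eq_zero.1 this).resolve_right hb0
  have ha0 : ∃ b : Fin 2, aB v i b.castSucc ≠ 0 := by
    by_contra! hcon
    refine hne (Sum.inl (Sum.inr (Sum.inl i))) ?_
    have aux : ∀ s : Fin 3, aB v i s = 0 := fun s => match s with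
      | 0 => hcon 0
      | 1 => hcon 1
      | 2 => ha2
    exact funext aux
  obtain ⟨b1, hb1⟩ := ha0
  refine ⟨v, hV.map evalZero, hne, fun X hX => ?_⟩
  have hnone : X none = 0 := by
    have := hX.xx_a i 2 b1.castSucc
    rw [ha2, mul_zero, xx_two] at this
    exact (mul_eq_zero.1 this).resolve_right hb1
  have hline : OnLine i X := onLine_iff.2 ⟨hnone, fun m hm b => by
    have := hX.xx_row m b.castSucc 2
    rw [xx_castSucc, xx_two, hnone, zero_mul, hvp] at this
    exact (mul_eq_zero.1 this).resolve_right (h.other m hm)⟩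
  refine ⟨⟨hline, fun b b' => ?_⟩, fun w U hT => ?_⟩
  · refine cross_trans (A := fun b => X (some (i, b))) (B := x)
      (Z := fun b : Fin 2 => aB v i b.castSucc) ⟨b1, hb1⟩ (fun s s' => ?_) (fun s s' => ?_) b b'
    · have := hX.xx_a i s.castSucc s'.castSucc
      rw [xx_castSucc, xx_castSucc] at this
      exact this
    · linear_combination -(ha1 s s')
  · have hU : ∀ m, m ≠ i → ∀ b : Fin 2, U (some (m, b)) =
        (U none / rowVal P m 2 q) * rowVal P m b.castSucc q := fun m hm b => by
      have := hT.xx_row m b.castSucc 2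
      rw [hline.xx_eq_zero hm, hline.xx_eq_zero hm, xx_castSucc, xx_two, hvp] at this
      have hm' := h.other m hm
      field_simp
      linear_combination this
    rw [linearForm_eq_of_rows hL hU]
    have : ∑ m ∈ Finset.univ.erase i, U none / rowVal P m 2 q * lamRow P L m q
        = U none * ∑ m ∈ Finset.univ.erase i, lamRow P L m q / rowVal P m 2 q := by
      rw [Finset.mul_sum]
      exact Finset.sum_congr rfl fun m _ => by ring
    rw [this]
    linear_combination U none * h0

/-- The point of the fibre over a point of the line through the camera center. -/
lemma IsFibre.exists_critical_of_point (h : IsFibre P i x q r u) (hP : GeneralPosition P)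
    (hx : x ≠ 0) (hL : ∀ b, L (Pi.single (some (i, b)) 1) = 0) {p : Fin 4 → ℂ} {τ : ℂ}
    (hp : p = fun l => r l + τ * q l)
    (h0 : (∃ m, m ≠ i ∧ rowVal P m 2 p = 0) ∧
        ∑ m ∈ Finset.univ.erase i with rowVal P m 2 p = 0, lamRow P L m p / rowVal P m 2 q = 0 ∨
      (∀ m, m ≠ i → rowVal P m 2 p ≠ 0) ∧ L (Pi.single none 1) +
        ∑ m ∈ Finset.univ.erase i, lamRow P L m p / rowVal P m 2 p = 0) :
    ∃ v, IPoint P v ∧ (∀ a, (fun k => v ⟨a, k⟩) ≠ 0) ∧ IsCritical P i x L v := by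
  obtain ⟨b0, hb0⟩ := Function.ne_iff.1 hx
  have hpi : ∀ b : Fin 2, rowVal P i b.castSucc p = x b := fun b => by
    rw [hp, rowVal_add, rowVal_smul, h.image, h.center, mul_zero, add_zero]
  have hpi2 : rowVal P i 2 p = 0 := by
    rw [hp, rowVal_add, rowVal_smul, h.plane, h.center, mul_zero, add_zero]
  have hb0' : rowVal P i b0.castSucc p ≠ 0 := by rw [hpi]; exact hb0
  have hp0 : p ≠ 0 := by
    rintro h'
    rw [h', rowVal_zero] at hb0'
    exact hb0' rfl
  have hnc : ∀ m, m ≠ i → ∃ s, rowVal P m s p ≠ 0 := fun m hm => by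
    by_contra! hcon
    exact hp0 (hP.eq_zero_of_center hm 2 hcon hpi2)
  -- The arc leaves `p` in the direction of the center. Since `h_i = t²` while every other `h_m`
  -- vanishes to order at most one, `h_i / h_m` tends to 0.
  obtain ⟨V, hV, hVp, hne, hvp⟩ := exists_iPoint_of_quad (P := P) (p := p) (q := q) (u := u) hp0
    fun m => by
      by_cases hm : m = i
      · subst hm
        rw [hpi2, h.center, h.off]
        exact quad_zero_zero_one_ne_zero
      · exact quad_ne_zero_of_middle _ _ (h.other m hm)
  set v : Coord (dims₂ N) → ℂ := fun c => evalZero (V c) with hv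
  have hI : IPoint P v := hV.map evalZero
  have hcc : ∀ m n, evalZero (cc V m n) = cc v m n := fun m n => map_cc ..
  have hcci : ∀ m, m ≠ i → cc v i m = 0 := fun m hm => by
    by_cases hm2 : rowVal P m 2 p = 0
    · have := hV.cc_row i m
      rw [hVp, hVp, hpi2, h.center, h.off, hm2, quad_zero, quad_zero] at this
      have := congrArg evalZero (mul_left_cancel₀ PowerSeries.X_ne_zero
        (show PowerSeries.X * (cc V i m * quad (rowVal P m 2 q) (rowVal P m 2 u) 0) =
          PowerSeries.X * (cc V m i * quad 0 1 0) by linear_combination this))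
      rw [map_mul, map_mul, evalZero_quad, evalZero_quad, mul_zero, hcc] at this
      exact (mul_eq_zero.1 this).resolve_right (h.other m hm)
    · have := hI.cc_row i m
      rw [hvp, hpi2, mul_zero] at this
      exact (mul_eq_zero.1 this).resolve_right hm2
  -- For planes through `p` the limit of `h_m : h_n` is that of the direction `q`.
  have hccm : ∀ m n, rowVal P m 2 p = 0 → rowVal P n 2 p = 0 →
      cc v m n * rowVal P n 2 q = cc v n m * rowVal P m 2 q := fun m n hm hn => by
    have := hV.cc_row m n
    rw [hVp, hVp, hm, hn, quad_zero, quad_zero] at this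
    have := congrArg evalZero (mul_left_cancel₀ PowerSeries.X_ne_zero
      (show PowerSeries.X * (cc V m n * quad (rowVal P n 2 q) (rowVal P n 2 u) 0) =
        PowerSeries.X * (cc V n m * quad (rowVal P m 2 q) (rowVal P m 2 u) 0) by
        linear_combination this))
    rw [map_mul, map_mul, evalZero_quad, evalZero_quad, hcc, hcc] at this
    exact this
  refine ⟨v, hI, hne, fun X hX => ?_⟩
  have hnone : X none = 0 := by
    have := hX.xx_row i 2 b0.castSucc
    rw [hvp, hpi2, mul_zero, xx_two] at this
    exact (mul_eq_zero.1 this).resolve_right hb0'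
  have hline : OnLine i X := onLine_iff.2 ⟨hnone, fun m hm b => by
    have := hX.xx_cc i m b0.castSucc b.castSucc
    rw [hcci m hm, mul_zero, hvp, xx_castSucc X m] at this
    have hmi : cc v m i ≠ 0 := fun h' => (cc_ne_zero_or (v := v) hne m i).elim (fun h'' => h'' h')
      fun h'' => h'' (hcci m hm)
    exact (mul_eq_zero.1 ((mul_eq_zero.1 this.symm).resolve_right hmi)).resolve_right hb0'⟩
  refine ⟨⟨hline, fun b b' => ?_⟩, fun w U hT => ?_⟩
  · have := hX.xx_row i b.castSucc b'.castSucc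
    rw [xx_castSucc, xx_castSucc, hvp, hpi, hpi] at this
    exact this
  have hUrow : ∀ m, m ≠ i → ∃ ν, ∀ s, xx U m s = ν * rowVal P m s p := fun m hm =>
    exists_eq_mul_of_cross (hnc m hm) fun s s' => by
      have := hT.xx_row m s s'
      rw [hline.xx_eq_zero hm, hline.xx_eq_zero hm, hvp] at this
      linear_combination this
  choose! ν hν using hUrow
  have hU : ∀ m, m ≠ i → ∀ b : Fin 2, U (some (m, b)) = ν m * rowVal P m b.castSucc p :=
    fun m hm b => by rw [← hν m hm, xx_castSucc]
  have hUn : ∀ m, m ≠ i → U none = ν m * rowVal P m 2 p := fun m hm => hν m hm 2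
  rw [linearForm_eq_of_rows hL hU]
  rcases h0 with ⟨⟨m1, hm1, hm1p⟩, h0⟩ | ⟨hne2, h0⟩
  · have hUn0 : U none = 0 := by rw [hUn m1 hm1, hm1p, mul_zero]
    -- The product `ν m * h_m(q)` is the same for all planes through `p`, so the value of `L` is
    -- this common factor times the total residue.
    have hK : ∀ m, m ≠ i → rowVal P m 2 p = 0 →
        ν m * rowVal P m 2 q = ν m1 * rowVal P m1 2 q := fun m hm hmp => by
      obtain ⟨s, hs⟩ := hnc m hm
      obtain ⟨s1, hs1⟩ := hnc m1 hm1
      have e1 := hT.xx_cc m m1 s s1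
      rw [hline.xx_eq_zero hm, hline.xx_eq_zero hm1, hν m hm, hν m1 hm1, hvp] at e1
      have e2 : ν m * cc v m m1 = ν m1 * cc v m1 m := by
        refine mul_left_cancel₀ (mul_ne_zero hs hs1) ?_
        linear_combination e1
      have e3 := hccm m m1 hmp hm1p
      rcases cc_ne_zero_or (v := v) hne m m1 with hcm | hcm
      · refine mul_left_cancel₀ hcm ?_
        linear_combination rowVal P m 2 q * e2 - ν m1 * e3
      · refine mul_left_cancel₀ hcm ?_
        linear_combination rowVal P m1 2 q * e2 - ν m * e3
    rw [hUn0, mul_zero, zero_add, ← Finset.sum_filter_add_sum_filter_not _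
      (fun m => rowVal P m 2 p = 0)]
    have e1 : ∑ m ∈ Finset.univ.erase i with ¬ rowVal P m 2 p = 0, ν m * lamRow P L m p = 0 :=
      Finset.sum_eq_zero fun m hm => by
        obtain ⟨hmi, hmp⟩ := Finset.mem_filter.1 hm
        have := hUn m (Finset.ne_of_mem_erase hmi)
        rw [hUn0] at this
        rw [(mul_eq_zero.1 this.symm).resolve_right hmp, zero_mul]
    have e2 : ∑ m ∈ Finset.univ.erase i with rowVal P m 2 p = 0, ν m * lamRow P L m p
        = (ν m1 * rowVal P m1 2 q) * ∑ m ∈ Finset.univ.erase i with rowVal P m 2 p = 0,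
          lamRow P L m p / rowVal P m 2 q := by
      rw [Finset.mul_sum]
      refine Finset.sum_congr rfl fun m hm => ?_
      obtain ⟨hmi, hmp⟩ := Finset.mem_filter.1 hm
      have hmi' := Finset.ne_of_mem_erase hmi
      have hq := h.other m hmi'
      have := hK m hmi' hmp
      field_simp
      linear_combination lamRow P L m p * this
    rw [e1, e2, h0, mul_zero, add_zero]
  · have : ∑ m ∈ Finset.univ.erase i, ν m * lamRow P L m p
        = U none * ∑ m ∈ Finset.univ.erase i, lamRow P L m p / rowVal P m 2 p := by
      rw [Finset.mul_sum]
      refine Finset.sum_congr rfl fun m hm => ?_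
      have hmi := Finset.ne_of_mem_erase hm
      have h1 := hne2 m hmi
      have h2 := hUn m hmi
      field_simp
      linear_combination -lamRow P L m p * h2
    rw [this]
    linear_combination U none * h0

/-- Every linear form that vanishes on the line of camera `i` annihilates the tangent space at a
suitable point of the fibre over a given point of the line. -/
lemma exists_isCritical (hN : 3 ≤ N) (hP : GeneralPosition P) (hx : x ≠ 0)
    (hL : ∀ b, L (Pi.single (some (i, b)) 1) = 0) :
    ∃ v, IPoint P v ∧ (∀ a, (fun k => v ⟨a, k⟩) ≠ 0) ∧ IsCritical P i x L v := by
  obtain ⟨q, r, u, h⟩ := exists_isFibre hN hP i x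
  -- The value at `t = ∞`, which belongs to the point over the center. If it is nonzero it is the
  -- constant term of the rational function below.
  by_cases hc : L (Pi.single none 1) +
      ∑ m ∈ Finset.univ.erase i, lamRow P L m q / rowVal P m 2 q = 0
  · exact h.exists_critical_center hN hx hL hc
  -- The parameter at which the line `r + t q` meets the plane of camera `m`. There `λ_m / h_m` has
  -- residue `λ_m(r + τ_m q) / h_m(q)`.
  set τ : Fin N → ℂ := fun m => -rowVal P m 2 r / rowVal P m 2 q with hτ
  obtain ⟨m0, hm0⟩ := exists_ne_of_three_le hN i
  obtain ⟨t, ht⟩ := exists_zero_or_residue (Finset.univ.erase i)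
    ⟨m0, Finset.mem_erase.2 ⟨hm0, Finset.mem_univ _⟩⟩ hc
    (fun m => (lamRow P L m r + τ m * lamRow P L m q) / rowVal P m 2 q) τ
  have hrow : ∀ m, m ≠ i → rowVal P m 2 (fun l => r l + t * q l)
      = rowVal P m 2 q * (t - τ m) := fun m hm => by
    have := h.other m hm
    rw [rowVal_add, rowVal_smul, hτ]
    field_simp
    ring
  have hrow0 : ∀ m, m ≠ i → (rowVal P m 2 (fun l => r l + t * q l) = 0 ↔ τ m = t) := fun m hm => by
    rw [hrow m hm, mul_eq_zero, or_iff_right (h.other m hm), sub_eq_zero, eq_comm]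
  refine h.exists_critical_of_point (τ := t) hP hx hL rfl ?_
  rcases ht with ⟨⟨m, hm, hmt⟩, hs⟩ | ⟨hne, hs⟩
  · left
    have hmi := Finset.ne_of_mem_erase hm
    refine ⟨⟨m, hmi, (hrow0 m hmi).2 hmt⟩, ?_⟩
    rw [Finset.filter_congr fun n hn => hrow0 n (Finset.ne_of_mem_erase hn), ← hs]
    refine Finset.sum_congr rfl fun n hn => ?_
    rw [lamRow_add_smul, (Finset.mem_filter.1 hn).2]
  · right
    refine ⟨fun m hm h' => hne m (Finset.mem_erase.2 ⟨hm, Finset.mem_univ m⟩) ((hrow0 m hm).1 h'), ?_⟩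
    rw [← hs, add_assoc, ← Finset.sum_add_distrib]
    congr 1
    refine Finset.sum_congr rfl fun m hm => ?_
    have hmi := Finset.ne_of_mem_erase hm
    have h1 := h.other m hmi
    have h2 : t - τ m ≠ 0 := sub_ne_zero.2 (hne m hm).symm
    rw [hrow m hmi, lamRow_add_smul]
    field_simp
    ring

end LineFibre

/-! ### Directions in the image of the differential over a line. -/

section LineVectors

variable {N : ℕ} {P : Fin N → Matrix (Fin 3) (Fin 4) ℂ} {i j k : Fin N}

/-- The vector on the line of camera `i` with given coordinates. -/
def lineVec (i : Fin N) (a : Fin 2 → ℂ) : ImgIndex N → ℂ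
  | none => 0
  | some (m, b) => if m = i then a b else 0

/-- A tangent direction transversal to the line of camera `i`, at a common point `p` of the planes
of the cameras `i`, `j`, `k`; the center of camera `i` is `q`. -/
def nodeVec (P : Fin N → Matrix (Fin 3) (Fin 4) ℂ) (q : Fin 4 → ℂ) (j k : Fin N) (p : Fin 4 → ℂ) :
    ImgIndex N → ℂ
  | none => 0
  | some (m, b) => if m = j then rowVal P k 2 q * rowVal P j b.castSucc p
      else if m = k then rowVal P j 2 q * rowVal P k b.castSucc p else 0

lemma nodeVec_smul (q : Fin 4 → ℂ) (j k : Fin N) (c : ℂ) (p : Fin 4 → ℂ) :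
    nodeVec P q j k (fun l => c * p l) = c • nodeVec P q j k p := by
  funext t
  rcases t with - | ⟨m, b⟩
  · exact (mul_zero c).symm
  · simp only [nodeVec, rowVal_smul, Pi.smul_apply, smul_eq_mul]
    split_ifs <;> ring

lemma OnLine.exists_ne_zero {X : ImgIndex N → ℂ} (hX : OnLine i X) (hX0 : X ≠ 0) :
    ∃ b, X (some (i, b)) ≠ 0 := by
  by_contra! h
  refine hX0 (funext fun t => ?_)
  by_cases ht : ∀ b, t ≠ some (i, b)
  · exact hX t ht
  · push Not at ht
    obtain ⟨b, rfl⟩ := ht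
    exact h b

lemma OnLine.eq_add {X U : ImgIndex N → ℂ} (hX : OnLine i X) (hU : OnLine i U) {κ c : ℂ}
    {a : Fin 2 → ℂ} (h : ∀ b, U (some (i, b)) = κ * a b + c * X (some (i, b))) :
    U = κ • lineVec i a + c • X := by
  obtain ⟨h1, h2⟩ := onLine_iff.1 hX
  obtain ⟨h3, h4⟩ := onLine_iff.1 hU
  funext t
  rcases t with - | ⟨m, b⟩
  · simp [lineVec, h1, h3]
  · by_cases hm : m = i
    · subst hm
      simp [lineVec, h b]
    · simp [lineVec, hm, h2 m hm b, h4 m hm b]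

variable {v w : Coord (dims₂ N) → ℂ} {X U : ImgIndex N → ℂ} {L : (ImgIndex N → ℂ) →ₗ[ℂ] ℂ}
  {r₀ : Fin 3} {a : Fin 2 → ℂ}

/-- Over the center of camera `i`, some tangent vector is sent to the given direction of the
line, modulo the image point. -/
lemma IsOverCenter.image_eq_lineVec (h : IsOverCenter P v i r₀) (hX0 : X ≠ 0) (hXl : OnLine i X)
    (hX : ImgRel P v X) (hT : TangentData P v w X U) {c : ℂ}
    (hM : centerMap P i r₀ w = ![a 0, a 1, 0, 0] + c • centerVec v i) :
    ∃ κ d : ℂ, κ ≠ 0 ∧ U = κ • lineVec i a + d • X := by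
  obtain ⟨κ, hκ, -⟩ := h.exists_eq (hX.centerRel i)
  obtain ⟨b0, hb0⟩ := hXl.exists_ne_zero hX0
  have hXb : ∀ b : Fin 2, X (some (i, b)) = κ * aB v i b.castSucc := fun b => by
    rw [← hκ, xx_castSucc]
  have hκ0 : κ ≠ 0 := by
    rintro rfl
    exact hb0 ((hXb b0).trans (zero_mul _))
  obtain ⟨hnone, hXm⟩ := onLine_iff.1 hXl
  have ha2 : aB v i 2 = 0 := by
    have := hκ 2
    rw [xx_two, hnone] at this
    exact (mul_eq_zero.1 this.symm).resolve_left hκ0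
  obtain ⟨hw, -⟩ := centerMap_eq_iff.1 hM
  have hw2 : aB w i 2 = 0 := (hw 2).trans (by
    change 0 + c * aB v i 2 = 0
    rw [ha2]; ring)
  have hwb : ∀ b : Fin 2, aB w i b.castSucc = a b + c * aB v i b.castSucc := fun b =>
    (hw _).trans (by fin_cases b <;> rfl)
  have hUn : U none = 0 := by
    have := hT.xx_a i r₀ 2
    rw [hw2, ha2, xx_two, hnone, xx_two] at this
    refine (mul_eq_zero.1 (?_ : U none * aB v i r₀ = 0)).resolve_right h.ne_zero
    linear_combination -this
  have hUl : OnLine i U := onLine_iff.2 ⟨hUn, fun m hm b => by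
    have := hT.xx_row m b.castSucc 2
    rw [hXl.xx_eq_zero hm, hXl.xx_eq_zero hm, xx_castSucc, xx_two, hUn] at this
    refine (mul_eq_zero.1 (?_ : U (some (m, b)) * rowVal P m 2 (pB v) = 0)).resolve_right
      (h.other m hm)
    linear_combination this⟩
  obtain ⟨d, hd⟩ := exists_eq_mul_of_cross (A := fun b => U (some (i, b)) - κ * a b)
    (Z := fun b : Fin 2 => aB v i b.castSucc) ⟨b0, fun h0 => hb0 (by
      rw [hXb]
      exact (congrArg (κ * ·) h0).trans (mul_zero κ))⟩ fun b b' => by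
    have := hT.xx_a i b.castSucc b'.castSucc
    rw [hκ, hκ, hwb, hwb, xx_castSucc, xx_castSucc] at this
    linear_combination this
  refine ⟨κ, d / κ, hκ0, hXl.eq_add hUl fun b => ?_⟩
  have := hd b
  rw [hXb]
  field_simp
  linear_combination this

/-- A flag over a point of the line of camera `i` begins with `i`. -/
lemma IsFlag.first_eq {i' : Fin N} (h : IsFlag P v i' j k) (hX0 : X ≠ 0) (hXl : OnLine i X)
    (hX : ImgRel P v X) : i' = i := by
  obtain ⟨κ, hκ⟩ := h.exists_isCoef (hX.flagRel i' j k)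
  by_contra hi
  obtain ⟨r, hr⟩ := h.center i'
  have := hκ.xx_eq i' r
  rw [hXl.xx_eq_zero hi] at this
  exact mul_ne_zero (h.coef_ne_zero hX0 hκ) hr this.symm

/-- The data of a flag over a point of the line of camera `i`. -/
lemma IsFlag.exists_coef_of_onLine (h : IsFlag P v i j k) (hX0 : X ≠ 0) (hXl : OnLine i X)
    (hX : ImgRel P v X) : ∃ κ : ℂ, κ ≠ 0 ∧ (∀ r, xx X i r = κ * rowVal P i r (pB v)) ∧
      cc v i j = 0 ∧ rowVal P i 2 (pB v) = 0 := by
  obtain ⟨κ, hκ⟩ := h.exists_isCoef (hX.flagRel i j k)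
  have hi := h.coef_ne_zero hX0 hκ
  have hj : κ j = 0 := by
    obtain ⟨r, hr⟩ := h.center j
    have := hκ.xx_eq j r
    rw [hXl.xx_eq_zero h.ij.symm] at this
    exact (mul_eq_zero.1 this.symm).resolve_right hr
  refine ⟨κ i, hi, hκ.xx_eq i, ?_, ?_⟩
  · have := hκ.ij
    rw [hj, zero_mul] at this
    exact (mul_eq_zero.1 this).resolve_left hi
  · have := hκ.none i
    rw [(onLine_iff.1 hXl).1] at this
    exact (mul_eq_zero.1 this.symm).resolve_left hi

/-- The image of a tangent vector along the proper transform of the plane of camera `i`. -/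
lemma IsFlag.image_eq_lineVec (h : IsFlag P v i j k) (hX0 : X ≠ 0) (hXl : OnLine i X)
    (hX : ImgRel P v X) (hT : TangentData P v w X U) (hw : ccLin w i j = 0) :
    ∃ κ d : ℂ, κ ≠ 0 ∧ U = κ • lineVec i (fun b => rowVal P i b.castSucc (pB w)) + d • X := by
  obtain ⟨κ, hκ0, hκ, hij, hi2⟩ := h.exists_coef_of_onLine hX0 hXl hX
  obtain ⟨hnone, hXm⟩ := onLine_iff.1 hXl
  obtain ⟨r, hr⟩ := h.center i
  have hUj : ∀ s, xx U j s = 0 := fun s => by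
    have := hT.xx_cc i j r s
    rw [hw, hij, hXl.xx_eq_zero h.ij.symm] at this
    refine (mul_eq_zero.1 (?_ : xx U j s * (rowVal P i r (pB v) * cc v j i) = 0)).resolve_right
      (mul_ne_zero hr h.ji)
    linear_combination -this
  have hUk : ∀ s, xx U k s = 0 := fun s => by
    obtain ⟨r', hr'⟩ := h.center j
    have := hT.xx_cc j k r' s
    rw [hXl.xx_eq_zero h.ij.symm, hXl.xx_eq_zero h.ik.symm, hUj] at this
    refine (mul_eq_zero.1 (?_ : xx U k s * (rowVal P j r' (pB v) * cc v k j) = 0)).resolve_right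
      (mul_ne_zero hr' h.kj)
    linear_combination -this
  have hUn : U none = 0 := hUj 2
  have hUl : OnLine i U := onLine_iff.2 ⟨hUn, fun m hm b => by
    by_cases hm2 : rowVal P m 2 (pB v) = 0
    · rcases h.mem m hm2 with rfl | rfl | rfl
      · exact (hm rfl).elim
      · rw [← xx_castSucc U, hUj]
      · rw [← xx_castSucc U, hUk]
    · have := hT.xx_row m b.castSucc 2
      rw [hXl.xx_eq_zero hm, hXl.xx_eq_zero hm, xx_castSucc, xx_two, hUn] at this
      refine (mul_eq_zero.1 (?_ : U (some (m, b)) * rowVal P m 2 (pB v) = 0)).resolve_right hm2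
      linear_combination this⟩
  obtain ⟨d, hd⟩ := exists_eq_mul_of_cross
    (A := fun s => xx U i s - κ * rowVal P i s (pB w)) (Z := fun s => rowVal P i s (pB v))
    ⟨r, hr⟩ fun s s' => by
      have := hT.xx_row i s s'
      rw [hκ, hκ] at this
      linear_combination this
  refine ⟨κ, d / κ, hκ0, hXl.eq_add hUl fun b => ?_⟩
  have := hd b.castSucc
  rw [xx_castSucc] at this
  rw [← xx_castSucc X, hκ]
  field_simp
  linear_combination this

lemma cc_row_of_mem_coneTangent (hN : 3 ≤ N) (hP : GeneralPosition P) {y : resolution P}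
    (hl : IsLift v y.1) (hw : w ∈ coneTangent (resolution P) v) (m n : Fin N) :
    cc v m n * rowVal P n 2 (pB w) + ccLin w m n * rowVal P n 2 (pB v)
      = cc v n m * rowVal P m 2 (pB w) + ccLin w n m * rowVal P m 2 (pB v) := by
  have hI := (mem_coneTangent_resolution_iff hN hP y.2 hl).1 hw
  have := congrArg TrivSqZeroExt.snd (hI.cc_row m n)
  simp only [pB_dualVec, rowVal_dualVec, cc_dualVec] at this
  simpa [mul_comm] using this

/-- Tangent vectors along the proper transform of the plane of camera `i`. -/
lemma IsFlag.exists_plane_tangent (h : IsFlag P v i j k) (hN : 3 ≤ N) (hP : GeneralPosition P)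
    {y : resolution P} (hl : IsLift v y.1) (hij : cc v i j = 0) {r : Fin 4 → ℂ}
    (hr : rowVal P i 2 r = 0)
    (hs : rowVal P k 2 (pB v) ≠ 0 ∨ cc v j k * rowVal P k 2 r = cc v k j * rowVal P j 2 r) :
    ∃ w ∈ coneTangent (resolution P) v, ccLin w i j = 0 ∧ pB w = r := by
  have hI := (mem_resolution_iff hN hP hl).1 y.2
  -- The derivative of `h_j / h_k`, times a square, that is forced by the prescribed `pB w = r`. It
  -- exists if `h_k ≠ 0`; otherwise `r` must respect the ratio `h_j : h_k` of the point.
  have hz : ∃ z1, rowVal P k 2 (pB v) * z1 =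
      cc v k j * (cc v k j * rowVal P j 2 r - cc v j k * rowVal P k 2 r) := by
    rcases hs with hs | hs
    · exact ⟨_, mul_div_cancel₀ _ hs⟩
    · exact ⟨0, by rw [hs]; ring⟩
  obtain ⟨z1, hz⟩ := hz
  obtain ⟨w, hw, hM⟩ := h.exists_tangent hN hP hl ![0, z1, rowVal P k 2 r, rowVal P i 0 r]
  have h0 : ccLin w i j * cc v j i - cc v i j * ccLin w j i = 0 := congrFun hM 0
  have h1 : ccLin w j k * cc v k j - cc v j k * ccLin w k j = z1 := congrFun hM 1
  have h2 : rowVal P k 2 (pB w) = rowVal P k 2 r := congrFun hM 2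
  have h3 : rowVal P i 0 (pB w) = rowVal P i 0 r := congrFun hM 3
  have hw0 : ccLin w i j = 0 := by
    rw [hij, zero_mul, sub_zero] at h0
    exact (mul_eq_zero.1 h0).resolve_right h.ji
  have hT1 := cc_row_of_mem_coneTangent hN hP hl hw
  have hi0 : rowVal P i 2 (pB v) = 0 := by
    have := hI.cc_row i j
    rw [hij, zero_mul] at this
    exact (mul_eq_zero.1 this.symm).resolve_left h.ji
  have h4 : rowVal P i 2 (pB w) = rowVal P i 2 r := by
    have := hT1 i j
    rw [hij, hw0, hi0] at this
    rw [hr]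
    refine (mul_eq_zero.1 (?_ : cc v j i * rowVal P i 2 (pB w) = 0)).resolve_left h.ji
    linear_combination -this
  have h5 : rowVal P j 2 (pB w) = rowVal P j 2 r := by
    refine mul_left_cancel₀ (mul_ne_zero h.kj h.kj) ?_
    linear_combination -cc v k j * hT1 j k + rowVal P k 2 (pB v) * h1 + hz +
      cc v k j * cc v j k * h2 + ccLin w k j * hI.cc_row j k
  refine ⟨w, hw, hw0, hP.ext_rowVal (injective_flag_rows h.ij h.ik h.jk) fun b => ?_⟩
  fin_cases b
  exacts [h3, h4, h5, h2]

/-- The image of a tangent vector transversal to the proper transform of the plane of camera `i`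
at a common point of three camera planes. -/
lemma IsFlag.image_eq_nodeVec (h : IsFlag P v i j k) (hX0 : X ≠ 0) (hXl : OnLine i X)
    (hX : ImgRel P v X) (hT : TangentData P v w X U) {q : Fin 4 → ℂ}
    (hqk : rowVal P k 2 q ≠ 0) (hq : cc v j k * rowVal P k 2 q = cc v k j * rowVal P j 2 q)
    (hj2 : rowVal P j 2 (pB v) = 0)
    (hw : ccLin w i j ≠ 0) (hpw : pB w = 0) :
    ∃ c d : ℂ, c ≠ 0 ∧ U = c • nodeVec P q j k (pB v) + d • X := by
  obtain ⟨κ, hκ0, hκ, hij, hi2⟩ := h.exists_coef_of_onLine hX0 hXl hX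
  obtain ⟨hnone, hXm⟩ := onLine_iff.1 hXl
  obtain ⟨r, hr⟩ := h.center i
  have hrow : ∀ m s, rowVal P m s (pB w) = 0 := fun m s => by rw [hpw, rowVal_zero]
  set ν := κ * ccLin w i j / cc v j i with hν
  have hji := h.ji
  have hkj := h.kj
  have hν0 : ν ≠ 0 := div_ne_zero (mul_ne_zero hκ0 hw) hji
  have hUj : ∀ s, xx U j s = ν * rowVal P j s (pB v) := fun s => by
    have := hT.xx_cc i j r s
    rw [hij, hXl.xx_eq_zero h.ij.symm, hκ] at this
    rw [hν]
    field_simp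
    refine mul_left_cancel₀ hr ?_
    linear_combination -this
  have hUk : ∀ s, xx U k s = ν * (rowVal P j 2 q / rowVal P k 2 q) * rowVal P k s (pB v) :=
    fun s => by
      obtain ⟨r', hr'⟩ := h.center j
      have := hT.xx_cc j k r' s
      rw [hXl.xx_eq_zero h.ij.symm, hXl.xx_eq_zero h.ik.symm, hUj] at this
      field_simp
      refine mul_left_cancel₀ (mul_ne_zero hr' hkj) ?_
      linear_combination -rowVal P k 2 q * this + ν * rowVal P j r' (pB v) *
        rowVal P k s (pB v) * hq
  have hUn : U none = 0 := (hUj 2).trans (by rw [hj2, mul_zero])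
  obtain ⟨d, hd⟩ := exists_eq_mul_of_cross
    (A := fun s => xx U i s) (Z := fun s => rowVal P i s (pB v))
    ⟨r, hr⟩ fun s s' => by
      have := hT.xx_row i s s'
      rw [hrow, hrow] at this
      linear_combination this
  refine ⟨ν / rowVal P k 2 q, d / κ, div_ne_zero hν0 hqk, funext fun t => ?_⟩
  rcases t with - | ⟨m, b⟩
  · simp [nodeVec, hnone, hUn]
  · rw [Pi.add_apply, Pi.smul_apply, Pi.smul_apply, smul_eq_mul, smul_eq_mul]
    simp only [nodeVec]
    by_cases hmj : m = j
    · subst hmj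
      rw [if_pos rfl, hXm m h.ij.symm, ← xx_castSucc U, hUj]
      field_simp
      ring
    by_cases hmk : m = k
    · subst hmk
      rw [if_neg hmj, if_pos rfl, hXm m h.ik.symm, ← xx_castSucc U, hUk]
      field_simp
      ring
    rw [if_neg hmj, if_neg hmk]
    by_cases hmi : m = i
    · subst hmi
      rw [← xx_castSucc U, ← xx_castSucc X, hκ]
      rw [mul_zero, zero_add]
      have := hd b.castSucc
      field_simp
      linear_combination this
    · have hm2 : rowVal P m 2 (pB v) ≠ 0 := fun h0 => by
        rcases h.mem m h0 with h' | h' | h'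
        exacts [hmi h', hmj h', hmk h']
      have := hT.xx_row m b.castSucc 2
      rw [hXl.xx_eq_zero hmi, hXl.xx_eq_zero hmi, xx_castSucc, xx_two, hUn] at this
      rw [hXm m hmi, (mul_eq_zero.1 (by linear_combination this :
        U (some (m, b)) * rowVal P m 2 (pB v) = 0)).resolve_right hm2]
      ring

/-- Tangent vectors transversal to the proper transform of the plane of camera `i`. -/
lemma IsFlag.exists_node_tangent (h : IsFlag P v i j k) (hN : 3 ≤ N) (hP : GeneralPosition P)
    {y : resolution P} (hl : IsLift v y.1) (hij : cc v i j = 0) (hk2 : rowVal P k 2 (pB v) = 0)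
    (hj2 : rowVal P j 2 (pB v) = 0) (hi2 : rowVal P i 2 (pB v) = 0) :
    ∃ w ∈ coneTangent (resolution P) v, ccLin w i j ≠ 0 ∧ pB w = 0 := by
  obtain ⟨w, hw, hM⟩ := h.exists_tangent hN hP hl ![1, 0, 0, 0]
  have h0 : ccLin w i j * cc v j i - cc v i j * ccLin w j i = 1 := congrFun hM 0
  have h2 : rowVal P k 2 (pB w) = 0 := congrFun hM 2
  have h3 : rowVal P i 0 (pB w) = 0 := congrFun hM 3
  have hT1 := cc_row_of_mem_coneTangent hN hP hl hw
  have h5 : rowVal P j 2 (pB w) = 0 := by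
    have := hT1 j k
    rw [h2, hk2, hj2] at this
    refine (mul_eq_zero.1 (?_ : cc v k j * rowVal P j 2 (pB w) = 0)).resolve_left h.kj
    linear_combination -this
  have h4 : rowVal P i 2 (pB w) = 0 := by
    have := hT1 i j
    rw [h5, hj2, hi2] at this
    refine (mul_eq_zero.1 (?_ : cc v j i * rowVal P i 2 (pB w) = 0)).resolve_left h.ji
    linear_combination -this
  refine ⟨w, hw, fun h' => ?_, hP.eq_zero (injective_flag_rows h.ij h.ik h.jk) fun b => ?_⟩
  · rw [hij, h'] at h0
    simp at h0
  · fin_cases b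
    exacts [h3, h4, h5, h2]

/-- A linear form that is non-zero on the tangent directions of the line of camera `i` and on all
transversal directions over common points of three camera planes is non-zero on the image of the
tangent space at every point over the line. -/
lemma PointData.exists_tangent_ne_zero (hN : 3 ≤ N) (hP : GeneralPosition P)
    {φ' : resolution P → ℙ ℂ (ImgIndex N → ℂ)} {y : resolution P}
    {F : ImgIndex N → MvPolynomial (Coord (dims₂ N)) ℂ} (h : PointData P φ' y v F)
    (hXl : OnLine i (fun t => aeval v (F t))) (hLX : L (fun t => aeval v (F t)) = 0)
    (ha : L (lineVec i a) ≠ 0) {q r : Fin 4 → ℂ} (hq : ∀ s, rowVal P i s q = 0)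
    (hqm : ∀ m, m ≠ i → rowVal P m 2 q ≠ 0)
    (hr : ∀ b : Fin 2, rowVal P i b.castSucc r = a b) (hr2 : rowVal P i 2 r = 0)
    (hnode : ∀ j k p, i ≠ j → i ≠ k → j ≠ k → p ≠ 0 → rowVal P i 2 p = 0 → rowVal P j 2 p = 0 →
      rowVal P k 2 p = 0 → L (nodeVec P q j k p) ≠ 0) :
    ∃ w ∈ coneTangent (resolution P) v, L (familyDifferential F v w) ≠ 0 := by
  have hX := h.imgRel hN hP
  have hX0 := h.ne_zero
  rcases h.flag_or_center hN hP with ⟨i', j, k, hf⟩ | ⟨i', r₀, hc⟩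
  · obtain rfl := hf.first_eq hX0 hXl hX
    obtain ⟨-, -, -, hij, hi2⟩ := hf.exists_coef_of_onLine hX0 hXl hX
    have key : ∀ r, (∀ b : Fin 2, rowVal P i' b.castSucc r = a b) → rowVal P i' 2 r = 0 →
        (rowVal P k 2 (pB v) ≠ 0 ∨ cc v j k * rowVal P k 2 r = cc v k j * rowVal P j 2 r) →
        ∃ w ∈ coneTangent (resolution P) v, L (familyDifferential F v w) ≠ 0 := by
      intro r hr hr2 hs
      obtain ⟨w, hw, hw0, hpw⟩ := hf.exists_plane_tangent hN hP h.lift hij hr2 hs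
      obtain ⟨κ, d, hκ, hU⟩ := hf.image_eq_lineVec hX0 hXl hX (h.tangentData hN hP hw) hw0
      refine ⟨w, hw, ?_⟩
      rw [hU, map_add, map_smul, map_smul, hLX, smul_zero, add_zero, hpw, funext hr]
      exact smul_ne_zero hκ ha
    by_cases hk2 : rowVal P k 2 (pB v) = 0
    swap
    · exact key r hr hr2 (Or.inl hk2)
    -- Here the point lies over `p_{ijk}`. Adding a multiple of `q` to `r` keeps the image in camera
    -- `i` and corrects the ratio `h_j : h_k`, unless the ratio is that of `q` itself. In that case
    -- the line through the center meets the exceptional curve, and a direction transversal to the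
    -- plane is used.
    by_cases hqq : cc v j k * rowVal P k 2 q = cc v k j * rowVal P j 2 q
    · have hj2 : rowVal P j 2 (pB v) = 0 := by
        have := h.iPoint.cc_row j k
        rw [hk2, mul_zero] at this
        exact (mul_eq_zero.1 this.symm).resolve_left hf.kj
      obtain ⟨w, hw, hw0, hpw⟩ := hf.exists_node_tangent hN hP h.lift hij hk2 hj2 hi2
      obtain ⟨c, d, hc, hU⟩ := hf.image_eq_nodeVec hX0 hXl hX (h.tangentData hN hP hw)
        (hqm k hf.ik.symm) hqq hj2 hw0 hpw
      refine ⟨w, hw, ?_⟩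
      rw [hU, map_add, map_smul, map_smul, hLX, smul_zero, add_zero]
      exact smul_ne_zero hc (hnode j k _ hf.ij hf.ik hf.jk h.pB_ne_zero hi2 hj2 hk2)
    · set D := cc v j k * rowVal P k 2 q - cc v k j * rowVal P j 2 q with hD
      have hD0 : D ≠ 0 := sub_ne_zero.2 hqq
      set θ := -(cc v j k * rowVal P k 2 r - cc v k j * rowVal P j 2 r) / D with hθ
      refine key (fun l => r l + θ * q l) (fun b => ?_) ?_ (Or.inr ?_)
      · rw [rowVal_add, rowVal_smul, hq, hr]; ring
      · rw [rowVal_add, rowVal_smul, hq, hr2]; ring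
      · rw [rowVal_add, rowVal_smul, rowVal_add, rowVal_smul]
        have : θ * D = -(cc v j k * rowVal P k 2 r - cc v k j * rowVal P j 2 r) :=
          div_mul_cancel₀ _ hD0
        rw [hD] at this
        linear_combination this
  · obtain ⟨s, hs⟩ := hc.coef_ne_zero hX0 (hX.centerRel i')
    have : i' = i := by
      by_contra hi
      exact hs (hXl.xx_eq_zero hi s)
    subst this
    obtain ⟨w, hw, c, hM⟩ := hc.exists_tangent hN hP h.lift ![a 0, a 1, 0, 0]
    obtain ⟨κ, d, hκ, hU⟩ := hc.image_eq_lineVec hX0 hXl hX (h.tangentData hN hP hw) hM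
    refine ⟨w, hw, ?_⟩
    rw [hU, map_add, map_smul, map_smul, hLX, smul_zero, add_zero]
    exact smul_ne_zero hκ ha

end LineVectors

/-! ### Transversality expressed by linear forms. -/

section Dual

variable {T : Type*} [AddCommGroup T] [Module ℂ T]

lemma sup_ne_top_of_le_ker {V R : Submodule ℂ T} {f : T →ₗ[ℂ] ℂ} (hf : f ≠ 0)
    (hV : V ≤ LinearMap.ker f) (hR : R ≤ LinearMap.ker f) : V ⊔ R ≠ ⊤ := fun h =>
  hf (LinearMap.ker_eq_top.1 (eq_top_iff.2 (h ▸ sup_le hV hR)))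

lemma ker_sup_eq_top {R : Submodule ℂ T} {f : T →ₗ[ℂ] ℂ} {t : T} (ht : t ∈ R) (hf : f t ≠ 0) :
    LinearMap.ker f ⊔ R = ⊤ := by
  rw [eq_top_iff]
  rintro s -
  refine Submodule.mem_sup.2 ⟨s - (f s / f t) • t, ?_, (f s / f t) • t, R.smul_mem _ ht, by simp⟩
  rw [LinearMap.mem_ker, map_sub, map_smul, smul_eq_mul]
  field_simp
  ring

end Dual

/-! ### The last two discriminants along the lines. -/

section Lines

variable {N : ℕ} {P : Fin N → Matrix (Fin 3) (Fin 4) ℂ} {φ' : resolution P → ℙ ℂ (ImgIndex N → ℂ)}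
  {i : Fin N}

lemma IsResolvedMap.exists_critical_pointData (hN : 3 ≤ N) (hP : GeneralPosition P)
    (hφ : IsResolvedMap P φ') {u : ImgIndex N → ℂ} (hu : u ≠ 0) (hul : OnLine i u)
    {L : (ImgIndex N → ℂ) →ₗ[ℂ] ℂ} (hL : ∀ b, L (Pi.single (some (i, b)) 1) = 0) :
    ∃ y v F, PointData P φ' y v F ∧ φ' y = Projectivization.mk ℂ u hu ∧
      ∀ w ∈ coneTangent (resolution P) v, L (familyDifferential F v w) = 0 := by
  obtain ⟨b0, hb0⟩ := hul.exists_ne_zero hu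
  obtain ⟨v, hI, hv, hcrit⟩ := exists_isCritical (x := fun b => u (some (i, b))) hN hP
    (fun h => hb0 (congrFun h b0)) hL
  set y : resolution P := ⟨_, (mem_resolution_iff hN hP (isLift_ofLift v hv)).2 hI⟩
  obtain ⟨F, hF⟩ := hφ.exists_pointData_of_lift hN hP y (isLift_ofLift v hv)
  obtain ⟨⟨hXl, hXu⟩, hcrit⟩ := hcrit _ (hF.imgRel hN hP)
  refine ⟨y, v, F, hF, ?_, fun w hw => hcrit w _ (hF.tangentData hN hP hw)⟩
  rw [← hF.map_eq]
  refine mk_eq_mk_of_cross _ _ fun s t => ?_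
  by_cases hs : ∀ b, s ≠ some (i, b)
  · rw [hul s hs, show aeval v (F s) = 0 from hXl s hs]; ring
  by_cases ht : ∀ b, t ≠ some (i, b)
  · rw [hul t ht, show aeval v (F t) = 0 from hXl t ht]; ring
  push Not at hs ht
  obtain ⟨b, rfl⟩ := hs
  obtain ⟨b', rfl⟩ := ht
  exact hXu b' b

lemma eq_sum_single_of_onLine {u : ImgIndex N → ℂ} (hul : OnLine i u) :
    u = ∑ b, u (some (i, b)) • Pi.single (some (i, b)) (1 : ℂ) := by
  obtain ⟨h1, h2⟩ := onLine_iff.1 hul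
  funext t
  rw [Finset.sum_apply]
  rcases t with - | ⟨m, b⟩
  · simp [h1]
  · by_cases hm : m = i
    · subst hm
      simp [Pi.single_apply]
    · simp [hm, h2 m hm b]

/-- A subspace of dimension `2N - 2` and the tangent direction of the line together lie in a
hyperplane. At a critical point of the fibre for this hyperplane the image of the tangent space lies
in it as well. -/
lemma coordLine_subset_higherDiscriminant (hN : 3 ≤ N) (hP : GeneralPosition P)
    (hφ : IsResolvedMap P φ') (i : Fin N) :
    coordLine i ⊆ higherDiscriminant (resolution P) φ' (2 * N - 1) := by
  rintro x ⟨u, hu, hul, hx⟩ V hV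
  obtain ⟨b0, hb0⟩ := hul.exists_ne_zero hu
  obtain ⟨b1, hb1⟩ : ∃ b1, b1 ≠ b0 := exists_ne b0
  set e : Fin 2 → (ImgIndex N → ℂ) := fun b => Pi.single (some (i, b)) 1 with he
  -- As `u` has a nonzero coordinate at `b0`, the other coordinate vector spans the tangent
  -- direction of the line.
  obtain ⟨t, ht⟩ : ∃ t : ProjTangent x, t = x.submodule.mkQ (e b1) := ⟨_, rfl⟩
  have hle : V ⊔ Submodule.span ℂ {t} < ⊤ := lt_top_iff_ne_top.2 fun htop => by
    have h1 := Submodule.finrank_add_le_finrank_add_finrank V (Submodule.span ℂ {t})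
    have h2 := finrank_span_le_card (R := ℂ) ({t} : Set (ProjTangent x))
    rw [htop, finrank_top, finrank_projTangent] at h1
    rw [Set.toFinset_singleton, Finset.card_singleton] at h2
    omega
  obtain ⟨f, hf, hfV⟩ := Submodule.exists_le_ker_of_lt_top _ hle
  set L := f ∘ₗ x.submodule.mkQ with hLdef
  have hLu : L u = 0 := by
    have : x.submodule.mkQ u = 0 := (Submodule.Quotient.mk_eq_zero _).2 (by
      rw [← hx]
      exact mem_projectivization_submodule.2 ⟨1, fun t => (one_mul _).symm⟩)
    rw [hLdef, LinearMap.comp_apply, this, map_zero]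
  have hL1 : L (e b1) = 0 := by
    rw [hLdef, LinearMap.comp_apply, ← ht]
    exact hfV (Submodule.mem_sup_right (Submodule.mem_span_singleton_self t))
  have hL : ∀ b, L (e b) = 0 := fun b => by
    by_cases hb : b = b0
    · subst hb
      rw [eq_sum_single_of_onLine hul, map_sum, Finset.sum_eq_single b] at hLu
      · rw [map_smul, smul_eq_mul] at hLu
        exact (mul_eq_zero.1 hLu).resolve_left hb0
      · intro b' _ hb'
        have : b' = b1 := by omega
        rw [this, map_smul]
        exact (congrArg _ hL1).trans (smul_zero _)
      · simp
    · have : b = b1 := by omega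
      rw [this, hL1]
  obtain ⟨y, v, F, hF, hy, hw⟩ := hφ.exists_critical_pointData hN hP hu hul hL
  rw [hx] at hy
  refine ⟨y, hy, sup_ne_top_of_le_ker hf (le_sup_left.trans hfV) ?_⟩
  rw [hF.differentialRange_eq hy]
  rintro _ ⟨w, hwW, rfl⟩
  exact hw w hwW

/-- The transversal directions are not tangent to the line. -/
lemma mkQ_nodeVec_ne_zero (hP : GeneralPosition P) {u : ImgIndex N → ℂ} (hu : u ≠ 0)
    (hul : OnLine i u) {q p : Fin 4 → ℂ} {j k : Fin N} (hij : i ≠ j) (hp : p ≠ 0)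
    (hqk : rowVal P k 2 q ≠ 0) (hi : rowVal P i 2 p = 0) (hj : rowVal P j 2 p = 0) :
    (Projectivization.mk ℂ u hu).submodule.mkQ (nodeVec P q j k p) ≠ 0 := fun h => by
  obtain ⟨c, hc⟩ := mem_projectivization_submodule.1 ((Submodule.Quotient.mk_eq_zero _).1 h)
  obtain ⟨s, hs⟩ := hP.not_center hij hp hi hj j
  have key : ∀ b : Fin 2, rowVal P j b.castSucc p = 0 := fun b => by
    have := hc (some (j, b))
    rw [(onLine_iff.1 hul).2 j hij.symm b, mul_zero] at this
    simp only [nodeVec, if_pos] at this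
    exact (mul_eq_zero.1 this).resolve_left hqk
  fin_cases s
  exacts [hs (key 0), hs (key 1), hs hj]

lemma exists_eq_mul_of_three_planes (hP : GeneralPosition P) {j k : Fin N} (hij : i ≠ j)
    (hik : i ≠ k) (hjk : j ≠ k) : ∃ p₀ : Fin 4 → ℂ, p₀ ≠ 0 ∧ rowVal P i 2 p₀ = 0 ∧
      rowVal P j 2 p₀ = 0 ∧ ∀ p : Fin 4 → ℂ, rowVal P i 2 p = 0 → rowVal P j 2 p = 0 →
        rowVal P k 2 p = 0 → ∃ c : ℂ, p = fun l => c * p₀ l := by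
  have hρ := injective_flag_rows hij hik hjk
  obtain ⟨p₀, hp₀⟩ := hP.exists_rowVal_eq (R := ℂ) hρ ![1, 0, 0, 0]
  have h0 : rowVal P i 0 p₀ = 1 := hp₀ 0
  refine ⟨p₀, ?_, hp₀ 1, hp₀ 2, fun p h1 h2 h3 => ⟨rowVal P i 0 p, hP.ext_rowVal hρ fun b => ?_⟩⟩
  · rintro rfl
    rw [rowVal_zero] at h0
    exact zero_ne_one h0
  · rw [rowVal_smul, hp₀]
    fin_cases b
    exacts [(mul_one _).symm, h1.trans (mul_zero _).symm, h2.trans (mul_zero _).symm,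
      h3.trans (mul_zero _).symm]

/-- A general hyperplane of the tangent space is transversal at every point of the fibre, because
only finitely many directions have to be avoided. -/
lemma notMem_higherDiscriminant_of_mem_coordLine (hN : 3 ≤ N) (hP : GeneralPosition P)
    (hφ : IsResolvedMap P φ') {x : ℙ ℂ (ImgIndex N → ℂ)} (hx : x ∈ coordLine i) :
    x ∉ higherDiscriminant (resolution P) φ' (2 * N) := by
  obtain ⟨u, hu, hul, rfl⟩ := hx
  intro hdisc
  set x := Projectivization.mk ℂ u hu with hx
  obtain ⟨b0, hb0⟩ := hul.exists_ne_zero hu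
  obtain ⟨b1, hb1⟩ : ∃ b1, b1 ≠ b0 := exists_ne b0
  set a : Fin 2 → ℂ := Pi.single b1 1 with ha
  obtain ⟨q, r, r', hfib⟩ := exists_isFibre hN hP i a
  have hδ : x.submodule.mkQ (lineVec i a) ≠ 0 := fun h => by
    obtain ⟨c, hc⟩ := mem_projectivization_submodule.1 ((Submodule.Quotient.mk_eq_zero _).1 h)
    have h0 := hc (some (i, b0))
    have h1 := hc (some (i, b1))
    simp only [lineVec, if_pos, ha, Pi.single_eq_same, Pi.single_eq_of_ne hb1.symm] at h0 h1
    rw [(mul_eq_zero.1 h0.symm).resolve_right hb0, zero_mul] at h1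
    exact one_ne_zero h1
  have hnode : ∀ jk : Fin N × Fin N, ∃ n : ProjTangent x, n ≠ 0 ∧
      (i ≠ jk.1 → i ≠ jk.2 → jk.1 ≠ jk.2 → ∀ p : Fin 4 → ℂ, rowVal P i 2 p = 0 →
        rowVal P jk.1 2 p = 0 → rowVal P jk.2 2 p = 0 →
        ∃ c : ℂ, x.submodule.mkQ (nodeVec P q jk.1 jk.2 p) = c • n) := by
    rintro ⟨j, k⟩
    by_cases h : i ≠ j ∧ i ≠ k ∧ j ≠ k
    · obtain ⟨hij, hik, hjk⟩ := h
      obtain ⟨p₀, hp₀, h1, h2, hp⟩ := exists_eq_mul_of_three_planes hP hij hik hjk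
      refine ⟨_, mkQ_nodeVec_ne_zero hP hu hul hij hp₀ (hfib.other k hik.symm) h1 h2,
        fun _ _ _ p h1 h2 h3 => ?_⟩
      obtain ⟨c, rfl⟩ := hp p h1 h2 h3
      exact ⟨c, by rw [nodeVec_smul, map_smul]⟩
    · exact ⟨_, hδ, fun h1 h2 h3 => (h ⟨h1, h2, h3⟩).elim⟩
  choose n hn hnp using hnode
  -- Finitely many nonzero vectors over an infinite field have a common linear form vanishing on
  -- none of them.
  obtain ⟨f, hf⟩ := Module.exists_dual_forall_apply_ne_zero (K := ℂ)
    (fun o : Option (Fin N × Fin N) => o.elim (x.submodule.mkQ (lineVec i a)) n)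
    (by rintro (- | jk); exacts [hδ, hn jk])
  have hf0 : f ≠ 0 := fun h => hf none (by rw [h]; rfl)
  have hker := Module.Dual.finrank_ker_add_one_of_ne_zero hf0
  rw [finrank_projTangent] at hker
  obtain ⟨y, hy, htop⟩ := hdisc (LinearMap.ker f) hker
  obtain ⟨v, F, hF⟩ := hφ.exists_pointData hN hP y
  have hXl : OnLine i (fun t => aeval v (F t)) := by
    rw [← OnLine.mk_mem hF.ne_zero, hF.map_eq, hy]
    exact ⟨u, hu, hul, rfl⟩
  have hX : x.submodule.mkQ (fun t => aeval v (F t)) = 0 := by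
    rw [← hy, ← hF.map_eq]
    exact (Submodule.Quotient.mk_eq_zero _).2
      (mem_projectivization_submodule.2 ⟨1, fun t => (one_mul _).symm⟩)
  obtain ⟨w, hw, hwL⟩ := hF.exists_tangent_ne_zero (L := f ∘ₗ x.submodule.mkQ) hN hP hXl
    (by rw [LinearMap.comp_apply, hX, map_zero]) (hf none) hfib.center hfib.other hfib.image
    hfib.plane fun j k p hij hik hjk hp h1 h2 h3 => by
      obtain ⟨c, hc⟩ := hnp (j, k) hij hik hjk p h1 h2 h3
      have hc0 : c ≠ 0 := by
        rintro rfl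
        rw [zero_smul] at hc
        exact mkQ_nodeVec_ne_zero hP hu hul hij hp (hfib.other k hik.symm) h1 h2 hc
      rw [LinearMap.comp_apply, hc, map_smul]
      exact smul_ne_zero hc0 (hf (some (j, k)))
  refine htop (ker_sup_eq_top (t := x.submodule.mkQ (familyDifferential F v w)) ?_ hwL)
  rw [hF.differentialRange_eq hy]
  exact ⟨w, hw, rfl⟩

end Lines

end Multiview

end

/-! ### The theorem. -/

theorem mainTheorem4 {N : ℕ} (hN : 3 ≤ N) (P : Fin N → Matrix (Fin 3) (Fin 4) ℂ)
    (hP : Multiview.GeneralPosition P) (hc : ¬ Multiview.CollinearCenters P) :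
    (∃ φ', Multiview.IsResolvedMap P φ') ∧
    ∀ φ', Multiview.IsResolvedMap P φ' →
      Multiview.higherDiscriminant (Multiview.resolution P) φ' (2 * N - 3) =
          Multiview.multiviewVariety P ∧
      Multiview.higherDiscriminant (Multiview.resolution P) φ' (2 * N - 2) =
          ⋃ i, Multiview.cameraPlaneImage P φ' i ∧
      Multiview.higherDiscriminant (Multiview.resolution P) φ' (2 * N - 1) =
          ⋃ i, Multiview.cameraPlaneImage P φ' i ∧
      Multiview.higherDiscriminant (Multiview.resolution P) φ' (2 * N) = ∅ ∧
      Pairwise (fun i j => Disjoint (Multiview.cameraPlaneImage P φ' i)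
        (Multiview.cameraPlaneImage P φ' j)) ∧
      ∀ i, Multiview.IsProjectiveLine (Multiview.cameraPlaneImage P φ' i) := by
  refine ⟨Multiview.exists_resolvedMap hN hP, fun φ' hφ => ?_⟩
  simp only [Multiview.cameraPlaneImage_eq hN hP hφ]
  -- The discriminant of index `2N - 2` lies in the union of the lines, the union in that of index
  -- `2N - 1`, and the latter in the first by monotonicity; so all three agree. That of index `2N`
  -- lies in them and contains no point of a line.
  have h1 := Multiview.higherDiscriminant_subset_iUnion hN hP hc hφ
  have h2 := Set.iUnion_subset (Multiview.coordLine_subset_higherDiscriminant hN hP hφ)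
  have h3 : Multiview.higherDiscriminant (Multiview.resolution P) φ' (2 * N - 1) ⊆
      Multiview.higherDiscriminant (Multiview.resolution P) φ' (2 * N - 2) := by
    have := Multiview.higherDiscriminant_succ_subset (Y := Multiview.resolution P) (f := φ')
      (m := 2 * N - 2) (by omega)
    rwa [show 2 * N - 2 + 1 = 2 * N - 1 by omega] at this
  have h4 : Multiview.higherDiscriminant (Multiview.resolution P) φ' (2 * N) ⊆
      Multiview.higherDiscriminant (Multiview.resolution P) φ' (2 * N - 1) := by
    have := Multiview.higherDiscriminant_succ_subset (Y := Multiview.resolution P) (f := φ')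
      (m := 2 * N - 1) (by omega)
    rwa [show 2 * N - 1 + 1 = 2 * N by omega] at this
  refine ⟨Multiview.higherDiscriminant_eq_multiviewVariety hN hP hφ, h1.antisymm (h2.trans h3),
    (h3.trans h1).antisymm h2, Set.eq_empty_of_forall_notMem fun x hx => ?_,
    fun i j hij => Multiview.coordLine_disjoint hij, Multiview.isProjectiveLine_coordLine⟩
  obtain ⟨i, hi⟩ := Set.mem_iUnion.1 (h1 (h3 (h4 hx)))
  exact Multiview.notMem_higherDiscriminant_of_mem_coordLine hN hP hφ hi hx
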